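/- Let $J\colon \mathbf{Cat}\to\mathbf{CAT}$ be the inclusion of the 2-category of small categories into the 2-category of locally small categories. Let $P$ be the relative pseudomonad of presheaves over $J$: it sends a small category $X$ to $PX=[X^{\mathrm{op}},\mathbf{Set}]$, its unit $i_X\colon JX\to PX$ is the Yoneda embedding, for a functor $f\colon JX\to PY$ the functor $f^*\colon PX\to PY$ is the left Kan extension of $f$ along $i_X$, that is $f^*(p)(y)=\int^{x\in X} f(x)(y)\times p(x)$, and it has the canonical isomorphisms $\mu_{f,g}\colon (g^*f)^*\cong g^*f^*$, $\eta_f\colon f\cong f^*i_X$ and $\theta_X\colon i_X^*\cong 1_{PX}$. Let $S$ be the 2-monad on $\mathbf{CAT}$ (restricting to $\mathbf{Cat}$ along $J$) for one of the following structures: strict monoidal categories; symmetric strict monoidal categories; strict monoidal categories whose unit is terminal; symmetric strict monoidal categories whose unit is terminal. Thus $SX$ is the free such category on $X$, whose objects are the finite tuples of objects of $X$, and the multiplication and the unit of $S$ are given by concatenation and by tuples of length one. Then $P$ has a lifting to pseudo-$S$-algebras, $\bar P\colon S\text{-}\mathrm{Alg}_{\mathbf{Cat}}\to \mathrm{Ps}\text{-}S\text{-}\mathrm{Alg}_{\mathbf{CAT}}$.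 Explicitly, there exist * a pseudo-$S$-algebra structure on $PA$ for every small strict $S$-algebra $A$; * a pseudomorphism structure on $f^*\colon PA\to PB$ for all small strict $S$-algebras $A$, $B$ and every pseudomorphism $f\colon JA\to PB$; * a pseudomorphism structure on $i_A\colon JA\to PA$ for every small strict $S$-algebra $A$; such that * if $\alpha\colon f\to f'$ is an algebra 2-cell between pseudomorphisms $JA\to PB$, then $\alpha^*\colon f^*\to f'^*$ is an algebra 2-cell; * $\mu_{f,g}\colon (g^*f)^*\to g^*f^*$ is an algebra 2-cell for all pseudomorphisms $f\colon JA\to PB$ and $g\colon JB\to PC$; * $\eta_f\colon f\to f^*i_A$ is an algebra 2-cell for every pseudomorphism $f\colon JA\to PB$; * $\theta_A\colon i_A^*\to 1_{PA}$ is an algebra 2-cell for every small strict $S$-algebra $A$. -/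

import Mathlib

open CategoryTheory Bicategory

universe w v u w₁ v₁ u₁ w₂ v₂ u₂ v₃ u₃

namespace PseudoLift

section TwoMonads

variable {B : Type u} [Bicategory.{w, v} B] [Bicategory.Strict B]

/-- A 2-monad on a 2-category: a 2-functor `S` with 2-natural transformations `mul` and `unit`
satisfying the monad axioms strictly. The `eqToHom`s only mediate between composite 1-cells that
are equal. Composition is written in diagrammatic order. -/
structure TwoMonad (B : Type u) [Bicategory.{w, v} B] [Bicategory.Strict B] where
  S : StrictPseudofunctor B B
  mul (X : B) : S.obj (S.obj X) ⟶ S.obj X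
  unit (X : B) : X ⟶ S.obj X
  mul_naturality {X Y : B} (f : X ⟶ Y) : S.map (S.map f) ≫ mul Y = mul X ≫ S.map f
  mul_naturality₂ {X Y : B} {f g : X ⟶ Y} (α : f ⟶ g) :
    S.map₂ (S.map₂ α) ▷ mul Y ≫ eqToHom (mul_naturality g) =
      eqToHom (mul_naturality f) ≫ mul X ◁ S.map₂ α
  unit_naturality {X Y : B} (f : X ⟶ Y) : f ≫ unit Y = unit X ≫ S.map f
  unit_naturality₂ {X Y : B} {f g : X ⟶ Y} (α : f ⟶ g) :
    α ▷ unit Y ≫ eqToHom (unit_naturality g) =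
      eqToHom (unit_naturality f) ≫ unit X ◁ S.map₂ α
  mul_assoc (X : B) : S.map (mul X) ≫ mul X = mul (S.obj X) ≫ mul X
  unit_mul (X : B) : unit (S.obj X) ≫ mul X = 𝟙 (S.obj X)
  map_unit_mul (X : B) : S.map (unit X) ≫ mul X = 𝟙 (S.obj X)

variable (T : TwoMonad B)

/-- A strict algebra structure on the object `A`. -/
structure StrictAlgebraStr (A : B) where
  str : T.S.obj A ⟶ A
  assoc : T.S.map str ≫ str = T.mul A ≫ str
  unit : 𝟙 A = T.unit A ≫ str

/-- A strict algebra: an object with a strict algebra structure. -/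
structure StrictAlgebra where
  obj : B
  alg : StrictAlgebraStr T obj

/-- A pseudoalgebra structure on the object `A`: a structure map, an invertible associativity
2-cell and an invertible unit 2-cell, subject to the two coherence axioms: the associativity axiom
(two ways from `S S a`, `S a`, `a` to `m S`, `m`, `a` agree) and the unit axiom (the unit 2-cell
under `S` followed by the associativity 2-cell restricted along `S e` is the identity). The
analogous equation for the associativity 2-cell restricted along `e S` follows from these two. -/
structure PseudoAlgebraStr (A : B) where
  str : T.S.obj A ⟶ A
  assoc : T.S.map str ≫ str ≅ T.mul A ≫ str
  unit : 𝟙 A ≅ T.unit A ≫ str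
  assoc_coherence :
    T.S.map₂ assoc.hom ▷ str ≫
      eqToHom (by rw [T.S.map_comp, Strict.assoc]) ≫
      T.S.map (T.mul A) ◁ assoc.hom ≫
      eqToHom (by rw [← Strict.assoc, T.mul_assoc, Strict.assoc]) =
    eqToHom (by rw [T.S.map_comp, Strict.assoc]) ≫
      T.S.map (T.S.map str) ◁ assoc.hom ≫
      eqToHom (by rw [← Strict.assoc, T.mul_naturality, Strict.assoc]) ≫
      T.mul (T.S.obj A) ◁ assoc.hom
  unit_coherence :
    T.S.map₂ unit.hom ▷ str ≫
      eqToHom (by rw [T.S.map_comp, Strict.assoc]) ≫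
      T.S.map (T.unit A) ◁ assoc.hom =
    eqToHom (by rw [T.S.map_id, ← Strict.assoc, T.map_unit_mul])

variable {T}

/-- A strict algebra is a pseudoalgebra whose associativity and unit 2-cells are identities. -/
def StrictAlgebraStr.toPseudo {A : B} (a : StrictAlgebraStr T A) : PseudoAlgebraStr T A where
  str := a.str
  assoc := eqToIso a.assoc
  unit := eqToIso a.unit
  assoc_coherence := by simp [PrelaxFunctor.map₂_eqToHom]
  unit_coherence := by simp [PrelaxFunctor.map₂_eqToHom]

/-- A pseudomorphism structure on the 1-cell `f` between pseudoalgebras: an invertible 2-cell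
compatible with the associativity and with the unit 2-cells. -/
structure PseudoMorphismStr {A A' : B} (a : PseudoAlgebraStr T A) (a' : PseudoAlgebraStr T A')
    (f : A ⟶ A') where
  cell : T.S.map f ≫ a'.str ≅ a.str ≫ f
  assoc_coherence :
    T.S.map (T.S.map f) ◁ a'.assoc.hom ≫
      eqToHom (by rw [← Strict.assoc, T.mul_naturality, Strict.assoc]) ≫
      T.mul A ◁ cell.hom ≫
      eqToHom (by rw [Strict.assoc]) =
    eqToHom (by rw [T.S.map_comp, Strict.assoc]) ≫
      T.S.map₂ cell.hom ▷ a'.str ≫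
      eqToHom (by rw [T.S.map_comp, Strict.assoc]) ≫
      T.S.map a.str ◁ cell.hom ≫
      eqToHom (by rw [Strict.assoc]) ≫
      a.assoc.hom ▷ f
  unit_coherence :
    f ◁ a'.unit.hom ≫
      eqToHom (by rw [← Strict.assoc, T.unit_naturality, Strict.assoc]) ≫
      T.unit A ◁ cell.hom =
    eqToHom (by rw [Strict.id_comp, Strict.comp_id]) ≫
      a.unit.hom ▷ f ≫ eqToHom (by rw [Strict.assoc])

/-- The condition for a 2-cell between (the 1-cells of) two pseudomorphisms to be an
algebra 2-cell. -/
def IsAlgebraTwoCell {A A' : B} {a : PseudoAlgebraStr T A} {a' : PseudoAlgebraStr T A'}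
    {f g : A ⟶ A'} (F : PseudoMorphismStr a a' f) (G : PseudoMorphismStr a a' g)
    (α : f ⟶ g) : Prop :=
  T.S.map₂ α ▷ a'.str ≫ G.cell.hom = F.cell.hom ≫ a.str ◁ α

section EqToHomLemmas

theorem eq_comp_eqToHom₁ {C : Type u₁} [Category.{v₁} C] {x₁ x₂ x₃ : C} {η₁ : x₁ ⟶ x₂}
    {p : x₂ = x₃} {θ : x₁ ⟶ x₃} (h : η₁ ≫ eqToHom p = θ) : η₁ = θ ≫ eqToHom p.symm := by
  subst p; simpa using h

theorem eq_comp_eqToHom₃ {C : Type u₁} [Category.{v₁} C] {x₁ x₂ x₃ x₄ x₅ : C} {η₁ : x₁ ⟶ x₂}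
    {η₂ : x₂ ⟶ x₃} {η₃ : x₃ ⟶ x₄} {p : x₄ = x₅} {θ : x₁ ⟶ x₅}
    (h : η₁ ≫ η₂ ≫ η₃ ≫ eqToHom p = θ) : η₁ ≫ η₂ ≫ η₃ = θ ≫ eqToHom p.symm := by
  subst p; simpa using h

theorem whiskerLeft_whiskerLeft_congr {X Y Y' Z W : B} {f : X ⟶ Y} {g : Y ⟶ Z}
    {f' : X ⟶ Y'} {g' : Y' ⟶ Z} (e : f ≫ g = f' ≫ g') {h k : Z ⟶ W} (η : h ⟶ k) :
    f ◁ g ◁ η = eqToHom (by rw [← Strict.assoc, e, Strict.assoc]) ≫ f' ◁ g' ◁ η ≫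
      eqToHom (by rw [← Strict.assoc, ← e, Strict.assoc]) := by
  have := congr_whiskerLeft e η
  simp only [comp_whiskerLeft, Strict.associator_eqToIso, eqToIso.hom, eqToIso.inv,
    Category.assoc, eqToHom_trans, eqToHom_trans_assoc] at this
  rw [eqToHom_comp_iff] at this
  rw [eq_comp_eqToHom₁ this]
  simp

end EqToHomLemmas

namespace PseudoMorphismStr
attribute [local simp] PrelaxFunctor.map₂_eqToHom Strict.associator_eqToIso
  Strict.leftUnitor_eqToIso Strict.rightUnitor_eqToIso StrictPseudofunctor.mapComp_eq_eqToIso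

/-- The identity pseudomorphism. -/
def id {A : B} (a : PseudoAlgebraStr T A) : PseudoMorphismStr a a (𝟙 A) where
  cell := eqToIso (by rw [T.S.map_id, Strict.id_comp, Strict.comp_id])
  assoc_coherence := by
    have h : T.S.map (T.S.map (𝟙 A)) = 𝟙 _ := by rw [T.S.map_id, T.S.map_id]
    rw [congr_whiskerLeft h]
    simp
  unit_coherence := by
    simp

/-- The composite of two pseudomorphisms. -/
def comp {A₁ A₂ A₃ : B} {a₁ : PseudoAlgebraStr T A₁} {a₂ : PseudoAlgebraStr T A₂}
    {a₃ : PseudoAlgebraStr T A₃} {f : A₁ ⟶ A₂} {g : A₂ ⟶ A₃}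
    (F : PseudoMorphismStr a₁ a₂ f) (G : PseudoMorphismStr a₂ a₃ g) :
    PseudoMorphismStr a₁ a₃ (f ≫ g) where
  cell := eqToIso (by rw [T.S.map_comp, Strict.assoc]) ≪≫
    whiskerLeftIso (T.S.map f) G.cell ≪≫ eqToIso (by rw [Strict.assoc]) ≪≫
    whiskerRightIso F.cell g ≪≫ eqToIso (by rw [Strict.assoc])
  assoc_coherence := by
    have k1 := congrArg (fun t => T.S.map (T.S.map f) ◁ t) G.assoc_coherence
    have k2 := congrArg (fun t => t ▷ g) F.assoc_coherence
    have k3 := whisker_exchange (T.S.map₂ F.cell.hom) G.cell.hom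
    have h : T.S.map (T.S.map (f ≫ g)) = T.S.map (T.S.map f) ≫ T.S.map (T.S.map g) := by
      rw [T.S.map_comp, T.S.map_comp]
    have h2 := whiskerLeft_whiskerLeft_congr (T.mul_naturality f).symm G.cell.hom
    rw [congr_whiskerLeft (T.S.map_comp _ _), congr_whiskerLeft (T.S.map_comp _ _)] at k3
    simp at k1 k2 k3
    rw [eqToHom_comp_iff] at k2
    rw [eqToHom_comp_iff] at k3
    replace k1 := eq_comp_eqToHom₃ k1
    replace k2 := eq_comp_eqToHom₃ k2
    replace k3 := eq_comp_eqToHom₃ k3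
    simp at k1 k2 k3
    rw [congr_whiskerLeft h]
    simp [h2, reassoc_of% k1, reassoc_of% k2, reassoc_of% k3]
  unit_coherence := by
    have k1 := congrArg (fun t => f ◁ t) G.unit_coherence
    have k2 := congrArg (fun t => t ▷ g) F.unit_coherence
    have h2 := whiskerLeft_whiskerLeft_congr (T.unit_naturality f).symm G.cell.hom
    simp at k1 k2 ⊢
    rw [eqToHom_comp_iff] at k2
    replace k2 := eq_comp_eqToHom₃ k2
    simp at k2
    simp [h2, reassoc_of% k1, reassoc_of% k2]

end PseudoMorphismStr
end TwoMonads

section Lifting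

variable {B : Type u₁} [Bicategory.{w₁, v₁} B] {C : Type u₂} [Bicategory.{w₂, v₂} C]

/-- A relative pseudomonad over a pseudofunctor `J`: objects `T X`, extension functors
`f ↦ f*`, units `i_X`, and invertible 2-cells `(g* f)* ≅ g* f*` and `f ≅ f* i_X`, natural in `f`
and `g`, and `i_X* ≅ 1`, subject to the associativity and unit axioms.
Composition is written in diagrammatic order. -/
structure RelativePseudomonad (J : B ⥤ᵖ C) where
  obj : B → C
  ext {X Y : B} : (J.obj X ⟶ obj Y) ⥤ (obj X ⟶ obj Y)
  unit (X : B) : J.obj X ⟶ obj X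
  mu {X Y Z : B} (f : J.obj X ⟶ obj Y) (g : J.obj Y ⟶ obj Z) :
    ext.obj (f ≫ ext.obj g) ≅ ext.obj f ≫ ext.obj g
  eta {X Y : B} (f : J.obj X ⟶ obj Y) : f ≅ unit X ≫ ext.obj f
  theta (X : B) : ext.obj (unit X) ≅ 𝟙 (obj X)
  mu_naturality_left {X Y Z : B} {f f' : J.obj X ⟶ obj Y} (α : f ⟶ f') (g : J.obj Y ⟶ obj Z) :
    ext.map (α ▷ ext.obj g) ≫ (mu f' g).hom = (mu f g).hom ≫ ext.map α ▷ ext.obj g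
  mu_naturality_right {X Y Z : B} (f : J.obj X ⟶ obj Y) {g g' : J.obj Y ⟶ obj Z} (β : g ⟶ g') :
    ext.map (f ◁ ext.map β) ≫ (mu f g').hom = (mu f g).hom ≫ ext.obj f ◁ ext.map β
  eta_naturality {X Y : B} {f f' : J.obj X ⟶ obj Y} (α : f ⟶ f') :
    α ≫ (eta f').hom = (eta f).hom ≫ unit X ◁ ext.map α
  assoc {X Y Z V : B} (f : J.obj X ⟶ obj Y) (g : J.obj Y ⟶ obj Z) (h : J.obj Z ⟶ obj V) :
    ext.map (f ◁ (mu g h).hom) ≫ ext.map (α_ f (ext.obj g) (ext.obj h)).inv ≫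
      (mu (f ≫ ext.obj g) h).hom ≫ (mu f g).hom ▷ ext.obj h =
    (mu f (g ≫ ext.obj h)).hom ≫ ext.obj f ◁ (mu g h).hom ≫
      (α_ (ext.obj f) (ext.obj g) (ext.obj h)).inv
  unit_coherence {X Y : B} (f : J.obj X ⟶ obj Y) :
    ext.map (eta f).hom ≫ (mu (unit X) f).hom ≫ (theta X).hom ▷ ext.obj f =
      (λ_ (ext.obj f)).inv

variable [Bicategory.Strict B] [Bicategory.Strict C]

/-- The 2-monad `S` restricts along `J` to the 2-monad `S₀`: `S J` and `J S₀` agree up to an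
isomorphism of objects, strictly 2-natural and strictly compatible with units and multiplications.
(When `J` is literally the inclusion of a sub-2-category, this isomorphism is an equality; here it
absorbs the change of universe.) -/
structure TwoMonad.Restriction (J : StrictPseudofunctor B C) (S₀ : TwoMonad B) (S : TwoMonad C) where
  iso (X : B) : S.S.obj (J.obj X) ≅ J.obj (S₀.S.obj X)
  naturality {X Y : B} (f : X ⟶ Y) :
    S.S.map (J.map f) ≫ (iso Y).hom = (iso X).hom ≫ J.map (S₀.S.map f)
  naturality₂ {X Y : B} {f g : X ⟶ Y} (α : f ⟶ g) :
    S.S.map₂ (J.map₂ α) ▷ (iso Y).hom ≫ eqToHom (naturality g) =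
      eqToHom (naturality f) ≫ (iso X).hom ◁ J.map₂ (S₀.S.map₂ α)
  unit (X : B) : S.unit (J.obj X) ≫ (iso X).hom = J.map (S₀.unit X)
  mul (X : B) : S.mul (J.obj X) ≫ (iso X).hom =
    S.S.map (iso X).hom ≫ (iso (S₀.S.obj X)).hom ≫ J.map (S₀.mul X)

variable {J : StrictPseudofunctor B C} {S₀ : TwoMonad B} {S : TwoMonad C}

/-- The action on objects of the lifting of `J` to strict algebras: the strict `S₀`-algebra `A`
gives a strict `S`-algebra structure on `J A`. -/
def TwoMonad.Restriction.lift (R : TwoMonad.Restriction J S₀ S) (A : StrictAlgebra S₀) :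
    StrictAlgebra S where
  obj := J.obj A.obj
  alg :=
    { str := (R.iso A.obj).hom ≫ J.map A.alg.str
      assoc := by
        rw [← Strict.assoc (S.mul _), R.mul, S.S.map_comp, Strict.assoc,
          ← Strict.assoc (S.S.map (J.map A.alg.str)), R.naturality]
        simp only [Strict.assoc]
        rw [← J.map_comp, A.alg.assoc, J.map_comp]
      unit := by
        rw [← Strict.assoc, R.unit, ← J.map_comp, ← A.alg.unit, J.map_id] }

/-- A lifting of the relative pseudomonad `T` over `J` to pseudoalgebras for `S`, where `S` restricts
along `J` to `S₀`: a pseudoalgebra structure on `T A` for every strict `S₀`-algebra `A`, a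
pseudomorphism structure on `f* : T A → T A'` for every pseudomorphism `f : J A → T A'`, and a
pseudomorphism structure on `i_A : J A → T A`, such that the functors `f ↦ f*` restrict to
pseudomorphisms and algebra 2-cells, and the 2-cells `mu`, `eta`, `theta` of `T` are
algebra 2-cells. -/
structure PseudoLifting (T : RelativePseudomonad J.toPseudofunctor)
    (R : TwoMonad.Restriction J S₀ S) where
  alg (A : StrictAlgebra S₀) : PseudoAlgebraStr S (T.obj A.obj)
  ext {A A' : StrictAlgebra S₀} {f : J.obj A.obj ⟶ T.obj A'.obj}
    (F : PseudoMorphismStr (R.lift A).alg.toPseudo (alg A') f) :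
    PseudoMorphismStr (alg A) (alg A') (T.ext.obj f)
  unit (A : StrictAlgebra S₀) :
    PseudoMorphismStr (R.lift A).alg.toPseudo (alg A) (T.unit A.obj)
  ext_map {A A' : StrictAlgebra S₀} {f f' : J.obj A.obj ⟶ T.obj A'.obj}
    (F : PseudoMorphismStr (R.lift A).alg.toPseudo (alg A') f)
    (F' : PseudoMorphismStr (R.lift A).alg.toPseudo (alg A') f') (α : f ⟶ f') :
    IsAlgebraTwoCell F F' α → IsAlgebraTwoCell (ext F) (ext F') (T.ext.map α)
  mu {A₁ A₂ A₃ : StrictAlgebra S₀} {f : J.obj A₁.obj ⟶ T.obj A₂.obj}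
    {g : J.obj A₂.obj ⟶ T.obj A₃.obj}
    (F : PseudoMorphismStr (R.lift A₁).alg.toPseudo (alg A₂) f)
    (G : PseudoMorphismStr (R.lift A₂).alg.toPseudo (alg A₃) g) :
    IsAlgebraTwoCell (ext (F.comp (ext G))) ((ext F).comp (ext G)) (T.mu f g).hom
  eta {A A' : StrictAlgebra S₀} {f : J.obj A.obj ⟶ T.obj A'.obj}
    (F : PseudoMorphismStr (R.lift A).alg.toPseudo (alg A') f) :
    IsAlgebraTwoCell F ((unit A).comp (ext F)) (T.eta f).hom
  theta (A : StrictAlgebra S₀) :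
    IsAlgebraTwoCell (ext (unit A)) (PseudoMorphismStr.id (alg A)) (T.theta A.obj).hom

end Lifting

/-- The four kinds of structure: strict monoidal categories, symmetric strict monoidal categories,
and those strict (respectively symmetric strict) monoidal categories whose unit is terminal. -/
inductive MonoidalKind
  | strictMonoidal
  | symmetricStrictMonoidal
  | strictMonoidalTerminalUnit
  | symmetricStrictMonoidalTerminalUnit

/-- The reindexing functions underlying the morphisms of the free category with structure of
kind `κ`. A morphism from an `n`-tuple to an `m`-tuple picks, for each of its `m` output positions,
an input position. Each input is used at most once; it may be dropped only if the unit is terminal,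
and the inputs may be permuted only in the symmetric case. (For `strictMonoidal` such a function
is an identity, and for `symmetricStrictMonoidal` it is a permutation.) -/
def MonoidalKind.Admissible (κ : MonoidalKind) {m n : ℕ} (φ : Fin m → Fin n) : Prop :=
  match κ with
  | .strictMonoidal => StrictMono φ ∧ Function.Surjective φ
  | .symmetricStrictMonoidal => Function.Bijective φ
  | .strictMonoidalTerminalUnit => StrictMono φ
  | .symmetricStrictMonoidalTerminalUnit => Function.Injective φ

section flat

theorem finSigmaFinEquiv_lt {m : ℕ} {n : Fin m → ℕ} {a b : (i : Fin m) × Fin (n i)}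
    (h : Sigma.Lex (· < ·) (fun _ => (· < ·)) a b) :
    finSigmaFinEquiv a < finSigmaFinEquiv b := by
  rw [Fin.lt_def, finSigmaFinEquiv_apply, finSigmaFinEquiv_apply]
  have e1 : ∀ k : Fin m, ∑ t : Fin (k : ℕ), n (Fin.castLE k.2.le t) =
      ∑ t ∈ Finset.Iio k, n t := by
    intro k
    refine Finset.sum_bij' (fun t _ => Fin.castLE k.2.le t)
      (fun t ht => ⟨t, by simpa using ht⟩) ?_ ?_ ?_ ?_ ?_
    · intro t _
      simp only [Finset.mem_Iio, Fin.lt_def]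
      exact t.2
    all_goals simp
  rw [e1, e1]
  cases h with
  | @left i j x y h =>
    have h1 : ∑ t ∈ Finset.Iio i, n t + n i ≤ ∑ t ∈ Finset.Iio j, n t := by
      rw [add_comm, ← Finset.sum_insert (by simp)]
      refine Finset.sum_le_sum_of_subset ?_
      intro t ht
      simp only [Finset.mem_insert, Finset.mem_Iio] at ht ⊢
      rcases ht with rfl | ht
      · exact h
      · exact ht.trans h
    have := x.2
    change _ + (x : ℕ) < _ + (y : ℕ)
    change ∑ t ∈ Finset.Iio i, n t + (x : ℕ) < ∑ t ∈ Finset.Iio j, n t + (y : ℕ)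
    omega
  | right x y h =>
    exact Nat.add_lt_add_left h _

theorem finSigmaFinEquiv_lt_iff {m : ℕ} {n : Fin m → ℕ} {a b : (i : Fin m) × Fin (n i)} :
    finSigmaFinEquiv a < finSigmaFinEquiv b ↔ Sigma.Lex (· < ·) (fun _ => (· < ·)) a b := by
  refine ⟨fun h => ?_, finSigmaFinEquiv_lt⟩
  rcases trichotomous_of (Sigma.Lex (· < ·) (fun _ => (· < ·))) a b with h' | rfl | h'
  · exact h'
  · exact absurd h (lt_irrefl _)
  · exact absurd h (finSigmaFinEquiv_lt h').asymm

end flat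

/-- The reindexing of concatenated tuples induced by a reindexing of blocks. -/
def flatIdx {m n : ℕ} {k : Fin m → ℕ} {l : Fin n → ℕ} (φ : Fin n → Fin m)
    (ψ : ∀ j, Fin (l j) → Fin (k (φ j))) (p : Fin (∑ j, l j)) : Fin (∑ i, k i) :=
  finSigmaFinEquiv ⟨φ (finSigmaFinEquiv.symm p).1, ψ _ (finSigmaFinEquiv.symm p).2⟩

namespace MonoidalKind.Admissible
variable {κ : MonoidalKind}

theorem id (n : ℕ) : κ.Admissible (fun i : Fin n => i) := by
  cases κ
  · exact ⟨strictMono_id, Function.surjective_id⟩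
  · exact Function.bijective_id
  · exact strictMono_id
  · exact Function.injective_id

theorem comp {l m n : ℕ} {φ : Fin m → Fin n} {ψ : Fin l → Fin m} (hφ : κ.Admissible φ)
    (hψ : κ.Admissible ψ) : κ.Admissible (fun i => φ (ψ i)) := by
  cases κ
  · exact ⟨hφ.1.comp hψ.1, hφ.2.comp hψ.2⟩
  · exact Function.Bijective.comp hφ hψ
  · exact StrictMono.comp hφ hψ
  · exact Function.Injective.comp hφ hψ

variable {m n : ℕ} {k : Fin m → ℕ} {l : Fin n → ℕ} {φ : Fin n → Fin m}
    {ψ : ∀ j, Fin (l j) → Fin (k (φ j))}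

theorem flat_injective (hφ : Function.Injective φ) (hψ : ∀ j, Function.Injective (ψ j)) :
    Function.Injective (flatIdx φ ψ) := by
  have : Function.Injective (Sigma.map (β₂ := fun i => Fin (k i)) φ ψ) := hφ.sigma_map hψ
  exact finSigmaFinEquiv.injective.comp (this.comp finSigmaFinEquiv.symm.injective)

theorem flat_surjective (hφ : Function.Surjective φ) (hψ : ∀ j, Function.Surjective (ψ j)) :
    Function.Surjective (flatIdx φ ψ) := by
  have : Function.Surjective (Sigma.map (β₂ := fun i => Fin (k i)) φ ψ) := hφ.sigma_map hψ
  exact finSigmaFinEquiv.surjective.comp (this.comp finSigmaFinEquiv.symm.surjective)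

theorem flat_strictMono (hφ : StrictMono φ) (hψ : ∀ j, StrictMono (ψ j)) :
    StrictMono (flatIdx φ ψ) := by
  intro p q h
  obtain ⟨a, rfl⟩ := finSigmaFinEquiv.surjective p
  obtain ⟨b, rfl⟩ := finSigmaFinEquiv.surjective q
  rw [finSigmaFinEquiv_lt_iff] at h
  apply finSigmaFinEquiv_lt
  rw [Equiv.symm_apply_apply, Equiv.symm_apply_apply]
  cases h with
  | left x y h => exact Sigma.Lex.left _ _ (hφ h)
  | right x y h => exact Sigma.Lex.right (s := fun i (a b : Fin (k i)) => a < b) _ _ (hψ _ h)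

theorem flat (hφ : κ.Admissible φ) (hψ : ∀ j, κ.Admissible (ψ j)) :
    κ.Admissible (flatIdx φ ψ) := by
  cases κ
  · exact ⟨flat_strictMono hφ.1 fun j => (hψ j).1, flat_surjective hφ.2 fun j => (hψ j).2⟩
  · exact ⟨flat_injective hφ.1 fun j => (hψ j).1, flat_surjective hφ.2 fun j => (hψ j).2⟩
  · exact flat_strictMono hφ hψ
  · exact flat_injective hφ hψ

end MonoidalKind.Admissible

/-- The objects of the free category with structure of kind `κ` on `X`: finite tuples of objects
of `X`. -/
structure Tuples (κ : MonoidalKind) (X : Type u) where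
  len : ℕ
  get : Fin len → X

namespace Tuples

variable {κ : MonoidalKind}

section
variable {X : Type u} [Category.{v} X]

/-- A morphism of tuples `x → y` is an admissible reindexing `idx` from the positions of `y` to those
of `x` with a family of morphisms `x_{idx j} → y_j`. (The argument `i` of `map` is redundant, since
it is forced to be `idx j`.) -/
@[ext]
structure Hom (x y : Tuples κ X) where
  idx : Fin y.len → Fin x.len
  admissible : κ.Admissible idx
  map (i : Fin x.len) (j : Fin y.len) (_ : idx j = i) : x.get i ⟶ y.get j

/-- The morphism of tuples over the identity reindexing given by a family of morphisms. -/
def homOver {n : ℕ} {x y : Fin n → X} (f : ∀ i, x i ⟶ y i) :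
    Hom (κ := κ) ⟨n, x⟩ ⟨n, y⟩ where
  idx j := j
  admissible := .id n
  map i j h := h ▸ f j

instance : Category (Tuples κ X) where
  Hom := Hom
  id x := homOver fun i => 𝟙 (x.get i)
  comp {x y z} f g :=
    { idx := fun k => f.idx (g.idx k)
      admissible := .comp f.admissible g.admissible
      map := fun i k h => f.map i (g.idx k) h ≫ g.map (g.idx k) k rfl }
  id_comp {x y} f := by
    refine Hom.ext rfl (heq_of_eq ?_)
    funext i j h
    subst h
    simp [homOver]
  comp_id {x y} f := by
    refine Hom.ext rfl (heq_of_eq ?_)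
    funext i j h
    subst h
    simp [homOver]
  assoc f g h := by
    refine Hom.ext rfl (heq_of_eq ?_)
    funext i j h
    simp

theorem hom_ext {x y : Tuples κ X} {f g : x ⟶ y} (h : ∀ j, f.idx j = g.idx j)
    (h' : ∀ i j (hf : f.idx j = i) (hg : g.idx j = i), f.map i j hf = g.map i j hg) : f = g := by
  obtain ⟨φ, hφ, f⟩ := f
  obtain ⟨ψ, hψ, g⟩ := g
  obtain rfl : φ = ψ := funext h
  congr
  funext i j e
  exact h' i j e e

@[simp] theorem id_idx (x : Tuples κ X) (j) : Hom.idx (𝟙 x) j = j := rfl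
@[simp] theorem comp_idx {x y z : Tuples κ X} (f : x ⟶ y) (g : y ⟶ z) (j) :
    (f ≫ g).idx j = f.idx (g.idx j) := rfl

theorem homOver_map {n : ℕ} {x y : Fin n → X} (f : ∀ i, x i ⟶ y i) (i : Fin n) (h) :
    (homOver (κ := κ) f).map i i h = f i := by
  rfl

theorem id_map (x : Tuples κ X) (j) (h) : Hom.map (𝟙 x) j j h = 𝟙 _ :=
  homOver_map _ _ _

theorem comp_map {x y z : Tuples κ X} (f : x ⟶ y) (g : y ⟶ z) (i j k) (h : f.idx j = i)
    (h' : g.idx k = j) (h'' : (f ≫ g).idx k = i) :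
    (f ≫ g).map i k h'' = f.map i j h ≫ g.map j k h' := by
  subst h'; rfl

end

variable {X : Type u} [Category.{v} X] {Y : Type u₂} [Category.{v₂} Y]
  {Z : Type u₃} [Category.{v₃} Z]

/-- The functor between categories of tuples induced by a functor. -/
@[simps]
def mapFunctor (F : X ⥤ Y) : Tuples κ X ⥤ Tuples κ Y where
  obj x := ⟨x.len, fun i => F.obj (x.get i)⟩
  map f :=
    { idx := f.idx
      admissible := f.admissible
      map := fun i j h => F.map (f.map i j h) }
  map_id x := by
    refine hom_ext (fun j => rfl) ?_
    rintro i j rfl h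
    refine Eq.trans ?_ (id_map _ _ _).symm
    refine (congrArg F.map (id_map x j h)).trans (F.map_id _)
  map_comp f g := by
    refine hom_ext (fun j => rfl) ?_
    rintro i j rfl _
    exact F.map_comp _ _

theorem mapFunctor_id : mapFunctor (κ := κ) (𝟭 X) = 𝟭 _ := rfl

theorem mapFunctor_comp (F : X ⥤ Y) (G : Y ⥤ Z) :
    mapFunctor (κ := κ) (F ⋙ G) = mapFunctor F ⋙ mapFunctor G := rfl

/-- The natural transformation induced by a natural transformation. -/
@[simps]
def mapNatTrans {F G : X ⥤ Y} (α : F ⟶ G) : mapFunctor (κ := κ) F ⟶ mapFunctor G where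
  app x := homOver fun i => α.app (x.get i)
  naturality x y f := by
    refine hom_ext (fun j => rfl) ?_
    rintro i j rfl _
    exact α.naturality _

variable (κ X) in
/-- The functor sending `x` to the tuple `(x)` of length one. -/
@[simps]
def unitFunctor : X ⥤ Tuples κ X where
  obj x := ⟨1, fun _ => x⟩
  map f := homOver fun _ => f
  map_id x := rfl
  map_comp f g := by
    refine hom_ext (fun j => rfl) ?_
    rintro i j rfl _
    rfl

/-- The entry of a tuple of tuples at a pair of positions. -/
def getSigma (x : Tuples κ (Tuples κ X)) (a : Σ i, Fin (x.get i).len) : X :=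
  (x.get a.1).get a.2

/-- The reindexing on pairs of positions induced by a morphism of tuples of tuples. -/
def idxSigma {x y : Tuples κ (Tuples κ X)} (f : x ⟶ y) (b : Σ j, Fin (y.get j).len) :
    Σ i, Fin (x.get i).len :=
  ⟨f.idx b.1, (f.map _ b.1 rfl).idx b.2⟩

/-- The components of a morphism of tuples of tuples. -/
def mapSigma {x y : Tuples κ (Tuples κ X)} (f : x ⟶ y) (a : Σ i, Fin (x.get i).len)
    (b : Σ j, Fin (y.get j).len) (h : idxSigma f b = a) :
    (x.get a.1).get a.2 ⟶ (y.get b.1).get b.2 :=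
  (f.map a.1 b.1 (by subst h; rfl)).map a.2 b.2 (by subst h; rfl)

theorem idxSigma_id (x : Tuples κ (Tuples κ X)) (b) : idxSigma (𝟙 x) b = b := by
  refine Sigma.ext rfl (heq_of_eq ?_)
  exact congrArg (fun t => Hom.idx t b.2) (id_map x b.1 rfl)

theorem mapSigma_id (x : Tuples κ (Tuples κ X)) (b) (h) : mapSigma (𝟙 x) b b h = 𝟙 _ := by
  have h1 := id_map x b.1 rfl
  have h2 := id_map (x.get b.1) b.2 rfl
  rw [← h2]
  unfold mapSigma
  congr 1

theorem idxSigma_comp {x y z : Tuples κ (Tuples κ X)} (f : x ⟶ y) (g : y ⟶ z) (b) :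
    idxSigma (f ≫ g) b = idxSigma f (idxSigma g b) := rfl

theorem mapSigma_comp {x y z : Tuples κ (Tuples κ X)} (f : x ⟶ y) (g : y ⟶ z) (a b c)
    (h : idxSigma f b = a) (h' : idxSigma g c = b) (h'' : idxSigma (f ≫ g) c = a) :
    mapSigma (f ≫ g) a c h'' = mapSigma f a b h ≫ mapSigma g b c h' := by
  subst h' h
  rfl

theorem mapSigma_congr {x y : Tuples κ (Tuples κ X)} (f : x ⟶ y) {a a' b b'} (ha : a = a')
    (hb : b = b') (h : idxSigma f b = a) (h' : idxSigma f b' = a') :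
    HEq (mapSigma f a b h) (mapSigma f a' b' h') := by
  subst ha hb
  rfl

/-- Concatenation of a tuple of tuples. -/
def flattenObj (x : Tuples κ (Tuples κ X)) : Tuples κ X where
  len := ∑ i, (x.get i).len
  get p := (x.get (finSigmaFinEquiv.symm p).1).get (finSigmaFinEquiv.symm p).2

/-- Concatenation of a morphism of tuples of tuples. -/
def flattenHom {x y : Tuples κ (Tuples κ X)} (f : x ⟶ y) : flattenObj x ⟶ flattenObj y where
  idx q := finSigmaFinEquiv (idxSigma f (finSigmaFinEquiv.symm q))
  admissible := MonoidalKind.Admissible.flat (k := fun i => (x.get i).len)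
    (l := fun j => (y.get j).len) (φ := f.idx) (ψ := fun j => (f.map _ j rfl).idx)
    f.admissible fun j => (f.map _ j rfl).admissible
  map p q h := mapSigma f (finSigmaFinEquiv.symm p) (finSigmaFinEquiv.symm q)
    (by rw [← h, Equiv.symm_apply_apply])

variable (κ X) in
/-- The functor forgetting the bracketing of a tuple of tuples. -/
@[simps]
def flatten : Tuples κ (Tuples κ X) ⥤ Tuples κ X where
  obj x := flattenObj x
  map f := flattenHom f
  map_id x := by
    refine hom_ext (fun j => ?_) fun i j h h' => ?_
    · exact (congrArg finSigmaFinEquiv (idxSigma_id x _)).trans (Equiv.apply_symm_apply _ _)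
    · obtain rfl : j = i := h'
      exact mapSigma_id x (finSigmaFinEquiv.symm j) (idxSigma_id x _)
  map_comp f g := by
    refine hom_ext (fun j => ?_) fun i j h h' => ?_
    · simp only [flattenHom, comp_idx, Equiv.symm_apply_apply]
      rfl
    · refine mapSigma_comp f g (finSigmaFinEquiv.symm i)
        (finSigmaFinEquiv.symm ((flattenHom g).idx j)) (finSigmaFinEquiv.symm j) ?_ ?_ ?_
      · simp [← h, flattenHom, idxSigma_comp]
      · simp [flattenHom]
      · simp [← h, flattenHom]

theorem flattenHom_map {x y : Tuples κ (Tuples κ X)} (f : x ⟶ y) (a b)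
    (h : (flattenHom f).idx (finSigmaFinEquiv b) = finSigmaFinEquiv a) (h' : idxSigma f b = a) :
    HEq ((flattenHom f).map (finSigmaFinEquiv a) (finSigmaFinEquiv b) h) (mapSigma f a b h') :=
  mapSigma_congr f (Equiv.symm_apply_apply _ _) (Equiv.symm_apply_apply _ _)
    (by rw [← h]; simp [flattenHom]) _

theorem functor_ext {C : Type u₂} [Category.{v₂} C] {F G : C ⥤ Tuples κ X}
    (hlen : ∀ c, (F.obj c).len = (G.obj c).len)
    (hget : ∀ c i, (F.obj c).get i = (G.obj c).get (Fin.cast (hlen c) i))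
    (hidx : ∀ {c d : C} (f : c ⟶ d) (j),
      Fin.cast (hlen c) ((F.map f).idx j) = (G.map f).idx (Fin.cast (hlen d) j))
    (hmap : ∀ {c d : C} (f : c ⟶ d) (i j) (h : (F.map f).idx j = i)
      (h' : (G.map f).idx (Fin.cast (hlen d) j) = Fin.cast (hlen c) i),
      HEq ((F.map f).map i j h) ((G.map f).map (Fin.cast (hlen c) i) (Fin.cast (hlen d) j) h')) :
    F = G := by
  obtain ⟨F, Fm, F1, F2⟩ := F
  obtain ⟨G, Gm, G1, G2⟩ := G
  obtain rfl : F = G := by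
    funext c
    have h1 : (F c).len = (G c).len := hlen c
    have h2 : ∀ i, (F c).get i = (G c).get (Fin.cast h1 i) := hget c
    clear hlen hget hidx hmap
    generalize F c = x at *
    generalize G c = y at *
    obtain ⟨n, x⟩ := x
    obtain ⟨m, y⟩ := y
    obtain rfl : n = m := h1
    congr
    funext i
    exact h2 i
  congr
  funext c d f
  refine hom_ext (fun j => hidx f j) ?_
  intro i j h h'
  exact eq_of_heq (hmap f i j h h')

theorem map_congr {x y : Tuples κ X} (f : x ⟶ y) {i i' j j'} (hi : i = i') (hj : j = j')
    (h : f.idx j = i) (h' : f.idx j' = i') : HEq (f.map i j h) (f.map i' j' h') := by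
  subst hi hj
  rfl

theorem cast_finSigmaFinEquiv_unique {n : ℕ} (a : Σ _ : Fin 1, Fin n)
    (h : ∑ _ : Fin 1, n = n) : Fin.cast h (finSigmaFinEquiv a) = a.2 := by
  ext
  exact finSigmaFinEquiv_one a

theorem cast_finSigmaFinEquiv_one {n : ℕ} (a : Σ _ : Fin n, Fin 1)
    (h : ∑ _ : Fin n, 1 = n) : Fin.cast h (finSigmaFinEquiv a) = a.1 := by
  ext
  rw [Fin.val_cast, finSigmaFinEquiv_apply]
  simp

theorem unit_flatten : unitFunctor κ (Tuples κ X) ⋙ flatten κ X = 𝟭 _ := by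
  refine functor_ext (fun c => Fin.sum_const 1 c.len |>.trans (one_mul _)) ?_ ?_ ?_
  · intro c p
    obtain ⟨a, rfl⟩ := (finSigmaFinEquiv (n := fun _ : Fin 1 => c.len)).surjective p
    refine Eq.trans ?_ (congrArg c.get (cast_finSigmaFinEquiv_unique a _)).symm
    exact congrArg (fun t => getSigma _ t) (Equiv.symm_apply_apply _ a)
  · intro c d f q
    obtain ⟨b, rfl⟩ := (finSigmaFinEquiv (n := fun _ : Fin 1 => d.len)).surjective q
    refine Eq.trans ?_ (congrArg f.idx (cast_finSigmaFinEquiv_unique b _)).symm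
    refine (cast_finSigmaFinEquiv_unique _ _).trans ?_
    exact congrArg (fun t => f.idx (Sigma.snd t)) (Equiv.symm_apply_apply _ b)
  · intro c d f p q h h'
    obtain ⟨a, rfl⟩ := (finSigmaFinEquiv (n := fun _ : Fin 1 => c.len)).surjective p
    obtain ⟨b, rfl⟩ := (finSigmaFinEquiv (n := fun _ : Fin 1 => d.len)).surjective q
    have ha := cast_finSigmaFinEquiv_unique a (Fin.sum_const 1 c.len |>.trans (one_mul _))
    have hb := cast_finSigmaFinEquiv_unique b (Fin.sum_const 1 d.len |>.trans (one_mul _))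
    have h1 : f.idx b.2 = a.2 := by rw [← ha, ← hb]; exact h'
    refine HEq.trans ?_ (map_congr f ha hb h' h1).symm
    obtain ⟨i, s⟩ := a
    obtain ⟨j, t⟩ := b
    obtain rfl : j = i := Subsingleton.elim _ _
    obtain rfl : f.idx t = s := h1
    exact flattenHom_map ((unitFunctor κ (Tuples κ X)).map f) ⟨j, f.idx t⟩ ⟨j, t⟩ h rfl

theorem map_unit_flatten : mapFunctor (unitFunctor κ X) ⋙ flatten κ X = 𝟭 _ := by
  refine functor_ext (fun c => Fin.sum_const c.len 1 |>.trans (mul_one _)) ?_ ?_ ?_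
  · intro c p
    obtain ⟨a, rfl⟩ := (finSigmaFinEquiv (n := fun _ : Fin c.len => 1)).surjective p
    refine Eq.trans ?_ (congrArg c.get (cast_finSigmaFinEquiv_one a _)).symm
    exact congrArg (fun t => c.get (Sigma.fst t)) (Equiv.symm_apply_apply _ a)
  · intro c d f q
    obtain ⟨b, rfl⟩ := (finSigmaFinEquiv (n := fun _ : Fin d.len => 1)).surjective q
    refine Eq.trans ?_ (congrArg f.idx (cast_finSigmaFinEquiv_one b _)).symm
    refine (cast_finSigmaFinEquiv_one _ _).trans ?_
    exact congrArg (fun t => f.idx (Sigma.fst t)) (Equiv.symm_apply_apply _ b)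
  · intro c d f p q h h'
    obtain ⟨a, rfl⟩ := (finSigmaFinEquiv (n := fun _ : Fin c.len => 1)).surjective p
    obtain ⟨b, rfl⟩ := (finSigmaFinEquiv (n := fun _ : Fin d.len => 1)).surjective q
    have ha := cast_finSigmaFinEquiv_one a (Fin.sum_const c.len 1 |>.trans (mul_one _))
    have hb := cast_finSigmaFinEquiv_one b (Fin.sum_const d.len 1 |>.trans (mul_one _))
    have h1 : f.idx b.1 = a.1 := by rw [← ha, ← hb]; exact h'
    refine HEq.trans ?_ (map_congr f ha hb h' h1).symm
    obtain ⟨i, s⟩ := a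
    obtain ⟨j, t⟩ := b
    obtain rfl : f.idx j = i := h1
    obtain rfl : t = s := Subsingleton.elim (α := Fin 1) t s
    exact flattenHom_map ((mapFunctor (unitFunctor κ X)).map f) ⟨f.idx j, t⟩ ⟨j, t⟩ h rfl

section flatten_flatten

/-- Positions in a tuple of tuples of tuples. -/
abbrev Triple (x : Tuples κ (Tuples κ (Tuples κ X))) : Type :=
  Σ i : Fin x.len, Σ j : Fin (x.get i).len, Fin ((x.get i).get j).len

/-- The lexicographic order on positions. -/
def Triple.Lt (x : Tuples κ (Tuples κ (Tuples κ X))) : Triple x → Triple x → Prop :=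
  Sigma.Lex (· < ·) fun _ => Sigma.Lex (· < ·) fun _ => (· < ·)

theorem sigmaLex_asymm {ι : Type} {T : ι → Type} {r : ι → ι → Prop} {t : ∀ i, T i → T i → Prop}
    (hr : ∀ {a b}, r a b → r b a → False) (ht : ∀ {i a b}, t i a b → t i b a → False)
    {a b : Sigma T} (h : Sigma.Lex r t a b) (h' : Sigma.Lex r t b a) : False := by
  cases h with
  | left x y h =>
    cases h' with
    | left _ _ h' => exact hr h h'
    | right _ _ h' => exact hr h h
  | right x y h =>
    cases h' with
    | left _ _ h' => exact hr h' h'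
    | right _ _ h' => exact ht h h'

theorem Triple.Lt.asymm {x : Tuples κ (Tuples κ (Tuples κ X))} {a b : Triple x}
    (h : Triple.Lt x a b) (h' : Triple.Lt x b a) : False :=
  sigmaLex_asymm (fun h h' => lt_asymm h h')
    (by
      intro i a b h₁ h₂
      refine sigmaLex_asymm ?_ ?_ h₁ h₂
      · exact fun h h' => lt_asymm h h'
      · exact fun h h' => lt_asymm h h') h h'

theorem eq_cast_of_lt {T : Type} {r : T → T → Prop} (hr : ∀ {a b}, r a b → r b a → False)
    {m n : ℕ} {d : Fin m → T} {d' : Fin n → T} (h : ∀ {p q}, p < q → r (d p) (d q))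
    (h' : ∀ {p q}, p < q → r (d' p) (d' q)) (hd : Function.Surjective d)
    (hd' : Function.Surjective d') : ∃ e : m = n, ∀ p, d' (Fin.cast e p) = d p := by
  have inj' : Function.Injective d' := by
    intro p q e
    by_contra hne
    rcases lt_or_gt_of_ne hne with h1 | h1
    · have := h' h1
      rw [e] at this
      exact hr this this
    · have := h' h1
      rw [e] at this
      exact hr this this
  choose φ hφ using fun p => hd' (d p)
  have mono : StrictMono φ := by
    intro p q hpq
    by_contra hle
    rcases eq_or_lt_of_le (not_lt.1 hle) with h1 | h1
    · have := h hpq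
      rw [← hφ, ← hφ, h1] at this
      exact hr this this
    · have h2 := h hpq
      have h3 := h' h1
      rw [hφ, hφ] at h3
      exact hr h2 h3
  have surj : Function.Surjective φ := by
    intro s
    obtain ⟨p, hp⟩ := hd (d' s)
    exact ⟨p, inj' ((hφ p).trans hp)⟩
  have e : m = n := by
    simpa using Fintype.card_congr (Equiv.ofBijective φ ⟨mono.injective, surj⟩)
  refine ⟨e, fun p => ?_⟩
  rw [← hφ]
  congr 1
  ext
  exact (Fin.coe_orderIso_apply (mono.orderIsoOfSurjective φ surj) p).symm

variable (x : Tuples κ (Tuples κ (Tuples κ X)))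

/-- The position in `x` of an entry of the tuple obtained by concatenating the inner tuples first. -/
def decodeL (p : Fin (flattenObj ((mapFunctor (flatten κ X)).obj x)).len) : Triple x :=
  ⟨(finSigmaFinEquiv.symm p).1, finSigmaFinEquiv.symm (finSigmaFinEquiv.symm p).2⟩

/-- The position in `x` of an entry of the tuple obtained by concatenating the outer tuples first. -/
def decodeR (p : Fin (flattenObj (flattenObj x)).len) : Triple x :=
  ⟨(finSigmaFinEquiv.symm (finSigmaFinEquiv.symm p).1).1,
    (finSigmaFinEquiv.symm (finSigmaFinEquiv.symm p).1).2, (finSigmaFinEquiv.symm p).2⟩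

theorem decodeL_lt {p q} (h : p < q) : Triple.Lt x (decodeL x p) (decodeL x q) := by
  obtain ⟨a, rfl⟩ := finSigmaFinEquiv.surjective p
  obtain ⟨b, rfl⟩ := finSigmaFinEquiv.surjective q
  replace h := finSigmaFinEquiv_lt_iff.1 h
  simp only [decodeL]
  rw [Equiv.symm_apply_apply, Equiv.symm_apply_apply]
  cases h with
  | left s t h => exact .left _ _ h
  | right s t h =>
    refine .right _ _ ?_
    rw [← finSigmaFinEquiv_lt_iff]
    exact (congrArg₂ (· < ·) (Equiv.apply_symm_apply _ _) (Equiv.apply_symm_apply _ _)).mpr h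

theorem decodeR_lt {p q} (h : p < q) : Triple.Lt x (decodeR x p) (decodeR x q) := by
  obtain ⟨a, rfl⟩ := finSigmaFinEquiv.surjective p
  obtain ⟨b, rfl⟩ := finSigmaFinEquiv.surjective q
  replace h := finSigmaFinEquiv_lt_iff.1 h
  simp only [decodeR]
  rw [Equiv.symm_apply_apply, Equiv.symm_apply_apply]
  cases h with
  | @left i j s t h =>
    have h : Sigma.Lex (· < ·) (fun _ => (· < ·)) (finSigmaFinEquiv.symm i)
        (finSigmaFinEquiv.symm j) := by
      rw [← finSigmaFinEquiv_lt_iff]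
      exact (congrArg₂ (· < ·) (Equiv.apply_symm_apply _ _) (Equiv.apply_symm_apply _ _)).mpr h
    have aux : ∀ a b : Σ i, Fin (x.get i).len, Sigma.Lex (· < ·) (fun _ => (· < ·)) a b →
        ∀ s t, Triple.Lt x ⟨a.1, a.2, s⟩ ⟨b.1, b.2, t⟩ := by
      intro a b h s t
      cases h with
      | left u v h => exact .left _ _ h
      | right u v h => exact .right _ _ (.left _ _ h)
    exact aux _ _ h s t
  | right s t h => exact .right _ _ (.right _ _ h)

theorem decodeL_surjective : Function.Surjective (decodeL x) := by
  rintro ⟨i, a⟩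
  refine ⟨finSigmaFinEquiv ⟨i, finSigmaFinEquiv a⟩, ?_⟩
  simp only [decodeL]
  rw [Equiv.symm_apply_apply]
  simp

theorem decodeR_surjective : Function.Surjective (decodeR x) := by
  rintro ⟨i, j, k⟩
  obtain ⟨p, hp⟩ := finSigmaFinEquiv.symm.surjective (⟨i, j⟩ : Σ i, Fin (x.get i).len)
  have h : ∀ (a : Σ i, Fin (x.get i).len) (h : a = ⟨i, j⟩),
      ∃ k' : Fin ((x.get a.1).get a.2).len, (⟨a.1, a.2, k'⟩ : Triple x) = ⟨i, j, k⟩ := by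
    rintro _ rfl
    exact ⟨k, rfl⟩
  obtain ⟨k', hk⟩ := h _ hp
  refine ⟨finSigmaFinEquiv ⟨p, k'⟩, ?_⟩
  simp only [decodeR]
  rw [Equiv.symm_apply_apply]
  exact hk

theorem decode_eq : ∃ e : (flattenObj ((mapFunctor (flatten κ X)).obj x)).len =
    (flattenObj (flattenObj x)).len, ∀ p, decodeR x (Fin.cast e p) = decodeL x p :=
  eq_cast_of_lt (r := Triple.Lt x) (d := decodeL x) (d' := decodeR x) Triple.Lt.asymm
    (decodeL_lt x) (decodeR_lt x) (decodeL_surjective x)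
    (decodeR_surjective x)

theorem decodeR_injective : Function.Injective (decodeR x) := by
  intro p q e
  by_contra hne
  rcases lt_or_gt_of_ne hne with h1 | h1
  · have := decodeR_lt x h1
    rw [e] at this
    exact Triple.Lt.asymm this this
  · have := decodeR_lt x h1
    rw [e] at this
    exact Triple.Lt.asymm this this

variable {x} {y : Tuples κ (Tuples κ (Tuples κ X))} (f : x ⟶ y)

/-- The reindexing on triples of positions. -/
def idxTriple (b : Triple y) : Triple x :=
  ⟨f.idx b.1, idxSigma (f.map _ b.1 rfl) b.2⟩

/-- The components of a morphism of tuples of tuples of tuples. -/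
def mapTriple (a : Triple x) (b : Triple y) (h : idxTriple f b = a) :
    ((x.get a.1).get a.2.1).get a.2.2 ⟶ ((y.get b.1).get b.2.1).get b.2.2 :=
  mapSigma (f.map a.1 b.1 (by subst h; rfl)) a.2 b.2 (by subst h; rfl)

theorem mapTriple_congr {a a' : Triple x} {b b' : Triple y} (ha : a = a') (hb : b = b')
    (h : idxTriple f b = a) (h' : idxTriple f b' = a') :
    HEq (mapTriple f a b h) (mapTriple f a' b' h') := by
  subst ha hb
  rfl

theorem decodeL_idx (q) :
    decodeL x (((mapFunctor (flatten κ X) ⋙ flatten κ X).map f).idx q) =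
      idxTriple f (decodeL y q) := by
  change decodeL x (finSigmaFinEquiv (idxSigma ((mapFunctor (flatten κ X)).map f)
    (finSigmaFinEquiv.symm q))) = _
  simp only [decodeL]
  rw [Equiv.symm_apply_apply]
  refine Sigma.ext rfl (heq_of_eq ?_)
  exact Equiv.symm_apply_apply _ _

theorem decodeR_idx (q) :
    decodeR x (((flatten κ (Tuples κ X) ⋙ flatten κ X).map f).idx q) =
      idxTriple f (decodeR y q) := by
  have h : ∀ (a b) (h : idxSigma f b = a) (k),
      (⟨a.1, a.2, (mapSigma f a b h).idx k⟩ : Triple x) = idxTriple f ⟨b.1, b.2, k⟩ := by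
    rintro _ b rfl k
    rfl
  change decodeR x (finSigmaFinEquiv (idxSigma (flattenHom f) (finSigmaFinEquiv.symm q))) = _
  simp only [decodeR]
  rw [Equiv.symm_apply_apply]
  exact h _ _ _ _

theorem flatten_flatten :
    mapFunctor (flatten κ X) ⋙ flatten κ X = flatten κ (Tuples κ X) ⋙ flatten κ X := by
  refine functor_ext (fun c => (decode_eq c).1) ?_ ?_ ?_
  · intro c p
    exact congrArg (fun t : Triple c => ((c.get t.1).get t.2.1).get t.2.2)
      ((decode_eq c).2 p).symm
  · intro c d f q
    apply decodeR_injective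
    refine ((decode_eq c).2 _).trans ?_
    refine Eq.trans ?_ (decodeR_idx f _).symm
    rw [decodeL_idx]
    exact congrArg (idxTriple f) ((decode_eq d).2 q).symm
  · intro c d f p q h h'
    exact mapTriple_congr f ((decode_eq c).2 p).symm ((decode_eq d).2 q).symm
      ((decodeL_idx f q).symm.trans (congrArg (decodeL c) h))
      ((decodeR_idx f _).symm.trans (congrArg (decodeR c) h'))

end flatten_flatten

theorem unitFunctor_naturality (F : X ⥤ Y) :
    F ⋙ unitFunctor κ Y = unitFunctor κ X ⋙ mapFunctor F := by
  refine functor_ext (fun _ => rfl) (fun _ _ => rfl) (fun _ _ => rfl) fun {x y} f i j h _ => ?_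
  obtain rfl : j = i := h
  refine heq_of_eq ?_
  rfl

theorem flatten_naturality (F : X ⥤ Y) :
    mapFunctor (mapFunctor F) ⋙ flatten κ Y = flatten κ X ⋙ mapFunctor F := by
  refine functor_ext (fun _ => rfl) (fun _ _ => rfl) (fun _ _ => rfl) fun {x y} f i j h _ => ?_
  rfl

end Tuples

namespace Tuples
variable {κ : MonoidalKind} {X : Type u} [Category.{v} X] {Y : Type u₂} [Category.{v₂} Y]
  {Z : Type u₃} [Category.{v₃} Z]

theorem homOver_id {n : ℕ} (x : Fin n → X) :
    homOver (κ := κ) (fun i => 𝟙 (x i)) = 𝟙 (⟨n, x⟩ : Tuples κ X) := rfl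

theorem homOver_comp {n : ℕ} {x y z : Fin n → X} (f : ∀ i, x i ⟶ y i) (g : ∀ i, y i ⟶ z i) :
    homOver (κ := κ) (fun i => f i ≫ g i) =
      CategoryStruct.comp (X := (⟨n, x⟩ : Tuples κ X)) (Y := ⟨n, y⟩) (Z := ⟨n, z⟩)
        (homOver f) (homOver g) := by
  refine hom_ext (fun j => rfl) ?_
  rintro i j rfl _
  rfl

theorem mapNatTrans_id (F : X ⥤ Y) : mapNatTrans (κ := κ) (𝟙 F) = 𝟙 _ := rfl

theorem mapNatTrans_comp {F G H : X ⥤ Y} (α : F ⟶ G) (β : G ⟶ H) :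
    mapNatTrans (κ := κ) (α ≫ β) = mapNatTrans α ≫ mapNatTrans β := by
  ext x
  exact homOver_comp _ _

theorem mapFunctor_homOver (F : X ⥤ Y) {n : ℕ} {x y : Fin n → X} (f : ∀ i, x i ⟶ y i) :
    (mapFunctor F).map (homOver f : (⟨n, x⟩ : Tuples κ X) ⟶ ⟨n, y⟩) =
      homOver fun i => F.map (f i) := by
  refine hom_ext (fun j => rfl) ?_
  rintro i j rfl _
  rfl

theorem flatten_homOver {F G : X ⥤ Y} (α : F ⟶ G) (x : Tuples κ (Tuples κ X)) :
    (flatten κ Y).map ((mapNatTrans (mapNatTrans α)).app x) =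
      (mapNatTrans α).app ((flatten κ X).obj x) := by
  refine hom_ext (fun j => Equiv.apply_symm_apply _ _) ?_
  intro i j h h'
  obtain rfl : j = i := h'
  rfl
end Tuples

theorem eq_eqToHom_comp_comp_eqToHom {C : Type u} [Category.{v} C] {a b : C} {f g : a ⟶ b}
    (p : a = a) (q : b = b) (h : f = g) : f = eqToHom p ≫ g ≫ eqToHom q := by
  subst h
  simp

theorem comp_eqToHom_eq_eqToHom_comp {C : Type u} [Category.{v} C] {a b : C} {f g : a ⟶ b}
    (p : b = b) (q : a = a) (h : f = g) : f ≫ eqToHom p = eqToHom q ≫ g := by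
  subst h
  simp

theorem cat_comp_eqToHom_eq {C D : Cat.{v, u}} {F F' G G' : C ⟶ D} (p : F' = G') (q : F = G)
    (α : F ⟶ F') (β : G ⟶ G')
    (h : ∀ x : C, α.toNatTrans.app x ≫ eqToHom (congrArg (fun K => K.toFunctor.obj x) p) =
      eqToHom (congrArg (fun K => K.toFunctor.obj x) q) ≫ β.toNatTrans.app x) :
    α ≫ eqToHom p = eqToHom q ≫ β := by
  subst p q
  ext x
  simpa using h x

/-- The 2-functor sending a category to its category of tuples. -/
def monoidalPreCore (κ : MonoidalKind) : StrictPseudofunctorPreCore Cat.{v, u} Cat.{v, u} where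
  obj X := Cat.of (Tuples κ X)
  map F := (Tuples.mapFunctor F.toFunctor).toCatHom
  map₂ α := (Tuples.mapNatTrans α.toNatTrans).toCatHom₂
  map₂_id _ := rfl
  map₂_comp α β := congrArg NatTrans.toCatHom₂ (Tuples.mapNatTrans_comp _ _)
  map_id _ := rfl
  map_comp _ _ := rfl
  map₂_whisker_left _ _ _ _ := eq_eqToHom_comp_comp_eqToHom _ _ rfl
  map₂_whisker_right α G := by
    refine eq_eqToHom_comp_comp_eqToHom _ _ ?_
    ext x
    exact (Tuples.mapFunctor_homOver G.toFunctor fun i => α.toNatTrans.app (Tuples.get x i)).symm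

/-- The 2-monad on the 2-category of categories whose strict algebras are the categories with strict
monoidal structure of kind `κ`: the free category on `X` consists of tuples of objects of `X`, the
multiplication concatenates tuples and the unit forms tuples of length one. -/
def monoidalTwoMonad (κ : MonoidalKind) : TwoMonad Cat.{v, u} where
  S := .mk'' (monoidalPreCore κ)
  mul X := (Tuples.flatten κ X).toCatHom
  unit X := (Tuples.unitFunctor κ X).toCatHom
  mul_naturality F := congrArg Functor.toCatHom (Tuples.flatten_naturality F.toFunctor)
  mul_naturality₂ {X Y F G} α := by
    refine comp_eqToHom_eq_eqToHom_comp _ _ ?_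
    ext x
    exact Tuples.flatten_homOver α.toNatTrans x
  unit_naturality F := congrArg Functor.toCatHom (Tuples.unitFunctor_naturality F.toFunctor)
  unit_naturality₂ {X Y F G} α := cat_comp_eqToHom_eq _ _ _ _ fun x =>
    comp_eqToHom_eq_eqToHom_comp (C := Tuples κ Y) (a := ⟨1, fun _ => F.toFunctor.obj x⟩)
      (b := ⟨1, fun _ => G.toFunctor.obj x⟩) _ _ rfl
  mul_assoc X := congrArg Functor.toCatHom Tuples.flatten_flatten
  unit_mul X := congrArg Functor.toCatHom Tuples.unit_flatten
  map_unit_mul X := congrArg Functor.toCatHom Tuples.map_unit_flatten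

attribute [local instance] uliftCategory

/-- The isomorphism from a small category to its copy in the next universe. -/
abbrev up (X : Type u) [Category.{u} X] : X ⥤ ULift.{u + 1} X := ULift.upFunctor

/-- The inverse of `up`. -/
abbrev down (X : Type u) [Category.{u} X] : ULift.{u + 1} X ⥤ X := ULift.downFunctor

/-- The inclusion `Cat → CAT` of the 2-category of small categories into that of locally small
categories. -/
def inclusion : StrictPseudofunctor Cat.{u, u} Cat.{u, u + 1} := .mk''
  { obj X := Cat.of (ULift.{u + 1} X)
    map F := (down _ ⋙ F.toFunctor ⋙ up _).toCatHom
    map₂ α := (Functor.whiskerLeft _ (Functor.whiskerRight α.toNatTrans _)).toCatHom₂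
    map₂_id _ := rfl
    map₂_comp _ _ := rfl
    map_id _ := rfl
    map_comp _ _ := rfl
    map₂_whisker_left _ _ _ _ := eq_eqToHom_comp_comp_eqToHom _ _ rfl
    map₂_whisker_right _ _ := eq_eqToHom_comp_comp_eqToHom _ _ rfl }

/-- The 2-monad for structures of kind `κ` on `CAT` restricts along `Cat → CAT` to the 2-monad
for structures of kind `κ` on `Cat`. -/
def monoidalRestriction (κ : MonoidalKind) :
    TwoMonad.Restriction inclusion.{u} (monoidalTwoMonad κ) (monoidalTwoMonad κ) where
  iso X :=
    { hom := (Tuples.mapFunctor (down X) ⋙ up (Tuples κ X)).toCatHom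
      inv := (down (Tuples κ X) ⋙ Tuples.mapFunctor (up X)).toCatHom
      hom_inv_id := rfl
      inv_hom_id := rfl }
  naturality F := rfl
  naturality₂ {X Y F G} α := by
    refine comp_eqToHom_eq_eqToHom_comp _ _ ?_
    ext x
    exact Tuples.mapFunctor_homOver _ _
  unit X := by
    refine congrArg (fun F => (F ⋙ (up _)).toCatHom)
      (Tuples.unitFunctor_naturality (κ := κ) (down X)).symm
  mul X := by
    refine congrArg (fun F => (F ⋙ (up _)).toCatHom)
      (Tuples.flatten_naturality (κ := κ) (down X)).symm

namespace Presheaf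
open Opposite

variable {X Y Z V : Type u} [Category.{u} X] [Category.{u} Y] [Category.{u} Z] [Category.{u} V]

/-- The relation generating the coend `∫^x F(x)(y) × p(x)`. -/
inductive CoendRel (F : X ⥤ Yᵒᵖ ⥤ Type u) (p : Xᵒᵖ ⥤ Type u) (y : Yᵒᵖ) :
    (Σ x : X, (F.obj x).obj y × p.obj (op x)) →
    (Σ x : X, (F.obj x).obj y × p.obj (op x)) → Prop
  | intro {x x' : X} (h : x ⟶ x') (s : (F.obj x).obj y) (t : p.obj (op x')) :
    CoendRel F p y ⟨x, s, p.map h.op t⟩ ⟨x', (F.map h).app y s, t⟩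

/-- The coend `∫^x F(x)(y) × p(x)`. -/
def Coend (F : X ⥤ Yᵒᵖ ⥤ Type u) (p : Xᵒᵖ ⥤ Type u) (y : Yᵒᵖ) : Type u :=
  Quot (CoendRel F p y)

namespace Coend
variable {F : X ⥤ Yᵒᵖ ⥤ Type u} {p : Xᵒᵖ ⥤ Type u} {y : Yᵒᵖ}

/-- The class of a pair in the coend. -/
def mk (x : X) (s : (F.obj x).obj y) (t : p.obj (op x)) : Coend F p y := Quot.mk _ ⟨x, s, t⟩

theorem sound {x x' : X} (h : x ⟶ x') (s : (F.obj x).obj y) (t : p.obj (op x')) :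
    (mk x s (p.map h.op t) : Coend F p y) = mk x' ((F.map h).app y s) t :=
  Quot.sound ⟨h, s, t⟩

theorem ind {P : Coend F p y → Prop} (h : ∀ x s t, P (mk x s t)) (a) : P a := by
  obtain ⟨x, s, t⟩ := a
  exact h x s t

/-- Functions out of the coend. -/
def lift {R : Type u} (f : ∀ x : X, (F.obj x).obj y → p.obj (op x) → R)
    (hf : ∀ {x x' : X} (h : x ⟶ x') (s : (F.obj x).obj y) (t : p.obj (op x')),
      f x s (p.map h.op t) = f x' ((F.map h).app y s) t) (a : Coend F p y) : R :=
  Quot.lift (fun a => f a.1 a.2.1 a.2.2) (by rintro _ _ ⟨h, s, t⟩; exact hf h s t) a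

end Coend

theorem hom_ext_apply {p q : Xᵒᵖ ⥤ Type u} {φ ψ : p ⟶ q} (h : ∀ x s, φ.app x s = ψ.app x s) :
    φ = ψ := by
  ext x s
  exact h x s

/-- The value at the presheaf `p` of the (pointwise) left Kan extension of `F` along the Yoneda
embedding, that is, the presheaf `y ↦ ∫^x F(x)(y) × p(x)`. -/
@[simps]
def extendObj (F : X ⥤ Yᵒᵖ ⥤ Type u) (p : Xᵒᵖ ⥤ Type u) : Yᵒᵖ ⥤ Type u where
  obj y := Coend F p y
  map k := ↾(Coend.lift (fun x s t => Coend.mk x ((F.obj x).map k s) t) (by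
    intro x x' h s t
    rw [Coend.sound, NatTrans.naturality_apply]))
  map_id y := by
    ext a
    induction a using Coend.ind with | _ x s t
    exact congrArg (fun s => Coend.mk x s t) ((F.obj x).map_id_apply _ s)
  map_comp k l := by
    ext a
    induction a using Coend.ind with | _ x s t
    exact congrArg (fun s => Coend.mk x s t) ((F.obj x).map_comp_apply k l s)

/-- Functoriality of the left Kan extension in the presheaf. -/
@[simps]
def extendMap (F : X ⥤ Yᵒᵖ ⥤ Type u) {p q : Xᵒᵖ ⥤ Type u} (φ : p ⟶ q) :
    extendObj F p ⟶ extendObj F q where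
  app y := ↾(Coend.lift (fun x s t => Coend.mk x s (φ.app _ t)) (by
    intro x x' h s t
    rw [NatTrans.naturality_apply, Coend.sound]))
  naturality y y' k := by
    ext a
    induction a using Coend.ind with | _ x s t
    rfl

/-- The left Kan extension of `F` along the Yoneda embedding. -/
@[simps]
def extend (F : X ⥤ Yᵒᵖ ⥤ Type u) : (Xᵒᵖ ⥤ Type u) ⥤ (Yᵒᵖ ⥤ Type u) where
  obj p := extendObj F p
  map φ := extendMap F φ
  map_id p := by
    refine hom_ext_apply fun y a => ?_
    induction a using Coend.ind with | _ x s t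
    rfl
  map_comp φ ψ := by
    refine hom_ext_apply fun y a => ?_
    induction a using Coend.ind with | _ x s t
    rfl

/-- Functoriality of the left Kan extension in `F`. -/
@[simps]
def extendTrans {F G : X ⥤ Yᵒᵖ ⥤ Type u} (α : F ⟶ G) : extend F ⟶ extend G where
  app p :=
    { app y := ↾(Coend.lift (fun x s t => Coend.mk x ((α.app x).app y s) t) (by
        intro x x' h s t
        rw [Coend.sound]
        have := ConcreteCategory.congr_hom (NatTrans.congr_app (α.naturality h) y) s
        exact congrArg (fun s => Coend.mk x' s t) this.symm))
      naturality y y' k := by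
        ext a
        induction a using Coend.ind with | _ x s t
        exact congrArg (fun s => Coend.mk x s t) ((α.app x).naturality_apply k s) }
  naturality p q φ := by
    refine hom_ext_apply fun y a => ?_
    induction a using Coend.ind with | _ x s t
    rfl

theorem extendTrans_id (F : X ⥤ Yᵒᵖ ⥤ Type u) : extendTrans (𝟙 F) = 𝟙 _ := by
  ext1; ext1 p
  refine hom_ext_apply fun y a => ?_
  induction a using Coend.ind with | _ x s t
  rfl

theorem extendTrans_comp {F G H : X ⥤ Yᵒᵖ ⥤ Type u} (α : F ⟶ G) (β : G ⟶ H) :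
    extendTrans (α ≫ β) = extendTrans α ≫ extendTrans β := by
  ext1; ext1 p
  refine hom_ext_apply fun y a => ?_
  induction a using Coend.ind with | _ x s t
  rfl

theorem natTrans_ext {F G : (Xᵒᵖ ⥤ Type u) ⥤ Yᵒᵖ ⥤ Type u} {α β : F ⟶ G}
    (h : ∀ p y a, ((α.app p).app y) a = ((β.app p).app y) a) : α = β := by
  ext p : 2
  exact hom_ext_apply (h p)

/-- Isomorphisms of presheaves from mutually inverse maps. -/
def pshIso {p q : Xᵒᵖ ⥤ Type u} (φ : p ⟶ q) (ψ : q ⟶ p) (h : ∀ x s, ψ.app x (φ.app x s) = s)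
    (h' : ∀ x s, φ.app x (ψ.app x s) = s) : p ≅ q where
  hom := φ
  inv := ψ
  hom_inv_id := hom_ext_apply h
  inv_hom_id := hom_ext_apply h'

/-- The map `[x, [y, s, r], t] ↦ [y, s, [x, r, t]]`. -/
def muHom (F : X ⥤ Yᵒᵖ ⥤ Type u) (G : Y ⥤ Zᵒᵖ ⥤ Type u) (p : Xᵒᵖ ⥤ Type u) :
    extendObj (F ⋙ extend G) p ⟶ extendObj G (extendObj F p) where
  app z := ↾(Coend.lift (fun x a t => Coend.lift (fun y s r => Coend.mk y s (Coend.mk x r t))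
    (by
      intro y y' h s r
      exact Coend.sound (p := extendObj F p) h s (Coend.mk x r t)) a) (by
    intro x x' h a t
    induction a using Coend.ind with | _ y s r
    exact congrArg (fun b => Coend.mk (p := extendObj F p) y s b) (Coend.sound h r t)))
  naturality z z' k := by
    ext a
    induction a using Coend.ind with | _ x a t
    induction a using Coend.ind with | _ y s r
    rfl

/-- The map `[y, s, [x, r, t]] ↦ [x, [y, s, r], t]`. -/
def muInv (F : X ⥤ Yᵒᵖ ⥤ Type u) (G : Y ⥤ Zᵒᵖ ⥤ Type u) (p : Xᵒᵖ ⥤ Type u) :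
    extendObj G (extendObj F p) ⟶ extendObj (F ⋙ extend G) p where
  app z := ↾(Coend.lift (fun y s b => Coend.lift (fun x r t =>
      Coend.mk (F := F ⋙ extend G) x (Coend.mk y s r) t)
    (by
      intro x x' h r t
      exact Coend.sound (F := F ⋙ extend G) h (Coend.mk y s r) t) b) (by
    intro y y' h s b
    induction b using Coend.ind with | _ x r t
    exact congrArg (fun a => Coend.mk (F := F ⋙ extend G) x a t) (Coend.sound h s r)))
  naturality z z' k := by
    ext a
    induction a using Coend.ind with | _ y s b
    induction b using Coend.ind with | _ x r t
    rfl

/-- Left Kan extension along Yoneda preserves composition: `(G* F)* ≅ G* F*`. -/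
def mu (F : X ⥤ Yᵒᵖ ⥤ Type u) (G : Y ⥤ Zᵒᵖ ⥤ Type u) :
    extend (F ⋙ extend G) ≅ extend F ⋙ extend G :=
  NatIso.ofComponents (fun p => pshIso (muHom F G p) (muInv F G p)
    (by
      intro z a
      induction a using Coend.ind with | _ x a t
      induction a using Coend.ind with | _ y s r
      rfl)
    (by
      intro z a
      induction a using Coend.ind with | _ y s b
      induction b using Coend.ind with | _ x r t
      rfl)) (by
    intro p q φ
    refine hom_ext_apply fun z a => ?_
    induction a using Coend.ind with | _ x a t
    induction a using Coend.ind with | _ y s r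
    rfl)

/-- The map `s ↦ [x, s, 1]`. -/
def etaHom (F : X ⥤ Yᵒᵖ ⥤ Type u) (x : X) : F.obj x ⟶ extendObj F (yoneda.obj x) where
  app y := ↾(fun s => Coend.mk (p := yoneda.obj x) x s (𝟙 x))
  naturality _ _ _ := rfl

/-- The map `[x', s, t] ↦ F(t)(s)`. -/
def etaInv (F : X ⥤ Yᵒᵖ ⥤ Type u) (x : X) : extendObj F (yoneda.obj x) ⟶ F.obj x where
  app y := ↾(Coend.lift (p := yoneda.obj x) (fun x' s t => (F.map t).app y s) (by
    intro x' x'' h s t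
    exact ConcreteCategory.congr_hom (NatTrans.congr_app (F.map_comp h t) y) s))
  naturality y y' k := by
    ext a
    induction a using Coend.ind with | _ x' s t
    exact (F.map t).naturality_apply k s

/-- Left Kan extension along Yoneda extends: `F ≅ F* y`. -/
def eta (F : X ⥤ Yᵒᵖ ⥤ Type u) : F ≅ yoneda ⋙ extend F :=
  NatIso.ofComponents (fun x => pshIso (etaHom F x) (etaInv F x)
    (by
      intro y s
      exact ConcreteCategory.congr_hom (NatTrans.congr_app (F.map_id x) y) s)
    (by
      intro y a
      induction a using Coend.ind with | _ x' s t
      refine (Coend.sound (p := yoneda.obj x) t s (𝟙 x)).symm.trans ?_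
      exact congrArg (fun t => Coend.mk (p := yoneda.obj x) x' s t) (Category.comp_id t))) (by
    intro x x' h
    refine hom_ext_apply fun y s => ?_
    refine (Coend.sound (p := yoneda.obj x') h s (𝟙 x')).symm.trans ?_
    refine congrArg (fun t => Coend.mk (p := yoneda.obj x') x s t) ?_
    exact (Category.comp_id h).trans (Category.id_comp h).symm)

/-- The map `[x, s, t] ↦ p(s)(t)`. -/
def thetaHom (p : Xᵒᵖ ⥤ Type u) : extendObj yoneda p ⟶ p where
  app y := ↾(Coend.lift (F := yoneda) (fun x s t => p.map (Quiver.Hom.op s) t) (by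
    intro x x' h s t
    exact (p.map_comp_apply h.op s.op t).symm))
  naturality y y' k := by
    ext a
    induction a using Coend.ind with | _ x s t
    exact p.map_comp_apply _ k t

/-- The map `t ↦ [y, 1, t]`. -/
def thetaInv (p : Xᵒᵖ ⥤ Type u) : p ⟶ extendObj yoneda p where
  app y := ↾(fun t => Coend.mk (F := yoneda) (y := y) y.unop (𝟙 y.unop) t)
  naturality y y' k := by
    ext t
    refine (Coend.sound (F := yoneda) (p := p) (y := y') k.unop (𝟙 y'.unop) t).trans ?_
    refine congrArg (fun s => Coend.mk (F := yoneda) (y := y') y.unop s t) ?_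
    exact (Category.id_comp k.unop).trans (Category.comp_id k.unop).symm

/-- The left Kan extension of the Yoneda embedding along itself is the identity. -/
def theta : extend (yoneda : X ⥤ Xᵒᵖ ⥤ Type u) ≅ 𝟭 _ :=
  NatIso.ofComponents (fun p => pshIso (thetaHom p) (thetaInv p)
    (by
      intro y a
      induction a using Coend.ind with | _ x s t
      refine (Coend.sound (F := yoneda) (p := p) (y := y) s (𝟙 y.unop) t).trans ?_
      refine congrArg (fun s => Coend.mk (F := yoneda) (y := y) x s t) ?_
      exact Category.id_comp s)
    (by
      intro y t
      exact p.map_id_apply y t)) (by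
    intro p q φ
    refine hom_ext_apply fun y a => ?_
    induction a using Coend.ind with | _ x s t
    exact (NatTrans.naturality_apply φ _ t).symm)

end Presheaf

namespace Presheaf

/-- The functor on `X` corresponding to a functor on its copy `J X`. -/
def toFun {X Y : Cat.{u, u}} (f : inclusion.{u}.obj X ⟶ Cat.of (Yᵒᵖ ⥤ Type u)) :
    X ⥤ Yᵒᵖ ⥤ Type u :=
  up X ⋙ f.toFunctor

/-- The action of `toFun` on natural transformations. -/
def toFunMap {X Y : Cat.{u, u}} {f g : inclusion.{u}.obj X ⟶ Cat.of (Yᵒᵖ ⥤ Type u)} (α : f ⟶ g) :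
    toFun f ⟶ toFun g :=
  Functor.whiskerLeft (up X) α.toNatTrans

/-- The extension functors `f ↦ f*`, given by left Kan extension along Yoneda. -/
def ext (X Y : Cat.{u, u}) : (inclusion.{u}.obj X ⟶ Cat.of (Yᵒᵖ ⥤ Type u)) ⥤
    (Cat.of (Xᵒᵖ ⥤ Type u) ⟶ Cat.of (Yᵒᵖ ⥤ Type u)) where
  obj f := (extend (toFun f)).toCatHom
  map α := (extendTrans (toFunMap α)).toCatHom₂
  map_id f := congrArg NatTrans.toCatHom₂ (extendTrans_id (toFun f))
  map_comp α β := congrArg NatTrans.toCatHom₂ (extendTrans_comp (toFunMap α) (toFunMap β))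

/-- The Yoneda embedding. -/
def unit (X : Cat.{u, u}) : inclusion.{u}.obj X ⟶ Cat.of (Xᵒᵖ ⥤ Type u) :=
  (down X ⋙ yoneda).toCatHom

/-- The isomorphism `(g* f)* ≅ g* f*`. -/
def catMu {X Y Z : Cat.{u, u}} (f : inclusion.{u}.obj X ⟶ Cat.of (Yᵒᵖ ⥤ Type u))
    (g : inclusion.{u}.obj Y ⟶ Cat.of (Zᵒᵖ ⥤ Type u)) :
    (ext X Z).obj (f ≫ (ext Y Z).obj g) ≅ (ext X Y).obj f ≫ (ext Y Z).obj g :=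
  Cat.Hom.isoMk (mu (toFun f) (toFun g))

/-- The isomorphism `f ≅ f* y`. -/
def catEta {X Y : Cat.{u, u}} (f : inclusion.{u}.obj X ⟶ Cat.of (Yᵒᵖ ⥤ Type u)) :
    f ≅ unit X ≫ (ext X Y).obj f :=
  Cat.Hom.isoMk (Functor.isoWhiskerLeft (down X) (eta (toFun f)))

/-- The isomorphism `y* ≅ 1`. -/
def catTheta (X : Cat.{u, u}) : (ext X X).obj (unit X) ≅ 𝟙 (Cat.of (Xᵒᵖ ⥤ Type u)) :=
  Cat.Hom.isoMk theta

end Presheaf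

open Presheaf in
/-- The relative pseudomonad of presheaves over the inclusion `Cat → CAT`: it sends a small category
`X` to the locally small category of presheaves on `X`, its unit is the Yoneda embedding, and
`f*` is the left Kan extension of `f` along the Yoneda embedding. -/
def presheafPseudomonad : RelativePseudomonad inclusion.{u}.toPseudofunctor where
  obj X := Cat.of (Xᵒᵖ ⥤ Type u)
  ext {X Y} := ext X Y
  unit X := unit X
  mu f g := catMu f g
  eta f := catEta f
  theta X := catTheta X
  mu_naturality_left {X Y Z f f'} α g := by
    refine Cat.Hom₂.ext (natTrans_ext fun p y a => ?_)
    induction a using Coend.ind with | _ x a t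
    induction a using Coend.ind with | _ y s r
    rfl
  mu_naturality_right {X Y Z} f {g g'} β := by
    refine Cat.Hom₂.ext (natTrans_ext fun p y a => ?_)
    induction a using Coend.ind with | _ x a t
    induction a using Coend.ind with | _ y s r
    rfl
  eta_naturality {X Y f f'} α := by
    refine Cat.Hom₂.ext ?_
    ext x : 2
    exact hom_ext_apply fun y s => rfl
  assoc {X Y Z V} f g h := by
    refine Cat.Hom₂.ext (natTrans_ext fun p y a => ?_)
    induction a using Coend.ind with | _ x a t
    induction a using Coend.ind with | _ y a r
    induction a using Coend.ind with | _ z s q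
    rfl
  unit_coherence {X Y} f := by
    refine Cat.Hom₂.ext (natTrans_ext fun p y a => ?_)
    induction a using Coend.ind with | _ x s t
    refine congrArg (fun t => Coend.mk (F := up X ⋙ f.toFunctor) x s t) ?_
    exact p.map_id_apply _ t

end PseudoLift

/-! Write `S` for tuples, `y` for the Yoneda embedding and `f*` for the extension of `f`. `Dense j
G` says that `G` is a left extension along `j`: restriction along `j` is a bijection from
transformations out of `G` to transformations out of `j ⋙ G`. The structure map on `PA` is Day
convolution, the left Kan extension along `S y` of the structure map of `A` followed by `y`; on
tuples of representables it gives back the structure map of `A`. Everything else in a lifting is a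
2-cell, or an equation of 2-cells, out of a composite such as `S s ⋙ s`, `flatten ⋙ s` or `S f* ⋙
s`, where `s` is Day convolution. Once each such composite is a left extension along the appropriate
one of `y`, `S y`, `SS y`, `SSS y`, the 2-cells can be defined, and the equations checked, on
representables. There they reduce to the algebra `A` and to the given pseudomorphisms.

The property that propagates well is `Good j G`: `G` is the nerve of `j` followed by some `extend
h`, that is, a pointwise left Kan extension. For full `j` it implies `Dense j G` (`Good.dense`). It
is stable under composition with `extend F`, because `(g* f)* ≅ g* f*`; under restriction along the
unit and along concatenation (`Good.unitFunctor_comp`, `Good.flatten_comp`); and under `G ↦ S G ⋙ s`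
(`Good.mapFunctor_comp_dayConvolution`).

The last three stability properties rest on the shape of morphisms of tuples: an admissible
reindexing and, for each output position, one morphism out of one input entry. Hence the elements of
the coends for the unit and for concatenation have unique normal forms (`good_unit_nerve`,
`good_flatten_nerve`). For `S f*` (`good_mapFunctor_extend_nerve`), a map from a representable to
`f* p` is a class of factorizations through some `f a`; a finite family of such classes is one class
of families, because the generating relation is reflexive (`eq_of_quot_mk_eq`). The kind `κ` enters
only through the closure of admissible reindexings under identities, composition and concatenation,
so the four cases are treated at once.

The rest is formal. `exists_transfer` moves a pseudoalgebra structure along a dense functor,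
`exists_extension` extends a pseudomorphism so that `f ≅ f* y` becomes an algebra 2-cell, and
`IsAlgebraTwoCell.of_whiskerLeft` tests algebra 2-cells on representables. The conditions on `α*`,
`mu` and `theta` then follow from the equations relating them to `eta`. -/

namespace PseudoLift

/-! ### Morphisms of tuples as a reindexing with a family of components -/

namespace Tuples
variable {κ : MonoidalKind} {X : Type u} [Category.{v} X] {Y : Type u₂} [Category.{v₂} Y]

/-- The morphism of tuples over a reindexing `φ` given by a family of morphisms. -/
def mkHom {x y : Tuples κ X} (φ : Fin y.len → Fin x.len) (hφ : κ.Admissible φ)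
    (m : ∀ k, x.get (φ k) ⟶ y.get k) : x ⟶ y where
  idx := φ
  admissible := hφ
  map _ k h := h ▸ m k

theorem mkHom_eta {x y : Tuples κ X} (f : x ⟶ y) :
    mkHom f.idx f.admissible (fun k => f.map _ k rfl) = f := by
  refine hom_ext (fun _ => rfl) ?_
  rintro i j rfl _
  rfl

theorem exists_mkHom {x y : Tuples κ X} (f : x ⟶ y) : ∃ φ hφ m, mkHom φ hφ m = f :=
  ⟨_, _, _, mkHom_eta f⟩

theorem mkHom_inj {x y : Tuples κ X} {φ : Fin y.len → Fin x.len} {hφ : κ.Admissible φ}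
    {m m' : ∀ k, x.get (φ k) ⟶ y.get k} (h : mkHom φ hφ m = mkHom φ hφ m') : m = m' := by
  funext k
  -- The type of `map` depends on `idx`, so both are compared at once, as a dependent pair.
  have := congrArg (fun f : x ⟶ y => (⟨f.idx, f.map⟩ :
    Σ' φ : Fin y.len → Fin x.len, ∀ i j, φ j = i → (x.get i ⟶ y.get j))) h
  simp only [mkHom, PSigma.mk.injEq, heq_eq_eq, true_and] at this
  exact congrFun (congrFun (congrFun this (φ k)) k) rfl

theorem mkHom_congr {x y : Tuples κ X} {φ φ' : Fin y.len → Fin x.len} {hφ : κ.Admissible φ}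
    {hφ' : κ.Admissible φ'}
    {m : ∀ k, x.get (φ k) ⟶ y.get k} {m' : ∀ k, x.get (φ' k) ⟶ y.get k}
    (h : φ = φ') (h' : ∀ k, m k = eqToHom (by rw [h]) ≫ m' k) :
    mkHom φ hφ m = mkHom φ' hφ' m' := by
  subst h
  congr 1
  funext k
  simpa using h' k

theorem mkHom_comp {x y z : Tuples κ X} (φ : Fin y.len → Fin x.len) (hφ : κ.Admissible φ)
    (m : ∀ k, x.get (φ k) ⟶ y.get k) (ψ : Fin z.len → Fin y.len) (hψ : κ.Admissible ψ)
    (n : ∀ k, y.get (ψ k) ⟶ z.get k) :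
    mkHom φ hφ m ≫ mkHom ψ hψ n =
      mkHom (fun k => φ (ψ k)) (.comp hφ hψ) (fun k => m (ψ k) ≫ n k) := by
  refine hom_ext (fun _ => rfl) ?_
  rintro i j rfl _
  rfl

theorem mapFunctor_mkHom (F : X ⥤ Y) {x y : Tuples κ X} (φ : Fin y.len → Fin x.len)
    (hφ : κ.Admissible φ) (m : ∀ k, x.get (φ k) ⟶ y.get k) :
    (mapFunctor F).map (mkHom φ hφ m) =
      mkHom (x := (mapFunctor F).obj x) (y := (mapFunctor F).obj y) φ hφ
        (fun k => F.map (m k)) := by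
  refine hom_ext (fun _ => rfl) ?_
  rintro i j rfl _
  rfl

/-- Preimages are taken componentwise over the same reindexing. `Good.dense` requires fullness of
every iterate of `mapFunctor` applied to the Yoneda embedding. -/
instance (F : X ⥤ Y) [F.Full] : (mapFunctor (κ := κ) F).Full where
  map_surjective {x y} f := by
    obtain ⟨φ, hφ, m, rfl⟩ := exists_mkHom f
    refine ⟨mkHom φ hφ fun k => F.preimage (m k), ?_⟩
    refine (mapFunctor_mkHom F φ hφ _).trans ?_
    congr 1
    funext k
    exact F.map_preimage _

instance (F : X ⥤ Y) [F.Faithful] : (mapFunctor (κ := κ) F).Faithful where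
  map_injective {x y} f g h := by
    obtain ⟨φ, hφ, m, rfl⟩ := exists_mkHom f
    obtain ⟨φ', hφ', m', rfl⟩ := exists_mkHom g
    obtain rfl : φ = φ' := congrArg Hom.idx h
    rw [mapFunctor_mkHom, mapFunctor_mkHom] at h
    congr 1
    funext k
    exact F.map_injective (congrFun (mkHom_inj h) k)

/-- A reindexing of a tuple. -/
abbrev reindex (x : Tuples κ X) {n : ℕ} (φ : Fin n → Fin x.len) : Tuples κ X :=
  ⟨n, fun k => x.get (φ k)⟩

/-- The canonical morphism from a tuple to a reindexing of it. -/
def toReindex (x : Tuples κ X) {n : ℕ} (φ : Fin n → Fin x.len) (hφ : κ.Admissible φ) :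
    x ⟶ x.reindex φ :=
  mkHom (y := x.reindex φ) φ hφ fun _ => 𝟙 _

/-- Morphisms of tuples factor as a reindexing followed by a family of morphisms. -/
theorem map_toReindex_comp_homOver (F : X ⥤ Y) (x : Tuples κ X) {n : ℕ} (φ : Fin n → Fin x.len)
    (hφ : κ.Admissible φ) {y : Fin n → Y} (m : ∀ k, F.obj (x.get (φ k)) ⟶ y k) :
    (mapFunctor F).map (toReindex x φ hφ) ≫ (homOver m : _ ⟶ (⟨n, y⟩ : Tuples κ Y)) =
      mkHom (x := (mapFunctor F).obj x) (y := ⟨n, y⟩) φ hφ m := by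
  rw [toReindex, mapFunctor_mkHom]
  refine (mkHom_comp (x := (mapFunctor F).obj x) (y := (mapFunctor F).obj (x.reindex φ))
    (z := ⟨n, y⟩) φ hφ (fun k => F.map (𝟙 _)) (fun i => i) (.id n) m).trans ?_
  congr 1
  funext k
  rw [F.map_id]
  exact Category.id_comp _

/-- The isomorphism of functors between categories of tuples induced by an isomorphism. -/
def mapFunctorIso {F G : X ⥤ Y} (e : F ≅ G) : mapFunctor (κ := κ) F ≅ mapFunctor G where
  hom := mapNatTrans e.hom
  inv := mapNatTrans e.inv
  hom_inv_id := by rw [← mapNatTrans_comp, e.hom_inv_id, mapNatTrans_id]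
  inv_hom_id := by rw [← mapNatTrans_comp, e.inv_hom_id, mapNatTrans_id]

/-- The equivalence between categories of tuples induced by an equivalence. -/
def mapEquivalence (e : X ≌ Y) : Tuples κ X ≌ Tuples κ Y :=
  CategoryTheory.Equivalence.mk (mapFunctor e.functor) (mapFunctor e.inverse)
    (mapFunctorIso e.unitIso) (mapFunctorIso e.counitIso)

end Tuples

/-! ### Functors that are left extensions of their restriction -/

section Dense

variable {X : Type u} [Category.{v} X] {Y : Type u₂} [Category.{v₂} Y]
  {Z : Type u₃} [Category.{v₃} Z] {X' : Type u₁} [Category.{v₁} X']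

/-- `G` is a left extension of its restriction along `j`. -/
def Dense (j : X ⥤ Y) (G : Y ⥤ Z) : Prop :=
  ∀ H : Y ⥤ Z, Function.Bijective fun α : G ⟶ H => Functor.whiskerLeft j α

namespace Dense
variable {j : X ⥤ Y} {G H : Y ⥤ Z}

theorem ext (hG : Dense j G) {α β : G ⟶ H} (h : ∀ x, α.app (j.obj x) = β.app (j.obj x)) :
    α = β :=
  (hG H).1 (by ext x; exact h x)

theorem exists_hom (hG : Dense j G) (γ : j ⋙ G ⟶ j ⋙ H) :
    ∃ α : G ⟶ H, ∀ x, α.app (j.obj x) = γ.app x := by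
  obtain ⟨α, h⟩ := (hG H).2 γ
  exact ⟨α, fun x => congrArg (fun t => t.app x) h⟩

/-- The two directions of `γ` extend separately, since both functors are left extensions; that the
extensions are mutually inverse is tested on the image of `j`. -/
theorem exists_iso (hG : Dense j G) (hH : Dense j H) (γ : j ⋙ G ≅ j ⋙ H) :
    ∃ α : G ≅ H, ∀ x, α.hom.app (j.obj x) = γ.hom.app x := by
  obtain ⟨α, h⟩ := hG.exists_hom γ.hom
  obtain ⟨β, h'⟩ := hH.exists_hom γ.inv
  refine ⟨⟨α, β, hG.ext fun x => ?_, hH.ext fun x => ?_⟩, h⟩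
  · rw [NatTrans.comp_app, h, h']
    exact γ.hom_inv_id_app x
  · rw [NatTrans.comp_app, h, h']
    exact γ.inv_hom_id_app x

theorem precomp (e : X' ≌ X) (hG : Dense j G) : Dense (e.functor ⋙ j) G := by
  intro H
  have h : Function.Bijective fun α : j ⋙ G ⟶ j ⋙ H => Functor.whiskerLeft e.functor α :=
    ⟨(e.symm.congrLeft (E := Z)).functor.map_injective,
      (e.symm.congrLeft (E := Z)).functor.map_surjective⟩
  exact h.comp (hG H)

theorem of_iso (hG : Dense j G) (i : G ≅ H) : Dense j H := by
  intro K
  constructor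
  · intro α β h
    have : i.hom ≫ α = i.hom ≫ β := hG.ext fun x => by
      have := congrArg (fun t => t.app x) h
      simp only [Functor.whiskerLeft_app] at this
      simp [this]
    simpa using this
  · intro γ
    obtain ⟨α, h⟩ := hG.exists_hom (Functor.whiskerLeft j i.hom ≫ γ)
    refine ⟨i.inv ≫ α, ?_⟩
    ext x
    simp [h]

end Dense
end Dense

/-! ### Pointwise left Kan extensions into presheaf categories -/

namespace Presheaf
open Opposite

variable {X : Type u} [Category.{u} X] {Y : Type u₂} [Category.{u} Y]
  {B C : Type u} [Category.{u} B] [Category.{u} C]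

/-- The nerve `w ↦ Hom(j -, w)` of a functor out of a small category. -/
def nerve (j : X ⥤ Y) : Y ⥤ Xᵒᵖ ⥤ Type u := yoneda ⋙ (Functor.whiskeringLeft _ _ _).obj j.op

/-- Functors that are pointwise left Kan extensions of presheaf-valued functors. -/
def Good (j : X ⥤ Y) (G : Y ⥤ Bᵒᵖ ⥤ Type u) : Prop :=
  ∃ h : X ⥤ Bᵒᵖ ⥤ Type u, Nonempty (nerve j ⋙ extend h ≅ G)

/-- The canonical comparison from the left Kan extension. -/
def comparison (j : X ⥤ Y) (G : Y ⥤ Bᵒᵖ ⥤ Type u) {h : X ⥤ Bᵒᵖ ⥤ Type u} (γ : h ⟶ j ⋙ G) :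
    nerve j ⋙ extend h ⟶ G where
  app w :=
    { app b := ↾(Coend.lift (F := h) (p := (nerve j).obj w) (y := b)
        (fun x s t => (G.map t).app b ((γ.app x).app b s)) (by
          intro x x' f s t
          have h1 := ConcreteCategory.congr_hom (NatTrans.congr_app (γ.naturality f) b) s
          have h2 := ConcreteCategory.congr_hom (NatTrans.congr_app (G.map_comp (j.map f) t) b)
            ((γ.app x).app b s)
          exact h2.trans (congrArg ((G.map t).app b) h1.symm)))
      naturality b b' k := by
        ext a
        induction a using Coend.ind with | _ x s t
        have h1 := (γ.app x).naturality_apply k s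
        have h2 := (G.map t).naturality_apply k ((γ.app x).app b s)
        exact (congrArg ((G.map t).app b') h1).trans h2 }
  naturality w w' f := by
    refine hom_ext_apply fun b a => ?_
    induction a using Coend.ind with | _ x s t
    exact ConcreteCategory.congr_hom (NatTrans.congr_app (G.map_comp t f) b) ((γ.app x).app b s)

/-- A pointwise bijective transformation between presheaf-valued functors is invertible. -/
noncomputable def isoOfBijective {Z : Type u₃} [Category.{v₃} Z] {G H : Z ⥤ Bᵒᵖ ⥤ Type u}
    (γ : G ⟶ H) (hγ : ∀ w b, Function.Bijective ((γ.app w).app b)) : G ≅ H :=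
  NatIso.ofComponents (fun w => NatIso.ofComponents
    (fun b => (Equiv.ofBijective _ (hγ w b)).toIso)
    (fun f => (γ.app w).naturality f)) (fun f => by
      ext b s
      exact ConcreteCategory.congr_hom (NatTrans.congr_app (γ.naturality f) b) s)

namespace Good
variable {j : X ⥤ Y} {G H : Y ⥤ Bᵒᵖ ⥤ Type u}

theorem of_iso (h : Good j G) (i : G ≅ H) : Good j H := by
  obtain ⟨k, ⟨e⟩⟩ := h
  exact ⟨k, ⟨e ≪≫ i⟩⟩

/-- `extend F` preserves left Kan extensions: by `mu`, extending `k` and then applying `extend F` is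
extending `k ⋙ extend F`. -/
theorem comp_extend (h : Good j G) (F : B ⥤ Cᵒᵖ ⥤ Type u) : Good j (G ⋙ extend F) := by
  obtain ⟨k, ⟨e⟩⟩ := h
  exact ⟨k ⋙ extend F, ⟨Functor.isoWhiskerLeft (nerve j) (mu k F) ≪≫
    Functor.isoWhiskerRight e (extend F)⟩⟩

theorem of_bijective {h : X ⥤ Bᵒᵖ ⥤ Type u} (γ : h ⟶ j ⋙ G)
    (hγ : ∀ w b, Function.Bijective (((comparison j G γ).app w).app b)) : Good j G := by
  exact ⟨h, ⟨isoOfBijective _ hγ⟩⟩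

/-- Every element `[x, s, t]` of the extension at `w` is the image under `t : j x ⟶ w` of `[x, s,
1]`, so a transformation is determined by its values on the elements `[x, s, 1]`, which lie over the
image of `j`. Conversely, values there define a transformation out of `k`, and `comparison` extends
it. -/
theorem dense [j.Full] (h : Good j G) : Dense j G := by
  obtain ⟨k, ⟨e⟩⟩ := h
  refine Dense.of_iso ?_ e
  intro H
  constructor
  · intro α β hαβ
    ext w : 2
    refine hom_ext_apply fun b a => ?_
    induction a using Coend.ind with | _ x s t
    change (j.obj x ⟶ w) at t
    have h0 : (Coend.mk x s t : ((nerve j ⋙ extend k).obj w).obj b) =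
        ((nerve j ⋙ extend k).map t).app b (Coend.mk x s (𝟙 (j.obj x))) :=
      congrArg (fun t => Coend.mk (p := (nerve j).obj w) x s t) (Category.id_comp t).symm
    have h1 := ConcreteCategory.congr_hom (NatTrans.congr_app (α.naturality t) b)
      (Coend.mk x s (𝟙 (j.obj x)))
    have h2 := ConcreteCategory.congr_hom (NatTrans.congr_app (β.naturality t) b)
      (Coend.mk x s (𝟙 (j.obj x)))
    have h3 : α.app (j.obj x) = β.app (j.obj x) := congrArg (fun f => f.app x) hαβ
    rw [h0]
    refine h1.trans (Eq.trans ?_ h2.symm)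
    exact congrArg (fun f => (H.map t).app b (f.app b (Coend.mk x s (𝟙 (j.obj x))))) h3
  · intro γ
    -- The adjoint transpose of `γ`: its value at `s` is the value of `γ` at `[x, s, 1]`.
    let δ : k ⟶ j ⋙ H :=
      { app x := { app b := ↾(fun s => (γ.app x).app b (Coend.mk (p := (nerve j).obj (j.obj x)) x s (𝟙 (j.obj x))))
                   naturality b b' f := by
                    ext s
                    exact (γ.app x).naturality_apply f
                      (Coend.mk (p := (nerve j).obj (j.obj x)) x s (𝟙 (j.obj x))) }
        naturality x x' f := by
          refine hom_ext_apply fun b s => ?_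
          have h1 := ConcreteCategory.congr_hom (NatTrans.congr_app (γ.naturality f) b)
            (Coend.mk (p := (nerve j).obj (j.obj x)) x s (𝟙 (j.obj x)))
          refine Eq.trans ?_ h1
          refine congrArg ((γ.app x').app b) ?_
          refine (Coend.sound (p := (nerve j).obj (j.obj x')) f s (𝟙 (j.obj x'))).symm.trans ?_
          refine congrArg (fun t => Coend.mk (p := (nerve j).obj (j.obj x')) x s t) ?_
          exact (Category.comp_id _).trans (Category.id_comp _).symm }
    refine ⟨comparison j H δ, ?_⟩
    ext x : 2
    refine hom_ext_apply fun b a => ?_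
    induction a using Coend.ind with | _ x' s t
    change (j.obj x' ⟶ j.obj x) at t
    -- Fullness enters here: `γ` is natural only along morphisms coming from `X`, so `t` has to be
    -- one of them for `[x', s, t]` to be reached from `[x', s, 1]`.
    obtain ⟨t, rfl⟩ := j.map_surjective t
    have h1 := ConcreteCategory.congr_hom (NatTrans.congr_app (γ.naturality t) b)
      (Coend.mk (p := (nerve j).obj (j.obj x')) x' s (𝟙 (j.obj x')))
    refine h1.symm.trans ?_
    refine congrArg ((γ.app x).app b) ?_
    exact congrArg (fun t => Coend.mk (p := (nerve j).obj (j.obj x)) x' s t) (Category.id_comp _)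

end Good

/-- The nerve of a fully faithful functor restricts to the Yoneda embedding. -/
noncomputable def nerveRestrict (j : X ⥤ Y) [j.Full] [j.Faithful] : CategoryTheory.yoneda ≅ j ⋙ nerve j :=
  isoOfBijective
    { app x :=
        { app x' := ↾(fun t => j.map t)
          naturality x' x'' f := by
            ext t
            exact j.map_comp _ _ }
      naturality x x' f := by
        refine hom_ext_apply fun x'' t => ?_
        exact j.map_comp _ _ }
    (fun x x' => ⟨j.map_injective, j.map_surjective⟩)

/-- The nerve of the Yoneda embedding is the identity. -/
def nerveYoneda : nerve (yoneda : X ⥤ Xᵒᵖ ⥤ Type u) ≅ 𝟭 _ :=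
  NatIso.ofComponents (fun p => NatIso.ofComponents (fun x => yonedaEquiv.toIso)
    (by
      intro x x' f
      ext t
      exact (yonedaEquiv_naturality' t f).symm))
    (by
      intro p q f
      ext x t
      rfl)

/-- The density theorem: a presheaf is the canonical colimit of representables. It is the starting
point for all other instances of `Good` along Yoneda. -/
theorem good_yoneda_id : Good (yoneda : X ⥤ Xᵒᵖ ⥤ Type u) (𝟭 _) :=
  ⟨yoneda, ⟨Functor.isoWhiskerRight nerveYoneda _ ≪≫ Functor.leftUnitor _ ≪≫ theta⟩⟩

theorem good_yoneda_extend (F : X ⥤ Bᵒᵖ ⥤ Type u) : Good yoneda (extend F) :=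
  (good_yoneda_id.comp_extend F).of_iso (Functor.leftUnitor _)

end Presheaf
end PseudoLift

/-! ### Quotients of finite products and morphisms into concatenations -/

namespace PseudoLift

/-- A function on a finite product that respects reflexive relations in all coordinates
simultaneously descends to the product of the quotients. -/
theorem eq_of_quot_mk_eq {ι : Type*} [Finite ι] {α : ι → Type*} {β : Type*}
    {r : ∀ i, α i → α i → Prop} (hr : ∀ i a, r i a a) (F : (∀ i, α i) → β)
    (hF : ∀ u u', (∀ i, r i (u i) (u' i)) → F u = F u') (u u' : ∀ i, α i)
    (h : ∀ i, Quot.mk (r i) (u i) = Quot.mk (r i) (u' i)) : F u = F u' := by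
  classical
  have := Fintype.ofFinite ι
  -- Induction on a set `s` outside of which `u` and `u'` already agree; one coordinate is corrected
  -- at a time.
  suffices H : ∀ (s : Finset ι) (u : ∀ i, α i), (∀ i, Quot.mk (r i) (u i) = Quot.mk (r i) (u' i)) →
      (∀ i, i ∉ s → u i = u' i) → F u = F u' from
    H Finset.univ u h fun i hi => absurd (Finset.mem_univ i) hi
  intro s
  induction s using Finset.induction_on with
  | empty => exact fun u _ hu => congrArg F (funext fun i => hu i (Finset.notMem_empty i))
  | insert i s _ ih =>
    intro u h hu
    -- Along a zigzag in coordinate `i` the other coordinates stay fixed; reflexivity makes such a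
    -- move an instance of the simultaneous relation in `hF`.
    have key : ∀ c c', Relation.EqvGen (r i) c c' →
        F (Function.update u i c) = F (Function.update u i c') := by
      intro c c' hc
      induction hc with
      | rel c c' hc =>
        refine hF _ _ fun k => ?_
        by_cases hk : k = i
        · subst hk; simpa using hc
        · simpa [hk] using hr k _
      | refl c => rfl
      | symm c c' _ ih => exact ih.symm
      | trans _ _ _ _ _ h1 h2 => exact h1.trans h2
    have h1 := key (u i) (u' i) (Quot.eqvGen_exact (h i))
    rw [Function.update_eq_self] at h1
    rw [h1]
    refine ih _ (fun k => ?_) fun k hk => ?_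
    · by_cases hki : k = i
      · subst hki; simp
      · simpa [hki] using h k
    · by_cases hki : k = i
      · subst hki; simp
      · simpa [hki] using hu k (by simp [hki, hk])

namespace Tuples
variable {κ : MonoidalKind} {X : Type u} [Category.{v} X] {Y : Type u₂} [Category.{v₂} Y]

/-- Both hom-sets are disjoint unions, over the same admissible reindexings, of finite products, and
`T` acts as a product of bijections on each summand. -/
theorem bijective_of_mkHom {m n : ℕ} {x : Fin n → X} {y : Fin m → X} {x' : Fin n → Y}
    {y' : Fin m → Y}
    (T : ((⟨n, x⟩ : Tuples κ X) ⟶ ⟨m, y⟩) → ((⟨n, x'⟩ : Tuples κ Y) ⟶ ⟨m, y'⟩))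
    (e : ∀ i k, (x i ⟶ y k) → (x' i ⟶ y' k)) (he : ∀ i k, Function.Bijective (e i k))
    (hT : ∀ (φ : Fin m → Fin n) (hφ : κ.Admissible φ) (f : ∀ k, x (φ k) ⟶ y k),
      T (mkHom φ hφ f) = mkHom (x := ⟨n, x'⟩) (y := ⟨m, y'⟩) φ hφ fun k => e _ _ (f k)) :
    Function.Bijective T := by
  constructor
  · intro f g h
    obtain ⟨φ, hφ, f, rfl⟩ := exists_mkHom f
    obtain ⟨ψ, hψ, g, rfl⟩ := exists_mkHom g
    rw [hT, hT] at h
    obtain rfl : φ = ψ := congrArg Hom.idx h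
    congr 1
    funext k
    exact (he _ _).1 (congrFun (mkHom_inj h) k)
  · intro g
    obtain ⟨φ, hφ, g, rfl⟩ := exists_mkHom g
    choose f hf using fun k => (he _ _).2 (g k)
    exact ⟨mkHom φ hφ f, (hT _ _ _).trans (congrArg (mkHom φ hφ) (funext hf))⟩

theorem exists_mkHom_unit {x : Tuples κ X} {w : X} (f : x ⟶ (unitFunctor κ X).obj w) :
    ∃ (i : Fin x.len) (h : κ.Admissible fun _ : Fin 1 => i) (m : x.get i ⟶ w),
      mkHom (y := (unitFunctor κ X).obj w) (fun _ => i) h (fun _ => m) = f := by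
  obtain ⟨φ, hφ, m, rfl⟩ := exists_mkHom f
  obtain ⟨i, rfl⟩ : ∃ i, φ = fun _ => i := ⟨φ (0 : Fin 1), funext fun k =>
    congrArg φ (Subsingleton.elim (α := Fin 1) k 0)⟩
  refine ⟨i, hφ, m (0 : Fin 1), ?_⟩
  congr 1
  funext k
  obtain rfl : k = (0 : Fin 1) := Subsingleton.elim (α := Fin 1) k 0
  rfl

/-- A morphism into a concatenation, given by a reindexing on pairs of positions. -/
def mkFlat {x : Tuples κ X} {w : Tuples κ (Tuples κ X)}
    (I : (Σ i : Fin w.len, Fin (w.get i).len) → Fin x.len)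
    (hI : κ.Admissible fun q => I (finSigmaFinEquiv.symm q))
    (m : ∀ b, x.get (I b) ⟶ getSigma w b) : x ⟶ flattenObj w :=
  mkHom (y := flattenObj w) (fun q => I (finSigmaFinEquiv.symm q)) hI
    fun q => m (finSigmaFinEquiv.symm q)

theorem exists_mkFlat {x : Tuples κ X} {w : Tuples κ (Tuples κ X)} (f : x ⟶ flattenObj w) :
    ∃ I hI m, mkFlat I hI m = f := by
  -- Positions of the concatenation are encoded and decoded again, which is the identity only
  -- propositionally; hence the `eqToHom` in the components.
  have h1 : ∀ q, f.idx (finSigmaFinEquiv (finSigmaFinEquiv.symm q)) = f.idx q := fun q => by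
    rw [Equiv.apply_symm_apply]
  refine ⟨fun b => f.idx (finSigmaFinEquiv b), ?_, fun b => f.map _ (finSigmaFinEquiv b) rfl ≫
    eqToHom (congrArg (getSigma w) (Equiv.symm_apply_apply _ b)), ?_⟩
  · refine (congrArg κ.Admissible ?_).mpr f.admissible
    exact funext h1
  · refine Eq.trans ?_ (mkHom_eta f)
    refine mkHom_congr (funext h1) fun q => ?_
    have : ∀ q' (hq : q' = q), f.map _ q' rfl ≫ eqToHom (by rw [hq]) =
        eqToHom (by rw [hq]) ≫ f.map _ q rfl := by
      rintro _ rfl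
      simp
    exact this _ (Equiv.apply_symm_apply _ q)

theorem mkFlat_inj {x : Tuples κ X} {w : Tuples κ (Tuples κ X)}
    {I I' : (Σ i : Fin w.len, Fin (w.get i).len) → Fin x.len} {hI hI'}
    {m : ∀ b, x.get (I b) ⟶ getSigma w b} {m' : ∀ b, x.get (I' b) ⟶ getSigma w b}
    (h : mkFlat I hI m = mkFlat I' hI' m') : I = I' ∧ HEq m m' := by
  obtain rfl : I = I' := by
    funext b
    simpa [mkFlat, mkHom] using
      congrFun (congrArg Hom.idx h) (finSigmaFinEquiv b)
  refine ⟨rfl, heq_of_eq ?_⟩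
  funext b
  obtain ⟨q, rfl⟩ := finSigmaFinEquiv.symm.surjective b
  exact congrFun (mkHom_inj h) q

/-- The second factor changes no position, so composing with its concatenation leaves `I` alone.
This lets entrywise morphisms slide across the coend for `flatten`. -/
theorem mkFlat_comp_homOver {x : Tuples κ X} {n : ℕ} {l : Fin n → ℕ} {v w : ∀ i, Fin (l i) → X}
    (I : (Σ i : Fin n, Fin (l i)) → Fin x.len)
    (hI : κ.Admissible fun q => I (finSigmaFinEquiv.symm q))
    (f : ∀ b, x.get (I b) ⟶ v b.1 b.2) (m : ∀ i k, v i k ⟶ w i k) :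
    mkFlat (w := ⟨n, fun i => ⟨l i, v i⟩⟩) I hI f ≫
        flattenHom (homOver (fun i => homOver (m i)) :
          (⟨n, fun i => ⟨l i, v i⟩⟩ : Tuples κ (Tuples κ X)) ⟶ ⟨n, fun i => ⟨l i, w i⟩⟩) =
      mkFlat (w := ⟨n, fun i => ⟨l i, w i⟩⟩) I hI fun b => f b ≫ m b.1 b.2 := by
  refine hom_ext (fun q => ?_) fun i q h h' => ?_
  · exact congrArg (fun q => I (finSigmaFinEquiv.symm q)) (Equiv.apply_symm_apply finSigmaFinEquiv q)
  · obtain rfl : I (finSigmaFinEquiv.symm q) = i := h'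
    exact comp_map (mkFlat (w := ⟨n, fun i => ⟨l i, v i⟩⟩) I hI f)
      (flattenHom (homOver (fun i => homOver (m i)) :
        (⟨n, fun i => ⟨l i, v i⟩⟩ : Tuples κ (Tuples κ X)) ⟶ ⟨n, fun i => ⟨l i, w i⟩⟩)) _ q q rfl
      (Equiv.apply_symm_apply finSigmaFinEquiv q) h

theorem mapFunctor_mkFlat (F : X ⥤ Y) {x : Tuples κ X} {w : Tuples κ (Tuples κ X)}
    (I : (Σ i : Fin w.len, Fin (w.get i).len) → Fin x.len)
    (hI : κ.Admissible fun q => I (finSigmaFinEquiv.symm q))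
    (m : ∀ b, x.get (I b) ⟶ getSigma w b) :
    (mapFunctor F).map (mkFlat I hI m) =
      mkFlat (x := (mapFunctor F).obj x) (w := (mapFunctor (mapFunctor F)).obj w) I hI
        fun b => F.map (m b) :=
  mapFunctor_mkHom F _ _ _

/-- Morphisms of tuples of tuples factor as reindexings followed by families of morphisms. -/
theorem exists_factorization (F : X ⥤ Y) (x : Tuples κ (Tuples κ X)) (y : Tuples κ (Tuples κ Y))
    (f : (mapFunctor (mapFunctor F)).obj x ⟶ y) :
    ∃ (v : ∀ i : Fin y.len, Fin (y.get i).len → X)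
      (g : x ⟶ ⟨y.len, fun i => ⟨(y.get i).len, v i⟩⟩)
      (m : ∀ i k, F.obj (v i k) ⟶ (y.get i).get k),
      f = (mapFunctor (mapFunctor F)).map g ≫
        (homOver (fun i => (homOver (m i) : _ ⟶ y.get i)) : _ ⟶ (⟨y.len, y.get⟩ : Tuples κ _)) := by
  obtain ⟨φ, hφ, f, rfl⟩ := exists_mkHom f
  choose ψ hψ m hm using fun i => exists_mkHom (f i)
  refine ⟨fun i k => (x.get (φ i)).get (ψ i k),
    mkHom (y := ⟨y.len, fun i => (x.get (φ i)).reindex (ψ i)⟩) φ hφ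
      fun i => toReindex (x.get (φ i)) (ψ i) (hψ i), m, ?_⟩
  refine Eq.symm ((congrArg (· ≫ _) (mapFunctor_mkHom _ _ _ _)).trans ?_)
  refine (mkHom_comp (x := (mapFunctor (mapFunctor F)).obj x)
    (y := ⟨y.len, fun i => (mapFunctor F).obj ((x.get (φ i)).reindex (ψ i))⟩)
    (z := ⟨y.len, y.get⟩) φ hφ _ (fun i => i) (.id _) fun i => homOver (m i)).trans ?_
  congr 1
  funext i
  exact (map_toReindex_comp_homOver F (x.get (φ i)) (ψ i) (hψ i) (m i)).trans (hm i)

theorem mapFunctor_homOver_comp (F : X ⥤ Y) {n : ℕ} {x y : Fin n → X} {z : Fin n → Y}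
    (f : ∀ i, x i ⟶ y i) (g : ∀ i, F.obj (y i) ⟶ z i) :
    (mapFunctor F).map (homOver f : (⟨n, x⟩ : Tuples κ X) ⟶ ⟨n, y⟩) ≫
      (homOver g : _ ⟶ (⟨n, z⟩ : Tuples κ Y)) = homOver fun i => F.map (f i) ≫ g i := by
  refine hom_ext (fun _ => rfl) ?_
  rintro i j rfl _
  rfl

theorem mapFunctor_mapFunctor_homOver_comp (F : X ⥤ Y) {n : ℕ} {l : Fin n → ℕ}
    {u v : ∀ i, Fin (l i) → X} {w : ∀ i, Fin (l i) → Y} (f : ∀ i k, u i k ⟶ v i k)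
    (g : ∀ i k, F.obj (v i k) ⟶ w i k) :
    (mapFunctor (mapFunctor F)).map (homOver (fun i => homOver (f i)) :
        (⟨n, fun i => ⟨l i, u i⟩⟩ : Tuples κ (Tuples κ X)) ⟶ ⟨n, fun i => ⟨l i, v i⟩⟩) ≫
      (homOver (fun i => homOver (g i)) : _ ⟶ (⟨n, fun i => ⟨l i, w i⟩⟩ : Tuples κ (Tuples κ Y))) =
      homOver fun i => homOver fun k => F.map (f i k) ≫ g i k :=
  (mapFunctor_homOver_comp (mapFunctor F) (fun i => homOver (f i)) fun i => homOver (g i)).trans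
    (congrArg homOver (funext fun i => mapFunctor_homOver_comp F (f i) (g i)))

end Tuples

/-! ### Nerves of tuple functors, and their restrictions along unit and concatenation -/

namespace Presheaf
open Opposite Tuples

variable {κ : MonoidalKind} {X : Type u} [Category.{u} X] {Y : Type u₂} [Category.{u} Y]
  {A B C : Type u} [Category.{u} A] [Category.{u} B] [Category.{u} C]

/-- The transformation `x' ⟶ x ↦ j x' ⟶ j x`. -/
def toNerve (j : X ⥤ Y) : CategoryTheory.yoneda ⟶ j ⋙ nerve j where
  app x :=
    { app x' := ↾(fun t => j.map t)
      naturality x' x'' f := by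
        ext t
        exact j.map_comp _ _ }
  naturality x x' f := by
    refine hom_ext_apply fun x'' t => ?_
    exact j.map_comp _ _

/-- The Yoneda lemma: a map from the representable at `x` to the nerve of `w` is an element of that
nerve at `x`, that is, a morphism `j x ⟶ w`. -/
theorem bijective_toNerve_comp (j : X ⥤ Y) (x : X) (w : Y) : Function.Bijective
    fun t : j.obj x ⟶ w => (toNerve j).app x ≫ (nerve j).map t := by
  have h : ∀ t : j.obj x ⟶ w, yonedaEquiv ((toNerve j).app x ≫ (nerve j).map t) = t := by
    intro t
    change j.map (𝟙 x) ≫ t = t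
    simp
  constructor
  · intro t t' e
    rw [← h t, ← h t']
    exact congrArg yonedaEquiv e
  · intro s
    refine ⟨yonedaEquiv s, ?_⟩
    apply yonedaEquiv.injective
    exact h _

/-- The comparison of nerves induced by a transformation. -/
def nerveTransfer {W : Type u₃} [Category.{u} W] {i : X ⥤ W} {j : X ⥤ Y} {N : Y ⥤ W}
    (ρ : i ⟶ j ⋙ N) : nerve j ⟶ N ⋙ nerve i where
  app w :=
    { app x := ↾(fun t : j.obj (unop x) ⟶ w => ρ.app (unop x) ≫ N.map t)
      naturality x x' f := by
        ext t
        change (j.obj (unop x) ⟶ w) at t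
        change ρ.app (unop x') ≫ N.map (j.map f.unop ≫ t) =
          i.map f.unop ≫ ρ.app (unop x) ≫ N.map t
        have := ρ.naturality f.unop
        simp only [Functor.comp_map] at this
        rw [N.map_comp, ← Category.assoc, ← Category.assoc, this] }
  naturality w w' f := by
    refine hom_ext_apply fun x t => ?_
    change (j.obj (unop x) ⟶ w) at t
    change ρ.app (unop x) ≫ N.map (t ≫ f) = (ρ.app (unop x) ≫ N.map t) ≫ N.map f
    rw [N.map_comp, Category.assoc]

/-- The nerve of `S j` in terms of the nerve of `j`. -/
noncomputable def nerveMapFunctor (j : X ⥤ Y) : nerve (mapFunctor (κ := κ) j) ≅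
    mapFunctor (nerve j) ⋙ nerve (mapFunctor (CategoryTheory.yoneda (C := X))) :=
  isoOfBijective (nerveTransfer (N := mapFunctor (nerve j)) (mapNatTrans (toNerve j)))
    (fun w x => by
      refine bijective_of_mkHom (x := fun i => j.obj ((unop x).get i)) (y := w.get)
        (x' := fun i => CategoryTheory.yoneda.obj ((unop x).get i))
        (y' := fun k => (nerve j).obj (w.get k))
        _ (fun i k t => (toNerve j).app ((unop x).get i) ≫ (nerve j).map t)
        (fun i k => bijective_toNerve_comp j _ _) ?_
      intro φ hφ f
      refine (congrArg (((mapNatTrans (toNerve j)).app (unop x)) ≫ ·)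
        (mapFunctor_mkHom (nerve j) (x := (mapFunctor j).obj (unop x)) (y := w) φ hφ f)).trans ?_
      exact mkHom_comp (x := (mapFunctor (CategoryTheory.yoneda (C := X))).obj (unop x))
        (y := (mapFunctor (nerve j)).obj ((mapFunctor j).obj (unop x)))
        (z := (mapFunctor (nerve j)).obj w)
        (fun i => i) (.id _) (fun i => (toNerve j).app ((unop x).get i)) φ hφ
        fun k => (nerve j).map (f k))

/-- Used with `V` a coend and `s` a parametrization of its elements by normal forms: no inverse map
out of the quotient has to be produced. -/
theorem bijective_of_section {U V W : Type*} {s : U → V} {c : V → W}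
    (hs : Function.Surjective s) (h : Function.Bijective (c ∘ s)) : Function.Bijective c :=
  ⟨h.1.of_comp_right hs, h.2.of_comp⟩

/-- A morphism from a tuple to a tuple of length one selects one position `i` and a morphism out of
that entry. Morphisms `S j x ⟶ (w)` are thus pairs of an admissible `i` and `j x_i ⟶ w`, and each
element of the coend has a representative whose first component is the bare selection of `x_i`. -/
theorem good_unit_nerve (j : X ⥤ Y) :
    Good j (unitFunctor κ Y ⋙ nerve (mapFunctor j)) := by
  refine Good.of_bijective (h := unitFunctor κ X ⋙ CategoryTheory.yoneda)
    (Functor.whiskerLeft (unitFunctor κ X) (toNerve (mapFunctor j))) fun w x => ?_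
  let F := unitFunctor κ X ⋙ CategoryTheory.yoneda
  let U := Σ' (i : Fin (unop x).len) (_ : κ.Admissible fun _ : Fin 1 => i),
    (j.obj ((unop x).get i) ⟶ w)
  let s : U → Coend F ((nerve j).obj w) x :=
    fun c => Coend.mk (F := F) (p := (nerve j).obj w) ((unop x).get c.1)
      (toReindex (unop x) (fun _ : Fin 1 => c.1) c.2.1) c.2.2
  have hs : Function.Surjective s := by
    intro a
    induction a using Coend.ind with | _ a f t
    change (unop x ⟶ (unitFunctor κ X).obj a) at f
    change (j.obj a ⟶ w) at t
    obtain ⟨i, h, m, rfl⟩ := exists_mkHom_unit f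
    refine ⟨⟨i, h, j.map m ≫ t⟩, ?_⟩
    -- The morphism `m : x_i ⟶ a` slides across the coend and is absorbed in the second component.
    refine (Coend.sound (F := F) (p := (nerve j).obj w) m
      (toReindex (unop x) (fun _ : Fin 1 => i) h) t).trans ?_
    refine congrArg (fun f => Coend.mk (F := F) (p := (nerve j).obj w) a f t) ?_
    exact map_toReindex_comp_homOver (𝟭 X) (unop x) (fun _ : Fin 1 => i) h
      (y := fun _ => a) fun _ => m
  refine bijective_of_section hs ?_
  have key : ∀ c : U, ((comparison j (unitFunctor κ Y ⋙ nerve (mapFunctor j))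
      (Functor.whiskerLeft (unitFunctor κ X) (toNerve (mapFunctor j)))).app w).app x (s c) =
      mkHom (x := (mapFunctor j).obj (unop x)) (y := (unitFunctor κ Y).obj w) (fun _ => c.1) c.2.1
        fun _ => c.2.2 := fun c =>
    map_toReindex_comp_homOver j (unop x) (fun _ : Fin 1 => c.1) c.2.1
      (y := fun _ => w) fun _ => c.2.2
  constructor
  · rintro ⟨i, h, m⟩ ⟨i', h', m'⟩ e
    replace e := (key _).symm.trans (e.trans (key _))
    obtain rfl : i = i' := congrFun (congrArg Hom.idx e) (0 : Fin 1)
    obtain rfl : m = m' := congrFun (mkHom_inj e) (0 : Fin 1)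
    rfl
  · intro f
    obtain ⟨i, h, m, rfl⟩ := exists_mkHom_unit (x := (mapFunctor j).obj (unop x)) f
    exact ⟨⟨i, h, m⟩, key _⟩

/-- A morphism from `S j x` to a concatenation `flatten w` assigns to each pair of positions of `w`
an entry of `x` and a morphism out of it. The corresponding normal form in the coend has as middle
object a tuple of tuples with the shape of `w`. Admissibility never has to be split into blocks: the
whole reindexing sits in the map from `x` to the concatenation, and the map to `w` is entrywise. -/
theorem good_flatten_nerve (j : X ⥤ Y) :
    Good (mapFunctor (mapFunctor j)) (flatten κ Y ⋙ nerve (mapFunctor j)) := by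
  refine Good.of_bijective (h := flatten κ X ⋙ CategoryTheory.yoneda)
    (Functor.whiskerLeft (flatten κ X) (toNerve (mapFunctor j))) fun w x => ?_
  let F := flatten κ X ⋙ CategoryTheory.yoneda
  let p := (nerve (mapFunctor (κ := κ) (mapFunctor (κ := κ) j))).obj w
  let U := Σ' (I : (Σ i : Fin w.len, Fin (w.get i).len) → Fin (unop x).len)
    (_ : κ.Admissible fun q => I (finSigmaFinEquiv.symm q)),
    (∀ b, j.obj ((unop x).get (I b)) ⟶ getSigma w b)
  -- The middle object: the bracketing of `w`, filled with the entries of `x` selected by `I`.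
  let V : ((Σ i : Fin w.len, Fin (w.get i).len) → Fin (unop x).len) → Tuples κ (Tuples κ X) :=
    fun I => ⟨w.len, fun i => ⟨(w.get i).len, fun k => (unop x).get (I ⟨i, k⟩)⟩⟩
  let s : U → Coend F p x :=
    fun c => Coend.mk (F := F) (p := p) (V c.1)
      (mkFlat (w := V c.1) c.1 c.2.1 fun _ => 𝟙 _)
      (homOver (y := w.get) fun i => homOver (y := (w.get i).get) fun k => c.2.2 ⟨i, k⟩)
  have hs : Function.Surjective s := by
    intro a
    induction a using Coend.ind with | _ a f t
    change (unop x ⟶ flattenObj a) at f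
    change ((mapFunctor (mapFunctor j)).obj a ⟶ w) at t
    -- Two slides give the normal form. The reindexing part `g` of `t` moves to the left, where `f ≫
    -- flatten g` has positions `I` and components `n`; then `n`, regarded as the entrywise morphism
    -- `g'`, moves back to the right.
    obtain ⟨v, g, m, rfl⟩ := exists_factorization j a w t
    obtain ⟨I, hI, n, e⟩ := exists_mkFlat (f ≫ (flatten κ X).map g)
    refine ⟨⟨I, hI, fun b => j.map (n b) ≫ m b.1 b.2⟩, ?_⟩
    refine Eq.trans ?_ (Coend.sound (F := F) (p := p) (y := x) g f _).symm
    let g' : V I ⟶ ⟨w.len, fun i => ⟨(w.get i).len, v i⟩⟩ :=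
      homOver fun i => homOver fun k => n ⟨i, k⟩
    have e1 : (F.map g).app x f = (F.map g').app x (mkFlat (w := V I) I hI fun _ => 𝟙 _) := by
      refine e.symm.trans (Eq.trans ?_ (mkFlat_comp_homOver (v := fun i k => (unop x).get (I ⟨i, k⟩))
        (w := v) I hI (fun _ => 𝟙 _) fun i k => n ⟨i, k⟩).symm)
      congr 1
      funext b
      exact (Category.id_comp _).symm
    rw [e1]
    refine Eq.trans ?_ (Coend.sound (F := F) (p := p) (y := x) g'
      (mkFlat (w := V I) I hI fun _ => 𝟙 _) _)
    refine congrArg (fun t => Coend.mk (F := F) (p := p) (y := x) (V I)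
      (mkFlat (w := V I) I hI fun _ => 𝟙 _) t) ?_
    exact (mapFunctor_mapFunctor_homOver_comp (w := fun i => (w.get i).get) j
      (fun i k => n ⟨i, k⟩) m).symm
  refine bijective_of_section hs ?_
  have key : ∀ c : U, ((comparison (mapFunctor (mapFunctor j)) (flatten κ Y ⋙ nerve (mapFunctor j))
      (Functor.whiskerLeft (flatten κ X) (toNerve (mapFunctor j)))).app w).app x (s c) =
      mkFlat (x := (mapFunctor j).obj (unop x)) (w := w) c.1 c.2.1 c.2.2 := by
    intro c
    refine (congrArg (· ≫ flattenHom _) (mapFunctor_mkFlat j (x := unop x) (w := V c.1) c.1 c.2.1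
      fun _ => 𝟙 _)).trans ?_
    refine (mkFlat_comp_homOver (x := (mapFunctor j).obj (unop x))
      (v := fun i k => j.obj ((unop x).get (c.1 ⟨i, k⟩)))
        (w := fun i => (w.get i).get) c.1 c.2.1 (fun _ => j.map (𝟙 _)) fun i k => c.2.2 ⟨i, k⟩).trans ?_
    congr 1
    funext b
    refine (congrArg (· ≫ _) (j.map_id _)).trans (Category.id_comp _)
  constructor
  · rintro ⟨i, h, m⟩ ⟨i', h', m'⟩ e
    replace e := (key _).symm.trans (e.trans (key _))
    obtain ⟨rfl, e⟩ := mkFlat_inj e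
    obtain rfl := eq_of_heq e
    rfl
  · intro f
    obtain ⟨I, h, m, rfl⟩ := exists_mkFlat (x := (mapFunctor j).obj (unop x)) f
    exact ⟨⟨I, h, m⟩, key _⟩

end Presheaf
end PseudoLift

/-! ### Tuples of extensions, and Day convolution -/

namespace PseudoLift
namespace Presheaf
open Opposite Tuples

variable {κ : MonoidalKind} {X : Type u} [Category.{u} X] {Y : Type u₂} [Category.{u} Y]
  {A B C : Type u} [Category.{u} A] [Category.{u} B] [Category.{u} C]

section
variable (F : A ⥤ Bᵒᵖ ⥤ Type u) (b : B) (p : Aᵒᵖ ⥤ Type u)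

/-- Formal factorizations of morphisms from a representable to a left Kan extension. -/
abbrev Factorization : Type u :=
  Σ a : A, (CategoryTheory.yoneda.obj b ⟶ F.obj a) × (CategoryTheory.yoneda.obj a ⟶ p)

variable {F b p}

/-- The morphism given by a factorization. -/
def Factorization.hom (c : Factorization F b p) :
    CategoryTheory.yoneda.obj b ⟶ (extend F).obj p :=
  c.2.1 ≫ (eta F).hom.app c.1 ≫ (extend F).map c.2.2

/-- The relation generating equality of the morphisms given by factorizations. -/
inductive Factorization.Rel : Factorization F b p → Factorization F b p → Prop
  | intro {a a' : A} (h : a ⟶ a') (s : CategoryTheory.yoneda.obj b ⟶ F.obj a)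
      (t : CategoryTheory.yoneda.obj a' ⟶ p) :
    Factorization.Rel ⟨a, s, CategoryTheory.yoneda.map h ≫ t⟩ ⟨a', s ≫ F.map h, t⟩

theorem Factorization.Rel.refl (c : Factorization F b p) : Factorization.Rel c c := by
  obtain ⟨a, s, t⟩ := c
  simpa using Factorization.Rel.intro (𝟙 a) s t

/-- Under the Yoneda lemma a factorization through `F a` is precisely a representative of an element
of the coend `(F* p)(b)`. -/
theorem Factorization.yonedaEquiv_hom (c : Factorization F b p) :
    yonedaEquiv c.hom = Coend.mk (F := F) (p := p) (y := op b) c.1 (yonedaEquiv c.2.1)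
      (yonedaEquiv c.2.2) :=
  rfl

theorem Factorization.exists_hom (f : CategoryTheory.yoneda.obj b ⟶ (extend F).obj p) :
    ∃ c : Factorization F b p, c.hom = f := by
  obtain ⟨a, rfl⟩ := yonedaEquiv.symm.surjective f
  induction a using Coend.ind with | _ a s t
  refine ⟨⟨a, yonedaEquiv.symm s, yonedaEquiv.symm t⟩, ?_⟩
  apply yonedaEquiv.injective
  rw [Factorization.yonedaEquiv_hom]
  simp only [Equiv.apply_symm_apply]
  exact (Equiv.apply_symm_apply (yonedaEquiv (X := b) (F := (extend F).obj p)) _).symm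

theorem Factorization.mk_eq_of_hom_eq {c c' : Factorization F b p} (h : c.hom = c'.hom) :
    Quot.mk Factorization.Rel c = Quot.mk Factorization.Rel c' := by
  have h1 := congrArg yonedaEquiv h
  rw [Factorization.yonedaEquiv_hom, Factorization.yonedaEquiv_hom] at h1
  -- The Yoneda bijections carry the coend relation to `Factorization.Rel`, so equality in the coend
  -- can be pushed forward to classes of factorizations.
  let T : Coend F p (op b) → ULift (Quot (Factorization.Rel (F := F) (b := b) (p := p))) :=
    Coend.lift (fun a s t => ⟨Quot.mk _ ⟨a, yonedaEquiv.symm s, yonedaEquiv.symm t⟩⟩) (by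
      intro a a' h s t
      refine congrArg ULift.up ?_
      have e1 : yonedaEquiv.symm (p.map h.op t) =
          CategoryTheory.yoneda.map h ≫ yonedaEquiv.symm t := by
        apply yonedaEquiv.injective
        rw [Equiv.apply_symm_apply]
        exact congrArg (p.map h.op) (Equiv.apply_symm_apply yonedaEquiv t).symm |>.trans
          (yonedaEquiv_naturality _ h)
      have e2 : yonedaEquiv.symm ((F.map h).app (op b) s) = yonedaEquiv.symm s ≫ F.map h := by
        apply yonedaEquiv.injective
        rw [Equiv.apply_symm_apply]
        exact congrArg ((F.map h).app (op b)) (Equiv.apply_symm_apply yonedaEquiv s).symm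
      rw [e1, e2]
      exact Quot.sound (.intro h _ _))
  have h2 := congrArg (fun a => (T a).down) h1
  simpa [T, Coend.lift, Coend.mk] using h2

end

/-- The comparison transformation for the compatibility of extensions with tuples. -/
def mapExtendTrans (F : A ⥤ Bᵒᵖ ⥤ Type u) :
    mapFunctor (κ := κ) F ⋙ nerve (mapFunctor CategoryTheory.yoneda) ⟶
      mapFunctor CategoryTheory.yoneda ⋙ mapFunctor (extend F) ⋙
        nerve (mapFunctor CategoryTheory.yoneda) :=
  Functor.whiskerRight (mapNatTrans (eta F).hom) (nerve (mapFunctor CategoryTheory.yoneda))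

/-- A map from a tuple of representables to `(F* p_k)_k` consists of a reindexing `φ` and maps from
representables to the `F* p_k`. Each of these factors through some `F a_k`, uniquely up to the coend
relation, and the chosen `a_k` form the tuple required by the coend over `S A`. Uniqueness needs the
finite product of these quotients to be the quotient of the product. -/
theorem good_mapFunctor_extend_nerve (F : A ⥤ Bᵒᵖ ⥤ Type u) :
    Good (mapFunctor (κ := κ) CategoryTheory.yoneda)
      (mapFunctor (extend F) ⋙ nerve (mapFunctor CategoryTheory.yoneda)) := by
  refine Good.of_bijective (mapExtendTrans F) fun p z => ?_
  let H := mapFunctor (κ := κ) F ⋙ nerve (mapFunctor CategoryTheory.yoneda)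
  let P := (nerve (mapFunctor (κ := κ) (CategoryTheory.yoneda (C := A)))).obj p
  let V : (Fin p.len → A) → Tuples κ A := fun a => ⟨p.len, a⟩
  -- The normal form: the reindexing is kept in the first component, and the map to `p` is
  -- entrywise.
  let s : ∀ (φ : Fin p.len → Fin (unop z).len) (_ : κ.Admissible φ)
    (_ : ∀ k, Factorization F ((unop z).get (φ k)) (p.get k)), Coend H P z :=
    fun φ hφ c => Coend.mk (F := H) (p := P) (y := z) (V fun k => (c k).1)
      (mkHom (x := (mapFunctor CategoryTheory.yoneda).obj (unop z))
        (y := (mapFunctor F).obj (V fun k => (c k).1)) φ hφ fun k => (c k).2.1)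
      (homOver (y := p.get) fun k => (c k).2.2)
  have hs : ∀ a, ∃ φ hφ c, s φ hφ c = a := by
    intro a
    induction a using Coend.ind with | _ a f t
    change ((mapFunctor CategoryTheory.yoneda).obj (unop z) ⟶ (mapFunctor F).obj a) at f
    change ((mapFunctor CategoryTheory.yoneda).obj a ⟶ p) at t
    obtain ⟨ψ, hψ, t, rfl⟩ := exists_mkHom t
    -- The reindexing `ψ` in the map to `p` comes from `S A`, so it can slide into the first
    -- component.
    have e1 := map_toReindex_comp_homOver CategoryTheory.yoneda a ψ hψ (y := p.get) t
    have e2 := Coend.sound (F := H) (p := P) (y := z) (toReindex a ψ hψ) f (homOver (y := p.get) t)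
    obtain ⟨φ, hφ, f', e3⟩ := exists_mkHom (f ≫ (mapFunctor F).map (toReindex a ψ hψ))
    refine ⟨φ, hφ, fun k => ⟨a.get (ψ k), f' k, t k⟩, ?_⟩
    refine Eq.trans ?_ (e2.symm.trans ?_)
    · exact congrArg (fun f => Coend.mk (F := H) (p := P) (y := z) (a.reindex ψ) f
        (homOver (y := p.get) t)) e3
    · exact congrArg (fun t => Coend.mk (F := H) (p := P) (y := z) a f t) e1
  have hrel : ∀ φ hφ c c', (∀ k, Factorization.Rel (c k) (c' k)) → s φ hφ c = s φ hφ c' := by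
    intro φ hφ c c' h
    have : ∀ k, ∃ (a a' : A) (h : a ⟶ a')
        (f : CategoryTheory.yoneda.obj ((unop z).get (φ k)) ⟶ F.obj a)
        (t : CategoryTheory.yoneda.obj a' ⟶ p.get k),
        c k = ⟨a, f, CategoryTheory.yoneda.map h ≫ t⟩ ∧ c' k = ⟨a', f ≫ F.map h, t⟩ := by
      intro k
      have aux : ∀ {c c' : Factorization F ((unop z).get (φ k)) (p.get k)},
          Factorization.Rel c c' → ∃ (a a' : A) (h : a ⟶ a')
            (f : CategoryTheory.yoneda.obj ((unop z).get (φ k)) ⟶ F.obj a)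
            (t : CategoryTheory.yoneda.obj a' ⟶ p.get k),
            c = ⟨a, f, CategoryTheory.yoneda.map h ≫ t⟩ ∧ c' = ⟨a', f ≫ F.map h, t⟩ := by
        rintro _ _ ⟨h, f, t⟩
        exact ⟨_, _, h, f, t, rfl, rfl⟩
      exact aux (h k)
    clear h
    choose a a' h f t hc hc' using this
    obtain rfl := funext hc
    obtain rfl := funext hc'
    -- One generating relation in each coordinate amounts to a single relation in the coend over `S
    -- A`, along the tuple of all the `h k`.
    let g : V a ⟶ V a' := homOver h
    let f₀ : (mapFunctor CategoryTheory.yoneda).obj (unop z) ⟶ (mapFunctor F).obj (V a) :=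
      mkHom (x := (mapFunctor CategoryTheory.yoneda).obj (unop z))
        (y := (mapFunctor F).obj (V a)) φ hφ f
    have e := Coend.sound (F := H) (p := P) (y := z) g f₀ (homOver (y := p.get) t)
    have e1 : (mapFunctor CategoryTheory.yoneda).map g ≫
        (homOver t : _ ⟶ (⟨p.len, p.get⟩ : Tuples κ _)) =
        homOver fun k => CategoryTheory.yoneda.map (h k) ≫ t k :=
      mapFunctor_homOver_comp CategoryTheory.yoneda h t
    have e2 : f₀ ≫ (mapFunctor F).map g = mkHom (x := (mapFunctor CategoryTheory.yoneda).obj (unop z))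
        (y := (mapFunctor F).obj (V a')) φ hφ fun k => f k ≫ F.map (h k) := by
      refine (congrArg (f₀ ≫ ·) (mapFunctor_homOver F h)).trans ?_
      exact mkHom_comp (x := (mapFunctor CategoryTheory.yoneda).obj (unop z))
        (y := (mapFunctor F).obj (V a)) (z := (mapFunctor F).obj (V a')) φ hφ f (fun i => i) (.id _)
        fun k => F.map (h k)
    refine (congrArg (fun t => Coend.mk (F := H) (p := P) (y := z) (V a) f₀ t) e1).symm.trans
      (e.trans ?_)
    exact congrArg (fun f => Coend.mk (F := H) (p := P) (y := z) (V a') f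
      (homOver (y := p.get) t)) e2
  have key : ∀ φ hφ c, ((comparison _ _ (mapExtendTrans (κ := κ) F)).app p).app z (s φ hφ c) =
      mkHom (x := (mapFunctor CategoryTheory.yoneda).obj (unop z))
        (y := (mapFunctor (extend F)).obj p) φ hφ fun k => (c k).hom := by
    intro φ hφ c
    let a : Tuples κ A := V fun k => (c k).1
    let f₀ : (mapFunctor CategoryTheory.yoneda).obj (unop z) ⟶ (mapFunctor F).obj a :=
      mkHom (x := (mapFunctor CategoryTheory.yoneda).obj (unop z)) (y := (mapFunctor F).obj a)
        φ hφ fun k => (c k).2.1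
    have e1 : f₀ ≫ (mapNatTrans (eta F).hom).app a =
        mkHom (x := (mapFunctor CategoryTheory.yoneda).obj (unop z))
          (y := (mapFunctor (extend F)).obj ((mapFunctor CategoryTheory.yoneda).obj a)) φ hφ
          fun k => (c k).2.1 ≫ (eta F).hom.app (c k).1 :=
      mkHom_comp (x := (mapFunctor CategoryTheory.yoneda).obj (unop z))
        (y := (mapFunctor F).obj a)
        (z := (mapFunctor (extend F)).obj ((mapFunctor CategoryTheory.yoneda).obj a)) φ hφ
        (fun k => (c k).2.1) (fun i => i) (.id _) fun k => (eta F).hom.app (c k).1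
    refine (congrArg (· ≫ (mapFunctor (extend F)).map (Y := p)
      (homOver (y := p.get) fun k => (c k).2.2)) e1).trans ?_
    refine (congrArg (_ ≫ ·) (mapFunctor_homOver (extend F) (y := p.get)
      fun k => (c k).2.2)).trans ?_
    refine (mkHom_comp (x := (mapFunctor CategoryTheory.yoneda).obj (unop z))
        (y := (mapFunctor (extend F)).obj ((mapFunctor CategoryTheory.yoneda).obj a))
        (z := (mapFunctor (extend F)).obj p) φ hφ
        (fun k => (c k).2.1 ≫ (eta F).hom.app (c k).1) (fun i => i) (.id _)
        fun k => (extend F).map (c k).2.2).trans ?_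
    rfl
  constructor
  · intro a a' e
    obtain ⟨φ, hφ, c, rfl⟩ := hs a
    obtain ⟨φ', hφ', c', rfl⟩ := hs a'
    replace e := (key _ _ _).symm.trans (e.trans (key _ _ _))
    obtain rfl : φ = φ' := congrArg Hom.idx e
    -- Equal images have the same `φ` and, in each coordinate, equal classes of factorizations.
    exact eq_of_quot_mk_eq (fun _ => Factorization.Rel.refl) (s φ hφ) (hrel φ hφ) c c' fun k =>
      Factorization.mk_eq_of_hom_eq (congrFun (mkHom_inj e) k)
  · intro f
    obtain ⟨φ, hφ, m, rfl⟩ := exists_mkHom (x := (mapFunctor CategoryTheory.yoneda).obj (unop z))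
      (y := (mapFunctor (extend F)).obj p) f
    choose c hc using fun k => Factorization.exists_hom (m k)
    exact ⟨s φ hφ c, (key _ _ _).trans (congrArg (mkHom φ hφ) (funext hc))⟩

/-- The structure map on presheaves induced by a structure map on a small category: the Day
convolution of a tuple of presheaves. -/
noncomputable def dayConvolution (b : Tuples κ B ⥤ B) :
    Tuples κ (Bᵒᵖ ⥤ Type u) ⥤ Bᵒᵖ ⥤ Type u :=
  nerve (mapFunctor CategoryTheory.yoneda) ⋙ extend (b ⋙ CategoryTheory.yoneda)

/-- The Day convolution of representables is representable. -/
noncomputable def dayConvolutionYoneda (b : Tuples κ B ⥤ B) :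
    mapFunctor CategoryTheory.yoneda ⋙ dayConvolution b ≅ b ⋙ CategoryTheory.yoneda :=
  Functor.isoWhiskerRight (nerveRestrict (mapFunctor CategoryTheory.yoneda)).symm
    (extend (b ⋙ CategoryTheory.yoneda)) ≪≫ (eta (b ⋙ CategoryTheory.yoneda)).symm

namespace Good
variable {j : X ⥤ Y}

/-- With `G ≅ nerve j ⋙ extend h`, the functor `S G ⋙ nerve (S y)` is `S (nerve j)` followed by `S
(extend h) ⋙ nerve (S y)`. The latter is an extension `nerve (S y) ⋙ extend k` of some `k`, and `S
(nerve j) ⋙ nerve (S y)` is `nerve (S j)`. Day convolution adds only a final `extend`. Iterating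
this gives the composites with several layers of tuples. -/
theorem mapFunctor_comp_dayConvolution {G : Y ⥤ Bᵒᵖ ⥤ Type u} (hG : Good j G)
    (b : Tuples κ B ⥤ B) :
    Good (mapFunctor (κ := κ) j) (mapFunctor G ⋙ dayConvolution b) := by
  obtain ⟨h, ⟨e⟩⟩ := hG
  obtain ⟨k, ⟨i⟩⟩ := good_mapFunctor_extend_nerve (κ := κ) h
  have h1 : Good (mapFunctor (κ := κ) j)
      (mapFunctor G ⋙ nerve (mapFunctor (CategoryTheory.yoneda (C := B)))) :=
    ⟨k, ⟨Functor.isoWhiskerRight (nerveMapFunctor j) (extend k) ≪≫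
      Functor.isoWhiskerLeft (mapFunctor (nerve j)) i ≪≫
      Functor.isoWhiskerRight (mapFunctorIso e) (nerve (mapFunctor CategoryTheory.yoneda))⟩⟩
  exact h1.comp_extend _

theorem unitFunctor_comp {G : Tuples κ Y ⥤ Bᵒᵖ ⥤ Type u} (hG : Good (mapFunctor j) G) :
    Good j (unitFunctor κ Y ⋙ G) := by
  obtain ⟨h, ⟨e⟩⟩ := hG
  exact ((good_unit_nerve j).comp_extend h).of_iso (Functor.isoWhiskerLeft (unitFunctor κ Y) e)

theorem flatten_comp {G : Tuples κ Y ⥤ Bᵒᵖ ⥤ Type u} (hG : Good (mapFunctor j) G) :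
    Good (mapFunctor (mapFunctor j)) (flatten κ Y ⋙ G) := by
  obtain ⟨h, ⟨e⟩⟩ := hG
  exact ((good_flatten_nerve j).comp_extend h).of_iso (Functor.isoWhiskerLeft (flatten κ Y) e)

theorem dayConvolution (b : Tuples κ B ⥤ B) :
    Good (mapFunctor CategoryTheory.yoneda) (dayConvolution b) :=
  good_yoneda_id.mapFunctor_comp_dayConvolution b

end Good

end Presheaf
end PseudoLift

/-! ### Coherence laws in components -/

namespace PseudoLift
open Tuples

variable {κ : MonoidalKind} {A B C : Cat.{v, u}}

theorem eqToIso_hom_app {f g : A ⟶ B} (h : f = g) (x : A) :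
    (eqToIso h).hom.toNatTrans.app x = eqToHom (congrArg (fun k => k.toFunctor.obj x) h) := by
  subst h
  rfl

namespace PseudoAlgebraStr

variable (a : PseudoAlgebraStr (monoidalTwoMonad κ) A)

/-- The structure functor of a pseudoalgebra. -/
abbrev func : Tuples κ A ⥤ A := a.str.toFunctor

/-- The components of the associativity 2-cell. -/
def assocAt (x : Tuples κ (Tuples κ A)) :
    a.func.obj ((mapFunctor a.func).obj x) ≅ a.func.obj (flattenObj x) :=
  (Cat.Hom.toNatIso a.assoc).app x

/-- The components of the unit 2-cell. -/
def unitAt (x : A) : x ≅ a.func.obj ((unitFunctor κ A).obj x) :=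
  (Cat.Hom.toNatIso a.unit).app x

theorem assocAt_naturality {x y : Tuples κ (Tuples κ A)} (f : x ⟶ y) :
    a.func.map ((mapFunctor a.func).map f) ≫ (a.assocAt y).hom =
      (a.assocAt x).hom ≫ a.func.map (flattenHom f) :=
  a.assoc.hom.toNatTrans.naturality f

theorem unitAt_naturality {x y : A} (f : x ⟶ y) :
    f ≫ (a.unitAt y).hom = (a.unitAt x).hom ≫ a.func.map ((unitFunctor κ A).map f) :=
  a.unit.hom.toNatTrans.naturality f

theorem flatten_flattenObj (z : Tuples κ (Tuples κ (Tuples κ A))) :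
    flattenObj ((mapFunctor (flatten κ A)).obj z) = flattenObj (flattenObj z) :=
  congrArg (fun F : Tuples κ (Tuples κ (Tuples κ A)) ⥤ Tuples κ A => F.obj z)
    (flatten_flatten (κ := κ) (X := A))

theorem flatten_unitObj (x : Tuples κ A) :
    x = flattenObj ((mapFunctor (unitFunctor κ A)).obj x) :=
  (congrArg (fun F : Tuples κ A ⥤ Tuples κ A => F.obj x)
    (map_unit_flatten (κ := κ) (X := A))).symm

theorem comp_id_comp_comp_eq {D : Type u₁} [Category.{v₁} D] {X₀ X₁ X₂ X₃ Y₁ : D}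
    {f₁ : X₀ ⟶ X₁} {e₁ : X₁ ⟶ X₁} {f₂ : X₁ ⟶ X₂} {e₂ e₂' : X₂ ⟶ X₃} {d₁ : X₀ ⟶ X₀}
    {g₁ : X₀ ⟶ Y₁} {d₂ : Y₁ ⟶ Y₁} {g₂ : Y₁ ⟶ X₃} (h₁ : e₁ = 𝟙 _) (h₂ : e₂ = e₂') (h₃ : d₁ = 𝟙 _)
    (h₄ : d₂ = 𝟙 _) : f₁ ≫ e₁ ≫ f₂ ≫ e₂ = d₁ ≫ g₁ ≫ d₂ ≫ g₂ ↔ f₁ ≫ f₂ ≫ e₂' = g₁ ≫ g₂ := by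
  subst h₁ h₂ h₃ h₄
  simp

/-- Three of the four `eqToHom`s relate composites that agree definitionally, so their components
are identities. Only the one from associativity of concatenation survives. -/
theorem assoc_coherence_iff {s : (monoidalTwoMonad κ).S.obj A ⟶ A}
    (α : (monoidalTwoMonad κ).S.map s ≫ s ≅ (monoidalTwoMonad κ).mul A ≫ s)
    (h₁ h₂ h₃ h₄) : (monoidalTwoMonad κ).S.map₂ α.hom ▷ s ≫ eqToHom h₁ ≫
        (monoidalTwoMonad κ).S.map ((monoidalTwoMonad κ).mul A) ◁ α.hom ≫ eqToHom h₂ =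
      eqToHom h₃ ≫ (monoidalTwoMonad κ).S.map ((monoidalTwoMonad κ).S.map s) ◁ α.hom ≫
        eqToHom h₄ ≫ (monoidalTwoMonad κ).mul ((monoidalTwoMonad κ).S.obj A) ◁ α.hom ↔
    ∀ z : Tuples κ (Tuples κ (Tuples κ A)),
      s.toFunctor.map ((mapNatTrans α.hom.toNatTrans).app z) ≫
        α.hom.toNatTrans.app ((mapFunctor (flatten κ A)).obj z) ≫
        eqToHom (congrArg s.toFunctor.obj (flatten_flattenObj z)) =
      α.hom.toNatTrans.app ((mapFunctor (mapFunctor s.toFunctor)).obj z) ≫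
        α.hom.toNatTrans.app (flattenObj z) := by
  have key := fun z => comp_id_comp_comp_eq
    (f₁ := s.toFunctor.map ((mapNatTrans α.hom.toNatTrans).app z))
    (f₂ := α.hom.toNatTrans.app ((mapFunctor (flatten κ A)).obj z))
    (e₂' := eqToHom (congrArg s.toFunctor.obj (flatten_flattenObj z)))
    (g₁ := α.hom.toNatTrans.app ((mapFunctor (mapFunctor s.toFunctor)).obj z))
    (g₂ := α.hom.toNatTrans.app (flattenObj z))
    (Cat.eqToHom_app _ _ h₁ z) (Cat.eqToHom_app _ _ h₂ z) (Cat.eqToHom_app _ _ h₃ z)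
    (Cat.eqToHom_app _ _ h₄ z)
  constructor
  · intro h z
    exact (key z).1 (congrArg (fun t => t.toNatTrans.app z) h)
  · intro h
    refine Cat.Hom₂.ext (NatTrans.ext (funext fun z => ?_))
    exact (key z).2 (h z)

theorem comp_id_comp_eq {D : Type u₁} [Category.{v₁} D] {X₀ X₁ X₂ : D}
    {f₁ : X₀ ⟶ X₁} {e₁ : X₁ ⟶ X₁} {f₂ : X₁ ⟶ X₂} {e₂ e₂' : X₀ ⟶ X₂}
    (h₁ : e₁ = 𝟙 _) (h₂ : e₂ = e₂') : f₁ ≫ e₁ ≫ f₂ = e₂ ↔ f₁ ≫ f₂ = e₂' := by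
  subst h₁ h₂
  simp

/-- Here the surviving `eqToHom` comes from the equality of a tuple with the concatenation of its
one-element tuples. -/
theorem unit_coherence_iff {s : (monoidalTwoMonad κ).S.obj A ⟶ A}
    (α : (monoidalTwoMonad κ).S.map s ≫ s ≅ (monoidalTwoMonad κ).mul A ≫ s)
    (υ : 𝟙 A ≅ (monoidalTwoMonad κ).unit A ≫ s)
    (h₁ h₂) : (monoidalTwoMonad κ).S.map₂ υ.hom ▷ s ≫ eqToHom h₁ ≫
        (monoidalTwoMonad κ).S.map ((monoidalTwoMonad κ).unit A) ◁ α.hom = eqToHom h₂ ↔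
    ∀ x : Tuples κ A, s.toFunctor.map ((mapNatTrans υ.hom.toNatTrans).app x) ≫
        α.hom.toNatTrans.app ((mapFunctor (unitFunctor κ A)).obj x) =
      eqToHom (congrArg s.toFunctor.obj (flatten_unitObj x)) := by
  have key := fun x => comp_id_comp_eq
    (f₁ := s.toFunctor.map ((mapNatTrans υ.hom.toNatTrans).app x))
    (f₂ := α.hom.toNatTrans.app ((mapFunctor (unitFunctor κ A)).obj x))
    (e₂' := eqToHom (congrArg s.toFunctor.obj (flatten_unitObj x)))
    (Cat.eqToHom_app _ _ h₁ x) (Cat.eqToHom_app _ _ h₂ x)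
  constructor
  · intro h x
    exact (key x).1 (congrArg (fun t => t.toNatTrans.app x) h)
  · intro h
    refine Cat.Hom₂.ext (NatTrans.ext (funext fun x => ?_))
    exact (key x).2 (h x)

theorem assocAt_coherence (z : Tuples κ (Tuples κ (Tuples κ A))) :
    a.func.map (homOver fun i => (a.assocAt (z.get i)).hom) ≫
        (a.assocAt ((mapFunctor (flatten κ A)).obj z)).hom ≫
        eqToHom (congrArg a.func.obj (flatten_flattenObj z)) =
      (a.assocAt ((mapFunctor (mapFunctor a.func)).obj z)).hom ≫ (a.assocAt (flattenObj z)).hom :=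
  (assoc_coherence_iff a.assoc _ _ _ _).1 a.assoc_coherence z

theorem unitAt_coherence (x : Tuples κ A) :
    a.func.map (homOver fun i => (a.unitAt (x.get i)).hom) ≫
        (a.assocAt ((mapFunctor (unitFunctor κ A)).obj x)).hom =
      eqToHom (congrArg a.func.obj (flatten_unitObj x)) :=
  (unit_coherence_iff a.assoc a.unit _ _).1 a.unit_coherence x

end PseudoAlgebraStr

namespace PseudoMorphismStr

variable {a : PseudoAlgebraStr (monoidalTwoMonad κ) A} {b : PseudoAlgebraStr (monoidalTwoMonad κ) B}
  {c : PseudoAlgebraStr (monoidalTwoMonad κ) C} {f : A ⟶ B} {g : B ⟶ C}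

/-- The components of the cell of a pseudomorphism. -/
def cellAt (F : PseudoMorphismStr a b f) (x : Tuples κ A) :
    b.func.obj ((mapFunctor f.toFunctor).obj x) ≅ f.toFunctor.obj (a.func.obj x) :=
  (Cat.Hom.toNatIso F.cell).app x

theorem cellAt_naturality (F : PseudoMorphismStr a b f) {x y : Tuples κ A} (h : x ⟶ y) :
    b.func.map ((mapFunctor f.toFunctor).map h) ≫ (F.cellAt y).hom =
      (F.cellAt x).hom ≫ f.toFunctor.map (a.func.map h) :=
  F.cell.hom.toNatTrans.naturality h

theorem coherence_aux {D : Type u₁} [Category.{v₁} D] {X₀ X₁ X₂ Y₁ Y₂ : D}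
    {f₁ : X₀ ⟶ X₁} {e₁ : X₁ ⟶ X₁} {f₂ : X₁ ⟶ X₂} {e₂ : X₂ ⟶ X₂} {d₁ : X₀ ⟶ X₀}
    {g₁ : X₀ ⟶ Y₁} {d₂ : Y₁ ⟶ Y₁} {g₂ : Y₁ ⟶ Y₂} {d₃ : Y₂ ⟶ Y₂} {g₃ : Y₂ ⟶ X₂}
    (h₁ : e₁ = 𝟙 _) (h₂ : e₂ = 𝟙 _) (h₃ : d₁ = 𝟙 _) (h₄ : d₂ = 𝟙 _) (h₅ : d₃ = 𝟙 _) :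
    f₁ ≫ e₁ ≫ f₂ ≫ e₂ = d₁ ≫ g₁ ≫ d₂ ≫ g₂ ≫ d₃ ≫ g₃ ↔ f₁ ≫ f₂ = g₁ ≫ g₂ ≫ g₃ := by
  subst h₁ h₂ h₃ h₄ h₅
  simp

theorem coherence_aux' {D : Type u₁} [Category.{v₁} D] {X₀ X₁ X₂ : D}
    {f₁ : X₀ ⟶ X₁} {e₁ : X₁ ⟶ X₁} {f₂ : X₁ ⟶ X₂} {d₁ : X₀ ⟶ X₀}
    {g₁ : X₀ ⟶ X₂} {d₂ : X₂ ⟶ X₂}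
    (h₁ : e₁ = 𝟙 _) (h₂ : d₁ = 𝟙 _) (h₃ : d₂ = 𝟙 _) :
    f₁ ≫ e₁ ≫ f₂ = d₁ ≫ g₁ ≫ d₂ ↔ f₁ ≫ f₂ = g₁ := by
  subst h₁ h₂ h₃
  simp

/-- Naturality of concatenation holds definitionally on objects, so no `eqToHom` remains in
components. -/
theorem assoc_coherence_iff (φ : (monoidalTwoMonad κ).S.map f ≫ b.str ≅ a.str ≫ f)
    (h₁ h₂ h₃ h₄ h₅) :
    (monoidalTwoMonad κ).S.map ((monoidalTwoMonad κ).S.map f) ◁ b.assoc.hom ≫ eqToHom h₁ ≫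
        (monoidalTwoMonad κ).mul A ◁ φ.hom ≫ eqToHom h₂ =
      eqToHom h₃ ≫ (monoidalTwoMonad κ).S.map₂ φ.hom ▷ b.str ≫ eqToHom h₄ ≫
        (monoidalTwoMonad κ).S.map a.str ◁ φ.hom ≫ eqToHom h₅ ≫ a.assoc.hom ▷ f ↔
    ∀ x : Tuples κ (Tuples κ A),
      (b.assocAt ((mapFunctor (mapFunctor f.toFunctor)).obj x)).hom ≫
        φ.hom.toNatTrans.app (flattenObj x) =
      b.func.map ((mapNatTrans φ.hom.toNatTrans).app x) ≫
        φ.hom.toNatTrans.app ((mapFunctor a.func).obj x) ≫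
        f.toFunctor.map (a.assocAt x).hom := by
  have key := fun x => coherence_aux
    (f₁ := (b.assocAt ((mapFunctor (mapFunctor f.toFunctor)).obj x)).hom)
    (f₂ := φ.hom.toNatTrans.app (flattenObj x))
    (g₁ := b.func.map ((mapNatTrans φ.hom.toNatTrans).app x))
    (g₂ := φ.hom.toNatTrans.app ((mapFunctor a.func).obj x))
    (g₃ := f.toFunctor.map (a.assocAt x).hom)
    (Cat.eqToHom_app _ _ h₁ x) (Cat.eqToHom_app _ _ h₂ x) (Cat.eqToHom_app _ _ h₃ x)
    (Cat.eqToHom_app _ _ h₄ x) (Cat.eqToHom_app _ _ h₅ x)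
  constructor
  · intro h x
    exact (key x).1 (congrArg (fun t => t.toNatTrans.app x) h)
  · intro h
    refine Cat.Hom₂.ext (NatTrans.ext (funext fun x => ?_))
    exact (key x).2 (h x)

theorem unit_coherence_iff (φ : (monoidalTwoMonad κ).S.map f ≫ b.str ≅ a.str ≫ f) (h₁ h₂ h₃) :
    f ◁ b.unit.hom ≫ eqToHom h₁ ≫ (monoidalTwoMonad κ).unit A ◁ φ.hom =
      eqToHom h₂ ≫ a.unit.hom ▷ f ≫ eqToHom h₃ ↔
    ∀ x : A, (b.unitAt (f.toFunctor.obj x)).hom ≫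
        φ.hom.toNatTrans.app ((unitFunctor κ A).obj x) =
      f.toFunctor.map (a.unitAt x).hom := by
  have key := fun x => coherence_aux'
    (f₁ := (b.unitAt (f.toFunctor.obj x)).hom)
    (f₂ := φ.hom.toNatTrans.app ((unitFunctor κ A).obj x))
    (g₁ := f.toFunctor.map (a.unitAt x).hom)
    (Cat.eqToHom_app _ _ h₁ x) (Cat.eqToHom_app _ _ h₂ x) (Cat.eqToHom_app _ _ h₃ x)
  constructor
  · intro h x
    exact (key x).1 (congrArg (fun t => t.toNatTrans.app x) h)
  · intro h
    refine Cat.Hom₂.ext (NatTrans.ext (funext fun x => ?_))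
    exact (key x).2 (h x)

theorem cellAt_assoc (F : PseudoMorphismStr a b f) (x : Tuples κ (Tuples κ A)) :
    (b.assocAt ((mapFunctor (mapFunctor f.toFunctor)).obj x)).hom ≫ (F.cellAt (flattenObj x)).hom =
      b.func.map (homOver fun i => (F.cellAt (x.get i)).hom) ≫
        (F.cellAt ((mapFunctor a.func).obj x)).hom ≫ f.toFunctor.map (a.assocAt x).hom :=
  (assoc_coherence_iff F.cell _ _ _ _ _).1 F.assoc_coherence x

theorem cellAt_unit (F : PseudoMorphismStr a b f) (x : A) :
    (b.unitAt (f.toFunctor.obj x)).hom ≫ (F.cellAt ((unitFunctor κ A).obj x)).hom =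
      f.toFunctor.map (a.unitAt x).hom :=
  (unit_coherence_iff F.cell _ _ _).1 F.unit_coherence x

theorem id_cellAt (x : Tuples κ A) : ((id a).cellAt x).hom = 𝟙 (a.func.obj x) :=
  eqToIso_hom_app (A := Cat.of (Tuples κ A)) (f := (monoidalTwoMonad κ).S.map (𝟙 A) ≫ a.str)
    (g := a.str ≫ 𝟙 A) rfl x

theorem comp_aux {D : Type u₁} [Category.{v₁} D] {X₀ X₁ X₂ : D} {e₁ : X₀ ⟶ X₀}
    {f₁ : X₀ ⟶ X₁} {e₂ : X₁ ⟶ X₁} {f₂ : X₁ ⟶ X₂} {e₃ : X₂ ⟶ X₂} (h₁ : e₁ = 𝟙 _) (h₂ : e₂ = 𝟙 _)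
    (h₃ : e₃ = 𝟙 _) : e₁ ≫ f₁ ≫ e₂ ≫ f₂ ≫ e₃ = f₁ ≫ f₂ := by
  subst h₁ h₂ h₃
  simp

theorem comp_cellAt (F : PseudoMorphismStr a b f) (G : PseudoMorphismStr b c g) (x : Tuples κ A) :
    ((F.comp G).cellAt x).hom =
      (G.cellAt ((mapFunctor f.toFunctor).obj x)).hom ≫ g.toFunctor.map (F.cellAt x).hom :=
  comp_aux (f₁ := (G.cellAt ((mapFunctor f.toFunctor).obj x)).hom)
    (f₂ := g.toFunctor.map (F.cellAt x).hom)
    (eqToIso_hom_app (A := Cat.of (Tuples κ A)) _ x)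
    (eqToIso_hom_app (A := Cat.of (Tuples κ A)) _ x)
    (eqToIso_hom_app (A := Cat.of (Tuples κ A)) _ x)

end PseudoMorphismStr

theorem isAlgebraTwoCell_iff {a : PseudoAlgebraStr (monoidalTwoMonad κ) A}
    {b : PseudoAlgebraStr (monoidalTwoMonad κ) B} {f g : A ⟶ B} (F : PseudoMorphismStr a b f)
    (G : PseudoMorphismStr a b g) (α : f ⟶ g) :
    IsAlgebraTwoCell F G α ↔ ∀ x : Tuples κ A,
      b.func.map ((mapNatTrans α.toNatTrans).app x) ≫ (G.cellAt x).hom =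
        (F.cellAt x).hom ≫ α.toNatTrans.app (a.func.obj x) := by
  constructor
  · intro h x
    exact congrArg (fun t => t.toNatTrans.app x) h
  · intro h
    exact Cat.Hom₂.ext (NatTrans.ext (funext fun x => h x))

end PseudoLift

/-! ### Transfer of pseudoalgebra structure along a dense functor -/

namespace PseudoLift
open Tuples

variable {κ : MonoidalKind} {A D E : Cat.{v, u}}

theorem eqToHom_comp_app {C : Type u₁} [Category.{v₁} C] {C' : Type u₂} [Category.{v₂} C']
    {F G : C ⥤ C'} (α : F ≅ G) {x y : C} (h : x = y) :
    eqToHom (congrArg F.obj h) ≫ (α.app y).hom = (α.app x).hom ≫ eqToHom (congrArg G.obj h) := by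
  subst h
  simp

/-- The diagram chase for associativity: `hP₁`, `hP₂`, `hG`, `hQ₂` say that each associativity cell
is conjugate, by the comparison `ι`, to one of `A`; `he`, `hv`, `hQ₁` are naturality squares; `hy`
is the image under `y` of the law in `A`. -/
theorem pentagon_of_components {C : Type u₁} [Category.{v₁} C]
    {X₀ X₁ X₂ X₃ Y₁ Y₂ Y₃ Z₁ Z₂ W₁ W₂ V₁ V₂ V₃ : C}
    {P₁ : X₀ ⟶ X₁} {P₂ : X₁ ⟶ X₂} {e : X₂ ⟶ X₃} {Q₁ : X₀ ⟶ Y₁} {Q₂ : Y₁ ⟶ X₃}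
    {u₁ : X₀ ⟶ Y₂} {u₂ : Y₂ ⟶ Y₃} {v : Y₃ ⟶ Z₁} {k : X₁ ≅ Z₁}
    {i₁ : Z₁ ⟶ V₁} {y₁ : V₁ ⟶ W₁} {i₂ : X₂ ≅ W₁} {i₃ : X₃ ≅ W₂} {e' : W₁ ⟶ W₂}
    {i₄ : Y₃ ⟶ V₂} {y₂ : V₂ ⟶ V₁} {l : Y₁ ≅ Z₂} {G : Y₂ ⟶ Z₂} {y₃ : V₂ ⟶ V₃} {i₅ : Z₂ ≅ V₃}
    {y₄ : V₃ ⟶ W₂}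
    (hP₁ : P₁ = u₁ ≫ u₂ ≫ v ≫ k.inv) (hP₂ : P₂ = k.hom ≫ i₁ ≫ y₁ ≫ i₂.inv)
    (he : e ≫ i₃.hom = i₂.hom ≫ e') (hv : v ≫ i₁ = i₄ ≫ y₂) (hQ₁ : Q₁ ≫ l.hom = u₁ ≫ G)
    (hG : G = u₂ ≫ i₄ ≫ y₃ ≫ i₅.inv) (hQ₂ : Q₂ = l.hom ≫ i₅.hom ≫ y₄ ≫ i₃.inv)
    (hy : y₂ ≫ y₁ ≫ e' = y₃ ≫ y₄) : P₁ ≫ P₂ ≫ e = Q₁ ≫ Q₂ := by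
  rw [← cancel_mono i₃.hom]
  subst hP₁ hP₂ hG hQ₂
  simp [he, reassoc_of% hv, reassoc_of% hQ₁, hy]

theorem unit_of_components {C : Type u₁} [Category.{v₁} C]
    {X₀ X₁ X₂ Y₁ Z₁ Z₂ V₁ : C} {P₁ : X₀ ⟶ X₁} {P₂ : X₁ ⟶ X₂} {e : X₀ ⟶ X₂}
    {v : X₀ ⟶ Y₁} {k : X₁ ≅ Y₁} {i₁ : Y₁ ⟶ V₁} {y₁ : V₁ ⟶ Z₂} {i₂ : X₂ ≅ Z₂}
    {i₃ : X₀ ⟶ Z₁} {y₂ : Z₁ ⟶ V₁} {e' : Z₁ ⟶ Z₂}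
    (hP₁ : P₁ = v ≫ k.inv) (hP₂ : P₂ = k.hom ≫ i₁ ≫ y₁ ≫ i₂.inv)
    (hv : v ≫ i₁ = i₃ ≫ y₂) (he : e ≫ i₂.hom = i₃ ≫ e') (hy : y₂ ≫ y₁ = e') :
    P₁ ≫ P₂ = e := by
  rw [← cancel_mono i₂.hom]
  subst hP₁ hP₂
  simp [he, reassoc_of% hv, hy]

theorem map_eqToHom_eq {C : Type u₁} [Category.{v₁} C] {C' : Type u₂} [Category.{v₂} C'] (F : C ⥤ C')
    {X₀ X₁ X₂ X₃ Y₁ : C} {f₁ : X₀ ⟶ X₁} {f₂ : X₁ ⟶ X₂} (e : X₂ = X₃) {g₁ : X₀ ⟶ Y₁} {g₂ : Y₁ ⟶ X₃}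
    (h : f₁ ≫ f₂ ≫ eqToHom e = g₁ ≫ g₂) :
    F.map f₁ ≫ F.map f₂ ≫ eqToHom (congrArg F.obj e) = F.map g₁ ≫ F.map g₂ := by
  subst e
  simp only [eqToHom_refl, Category.comp_id] at h ⊢
  rw [← F.map_comp, h, F.map_comp]

theorem comp_inv_comp {C : Type u₁} [Category.{v₁} C] {X₀ X₁ X₂ X₃ Y : C} {f : X₀ ⟶ Y}
    {f₁ : X₀ ⟶ X₁} {f₂ : X₁ ⟶ X₂} {f₃ : X₂ ⟶ X₃} {i : Y ≅ X₃}
    (h : f = f₁ ≫ f₂ ≫ f₃ ≫ i.inv) : f ≫ i.hom = f₁ ≫ f₂ ≫ f₃ := by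
  simp [h]

theorem map_comp₄ {C : Type u₁} [Category.{v₁} C] {C' : Type u₂} [Category.{v₂} C'] (F : C ⥤ C')
    {X₀ X₁ X₂ X₃ X₄ : C} (f₁ : X₀ ⟶ X₁) (f₂ : X₁ ⟶ X₂) (f₃ : X₂ ⟶ X₃) (f₄ : X₃ ⟶ X₄) :
    F.map (f₁ ≫ f₂ ≫ f₃ ≫ f₄) = F.map f₁ ≫ F.map f₂ ≫ F.map f₃ ≫ F.map f₄ := by
  simp only [Functor.map_comp]

theorem naturality_comp {C : Type u₁} [Category.{v₁} C] {X₀ X₁ X₂ Y₀ Y₁ Y₂ : C} {f₁ : X₀ ⟶ X₁}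
    {f₂ : X₁ ⟶ X₂} {g₁ : Y₀ ⟶ Y₁} {g₂ : Y₁ ⟶ Y₂} {h₀ : Y₀ ⟶ X₀} {h₁ : Y₁ ⟶ X₁} {h₂ : Y₂ ⟶ X₂}
    (e₁ : h₀ ≫ f₁ = g₁ ≫ h₁) (e₂ : h₁ ≫ f₂ = g₂ ≫ h₂) :
    h₀ ≫ f₁ ≫ f₂ = (g₁ ≫ g₂) ≫ h₂ := by
  rw [reassoc_of% e₁, e₂, Category.assoc]

section Transfer

variable (a : PseudoAlgebraStr (monoidalTwoMonad κ) A) (y : A ⟶ D) (s : Tuples κ D ⥤ D)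
  (ι : mapFunctor y.toFunctor ⋙ s ≅ a.func ⋙ y.toFunctor)

/-- The restriction of the associativity cell of a transferred pseudoalgebra. -/
def transferAssoc : mapFunctor (mapFunctor y.toFunctor) ⋙ mapFunctor s ⋙ s ≅
    mapFunctor (mapFunctor y.toFunctor) ⋙ flatten κ D ⋙ s :=
  Functor.isoWhiskerRight (mapFunctorIso ι) s ≪≫
    Functor.isoWhiskerLeft (mapFunctor a.func) ι ≪≫
    Functor.isoWhiskerRight (Cat.Hom.toNatIso a.assoc) y.toFunctor ≪≫
    (Functor.isoWhiskerLeft (flatten κ A) ι).symm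

/-- The restriction of the unit cell of a transferred pseudoalgebra. -/
def transferUnit : y.toFunctor ⋙ 𝟭 D ≅ y.toFunctor ⋙ unitFunctor κ D ⋙ s :=
  NatIso.ofComponents (fun x => y.toFunctor.mapIso (a.unitAt x) ≪≫
      (ι.app ((unitFunctor κ A).obj x)).symm) (by
    intro x x' f
    have h₁ := congrArg y.toFunctor.map (a.unitAt_naturality f)
    rw [Functor.map_comp, Functor.map_comp] at h₁
    have h₂ := ι.inv.naturality ((unitFunctor κ A).map f)
    have h₃ : (mapFunctor y.toFunctor).map ((unitFunctor κ A).map f) =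
      (unitFunctor κ D).map (y.toFunctor.map f) := mapFunctor_homOver y.toFunctor fun _ => f
    have h₄ := h₂.trans (congrArg (fun t => ι.inv.app ((unitFunctor κ A).obj x) ≫ s.map t) h₃)
    exact naturality_comp h₁ h₄)

variable {a y s} {ι}

/-- On triple tuples coming from `A`, the cell `α` is the associativity cell of `A` conjugated by
`ι`, so its coherence law is the conjugate of the law in `A`. -/
theorem transfer_assoc_coherence {α : mapFunctor s ⋙ s ≅ flatten κ D ⋙ s}
    (hα : ∀ x : Tuples κ (Tuples κ A),
      α.hom.app ((mapFunctor (mapFunctor y.toFunctor)).obj x) =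
        s.map ((mapNatTrans ι.hom).app x) ≫ (ι.app ((mapFunctor a.func).obj x)).hom ≫
          y.toFunctor.map (a.assocAt x).hom ≫ (ι.app (flattenObj x)).inv)
    (z : Tuples κ (Tuples κ (Tuples κ A))) :
    s.map ((mapNatTrans α.hom).app
          ((mapFunctor (mapFunctor (mapFunctor y.toFunctor))).obj z)) ≫
        α.hom.app ((mapFunctor (flatten κ D)).obj
          ((mapFunctor (mapFunctor (mapFunctor y.toFunctor))).obj z)) ≫
        eqToHom (congrArg s.obj (PseudoAlgebraStr.flatten_flattenObj
          ((mapFunctor (mapFunctor (mapFunctor y.toFunctor))).obj z))) =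
      α.hom.app ((mapFunctor (mapFunctor s)).obj
          ((mapFunctor (mapFunctor (mapFunctor y.toFunctor))).obj z)) ≫
        α.hom.app (flattenObj ((mapFunctor (mapFunctor (mapFunctor y.toFunctor))).obj z)) := by
  let y₁ := mapFunctor (κ := κ) y.toFunctor
  let Sι := mapFunctorIso (κ := κ) ι
  have hS : s.map ((mapNatTrans α.hom).app ((mapFunctor (mapFunctor y₁)).obj z)) =
      s.map ((mapFunctor s).map ((mapNatTrans Sι.hom).app z)) ≫
      s.map (Sι.hom.app ((mapFunctor (mapFunctor a.func)).obj z)) ≫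
      s.map (y₁.map (homOver fun i => (a.assocAt (z.get i)).hom)) ≫
      s.map (Sι.inv.app ((mapFunctor (flatten κ A)).obj z)) := by
    -- `hα` holds at each entry of `z`; over the identity reindexing these equations assemble into
    -- one for tuples.
    have e : (mapNatTrans α.hom).app ((mapFunctor (mapFunctor y₁)).obj z) =
        (mapFunctor s).map ((mapNatTrans Sι.hom).app z) ≫
          Sι.hom.app ((mapFunctor (mapFunctor a.func)).obj z) ≫
          y₁.map (homOver fun i => (a.assocAt (z.get i)).hom) ≫
          Sι.inv.app ((mapFunctor (flatten κ A)).obj z) := by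
      refine hom_ext (fun _ => rfl) ?_
      rintro i j rfl _
      exact hα (z.get j)
    exact (congrArg s.map e).trans (map_comp₄ s _ _ _ _)
  refine pentagon_of_components hS (k := s.mapIso (Sι.app ((mapFunctor (flatten κ A)).obj z))) (hα ((mapFunctor (flatten κ A)).obj z))
    (i₃ := ι.app (flattenObj (flattenObj z))) (eqToHom_comp_app ι (PseudoAlgebraStr.flatten_flattenObj z))
    (ι.hom.naturality _) (l := s.mapIso (Sι.app (flattenObj z))) 
    (G := α.hom.app ((mapFunctor (mapFunctor y.toFunctor)).obj ((mapFunctor (mapFunctor a.func)).obj z))) ?_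
    (hα ((mapFunctor (mapFunctor a.func)).obj z)) (hα (flattenObj z)) ?_
  · exact ((α.hom.naturality ((mapNatTrans Sι.hom).app z)).trans
      (congrArg (fun t => α.hom.app _ ≫ s.map t) (flatten_homOver ι.hom z))).symm
  · exact map_eqToHom_eq y.toFunctor _ (a.assocAt_coherence z)

theorem transfer_unit_coherence {α : mapFunctor s ⋙ s ≅ flatten κ D ⋙ s}
    (hα : ∀ x : Tuples κ (Tuples κ A),
      α.hom.app ((mapFunctor (mapFunctor y.toFunctor)).obj x) =
        s.map ((mapNatTrans ι.hom).app x) ≫ (ι.app ((mapFunctor a.func).obj x)).hom ≫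
          y.toFunctor.map (a.assocAt x).hom ≫ (ι.app (flattenObj x)).inv)
    {υ : 𝟭 D ≅ unitFunctor κ D ⋙ s} (hυ : ∀ x : A, υ.hom.app (y.toFunctor.obj x) =
      y.toFunctor.map (a.unitAt x).hom ≫ (ι.app ((unitFunctor κ A).obj x)).inv)
    (x : Tuples κ A) :
    s.map ((mapNatTrans υ.hom).app ((mapFunctor y.toFunctor).obj x)) ≫
        α.hom.app ((mapFunctor (unitFunctor κ D)).obj ((mapFunctor y.toFunctor).obj x)) =
      eqToHom (congrArg s.obj (PseudoAlgebraStr.flatten_unitObj ((mapFunctor y.toFunctor).obj x))) := by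
  let y₁ := mapFunctor (κ := κ) y.toFunctor
  let Sι := mapFunctorIso (κ := κ) ι
  have hS : s.map ((mapNatTrans υ.hom).app (y₁.obj x)) =
      s.map (y₁.map (homOver fun i => (a.unitAt (x.get i)).hom)) ≫
        s.map (Sι.inv.app ((mapFunctor (unitFunctor κ A)).obj x)) := by
    refine (congrArg s.map (?_ : _ = y₁.map (homOver fun i => (a.unitAt (x.get i)).hom) ≫
      Sι.inv.app ((mapFunctor (unitFunctor κ A)).obj x))).trans (s.map_comp _ _)
    refine hom_ext (fun _ => rfl) ?_
    rintro i j rfl _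
    exact hυ (x.get j)
  refine unit_of_components hS
    (k := s.mapIso (Sι.app ((mapFunctor (unitFunctor κ A)).obj x)))
    (hα ((mapFunctor (unitFunctor κ A)).obj x)) (ι.hom.naturality _)
    (eqToHom_comp_app ι (PseudoAlgebraStr.flatten_unitObj x)) ?_
  exact ((y.toFunctor.map_comp _ _).symm.trans (congrArg y.toFunctor.map (a.unitAt_coherence x))).trans
    (eqToHom_map _ _)


/-- Pseudoalgebra structures transfer along dense functors. -/
theorem exists_transfer (ι : mapFunctor y.toFunctor ⋙ s ≅ a.func ⋙ y.toFunctor)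
    (h₀ : Dense y.toFunctor (𝟭 D)) (h₀' : Dense y.toFunctor (unitFunctor κ D ⋙ s))
    (h₁ : Dense (mapFunctor (κ := κ) y.toFunctor) s)
    (h₂ : Dense (mapFunctor (κ := κ) (mapFunctor (κ := κ) y.toFunctor)) (mapFunctor s ⋙ s))
    (h₂' : Dense (mapFunctor (κ := κ) (mapFunctor (κ := κ) y.toFunctor)) (flatten κ D ⋙ s))
    (h₃ : Dense (mapFunctor (κ := κ) (mapFunctor (κ := κ) (mapFunctor (κ := κ) y.toFunctor)))
      (mapFunctor (mapFunctor s ⋙ s) ⋙ s)) :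
    ∃ d : PseudoAlgebraStr (monoidalTwoMonad κ) D, d.func = s ∧ Nonempty (PseudoMorphismStr a d y) := by
  -- The associativity and unit cells are the unique extensions of those of `A` conjugated by `ι`;
  -- this choice also makes `ι` a pseudomorphism structure on `y`.
  obtain ⟨α, hα⟩ := h₂.exists_iso h₂' (transferAssoc a y s ι)
  obtain ⟨υ, hυ⟩ := h₀.exists_iso h₀' (transferUnit a y s ι)
  have hα' : ∀ x : Tuples κ (Tuples κ A),
      α.hom.app ((mapFunctor (mapFunctor y.toFunctor)).obj x) =
        s.map ((mapNatTrans ι.hom).app x) ≫ (ι.app ((mapFunctor a.func).obj x)).hom ≫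
          y.toFunctor.map (a.assocAt x).hom ≫ (ι.app (flattenObj x)).inv := hα
  have hυ' : ∀ x : A, υ.hom.app (y.toFunctor.obj x) =
      y.toFunctor.map (a.unitAt x).hom ≫ (ι.app ((unitFunctor κ A).obj x)).inv := hυ
  have c₁ : ∀ z : Tuples κ (Tuples κ (Tuples κ D)),
      s.map ((mapNatTrans α.hom).app z) ≫ α.hom.app ((mapFunctor (flatten κ D)).obj z) ≫
        eqToHom (congrArg s.obj (PseudoAlgebraStr.flatten_flattenObj z)) =
      α.hom.app ((mapFunctor (mapFunctor s)).obj z) ≫ α.hom.app (flattenObj z) := by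
    have e : mapFunctor (flatten κ D) ⋙ flatten κ D ⋙ s =
      flatten κ (Tuples κ D) ⋙ flatten κ D ⋙ s :=
      congrArg (· ⋙ s) (flatten_flatten (κ := κ) (X := D))
    have he : ∀ z, (eqToHom e).app z =
        eqToHom (congrArg s.obj (PseudoAlgebraStr.flatten_flattenObj z)) := fun z => eqToHom_app e z
    have hc : ∀ z, (Functor.whiskerRight (mapNatTrans α.hom) s ≫
        Functor.whiskerLeft (mapFunctor (flatten κ D)) α.hom ≫ eqToHom e).app z =
        s.map ((mapNatTrans α.hom).app z) ≫ α.hom.app ((mapFunctor (flatten κ D)).obj z) ≫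
          eqToHom (congrArg s.obj (PseudoAlgebraStr.flatten_flattenObj z)) := fun z =>
      congrArg (fun t => s.map ((mapNatTrans α.hom).app z) ≫
        α.hom.app ((mapFunctor (flatten κ D)).obj z) ≫ t) (he z)
    -- Both sides of the associativity law start at `S (S s ⋙ s) ⋙ s`, a left extension by `h₃`, so
    -- triple tuples from `A` suffice. The unit law below starts at `s` and uses `h₁` in the same
    -- way.
    have key := h₃.ext (H := flatten κ (Tuples κ D) ⋙ flatten κ D ⋙ s)
      (α := Functor.whiskerRight (mapNatTrans α.hom) s ≫
        Functor.whiskerLeft (mapFunctor (flatten κ D)) α.hom ≫ eqToHom e)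
      (β := Functor.whiskerLeft (mapFunctor (mapFunctor s)) α.hom ≫
        Functor.whiskerLeft (flatten κ (Tuples κ D)) α.hom) (fun z =>
        (hc _).trans (transfer_assoc_coherence hα' z))
    intro z
    exact (hc z).symm.trans (congrArg (fun t => t.app z) key)
  have c₂ : ∀ x : Tuples κ D, s.map ((mapNatTrans υ.hom).app x) ≫
        α.hom.app ((mapFunctor (unitFunctor κ D)).obj x) =
      eqToHom (congrArg s.obj (PseudoAlgebraStr.flatten_unitObj x)) := by
    have e : s = mapFunctor (unitFunctor κ D) ⋙ flatten κ D ⋙ s :=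
      (congrArg (· ⋙ s) (map_unit_flatten (κ := κ) (X := D))).symm
    have he : ∀ z, (eqToHom e).app z =
        eqToHom (congrArg s.obj (PseudoAlgebraStr.flatten_unitObj z)) := fun z => eqToHom_app e z
    have key := h₁.ext (H := mapFunctor (unitFunctor κ D) ⋙ flatten κ D ⋙ s)
      (α := Functor.whiskerRight (mapNatTrans υ.hom) s ≫
        Functor.whiskerLeft (mapFunctor (unitFunctor κ D)) α.hom)
      (β := eqToHom e) (fun x => (transfer_unit_coherence hα' hυ' x).trans (he _).symm)
    intro x
    exact (congrArg (fun t => t.app x) key).trans (he x)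
  let d : PseudoAlgebraStr (monoidalTwoMonad κ) D :=
    { str := s.toCatHom
      assoc := Cat.Hom.isoMk α
      unit := Cat.Hom.isoMk υ
      assoc_coherence :=
        (PseudoAlgebraStr.assoc_coherence_iff (A := D) (s := s.toCatHom) (Cat.Hom.isoMk α) _ _ _ _).2 c₁
      unit_coherence :=
        (PseudoAlgebraStr.unit_coherence_iff (A := D) (s := s.toCatHom) (Cat.Hom.isoMk α)
          (Cat.Hom.isoMk υ) _ _).2 c₂ }
  refine ⟨d, rfl, ⟨⟨Cat.Hom.isoMk ι, ?_, ?_⟩⟩⟩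
  · refine (PseudoMorphismStr.assoc_coherence_iff (a := a) (b := d) (f := y) (Cat.Hom.isoMk ι)
      _ _ _ _ _).2 fun x => ?_
    exact comp_inv_comp (i := ι.app (flattenObj x)) (hα' x)
  · refine (PseudoMorphismStr.unit_coherence_iff (a := a) (b := d) (f := y) (Cat.Hom.isoMk ι)
      _ _ _).2 fun x => ?_
    exact (Iso.comp_inv_eq (ι.app ((unitFunctor κ A).obj x))).1 (hυ' x).symm |>.symm

end Transfer

end PseudoLift

/-! ### Extension of pseudomorphisms, and tests for algebra 2-cells -/

namespace PseudoLift
open Tuples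

variable {κ : MonoidalKind} {A D E : Cat.{v, u}}

/-- The diagram chase for `g`: `h₂`, `h₇` and, under `S`, `h₅` are the equation defining the new
cell; `h₃` and `h₈` are the associativity laws of `F` and `Y`; `h₁`, `h₄`, `h₆` are naturality
squares. The isomorphisms at both ends are cancelled to compare `g` with `f`. -/
theorem extension_assoc_of_components {C : Type u₁} [Category.{v₁} C]
    {X₀ X₀' X₁ X₁' X₂ X₃ Y₁ Y₂ Y₃ Y₄ Z₁ Z₂ Z₃ W₁ : C} {M : X₀' ≅ X₀} {L₁ : X₀ ⟶ X₁} {L₂ : X₁ ⟶ X₂}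
    {N : X₀' ⟶ X₁'} {Λ₁ : X₁' ⟶ X₁} {gYf : X₂ ≅ X₃} {Ff : X₁' ⟶ Y₁} {ηf : Y₁ ⟶ X₃}
    {SF : X₀' ⟶ Y₂} {Fa : Y₂ ⟶ Y₃} {fα : Y₃ ⟶ Y₁} {ηa : Y₃ ⟶ Y₄} {gyα : Y₄ ⟶ X₃}
    {R₁ : X₀ ⟶ Z₁} {K : Z₁ ≅ Z₂} {Λ₂ : Y₂ ⟶ Z₂} {Φ : Z₂ ⟶ Z₃} {R₂ : Z₁ ⟶ W₁} {l : W₁ ≅ Z₃}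
    {gYa : Z₃ ≅ Y₄} {gα : W₁ ⟶ X₂}
    (h₁ : M.hom ≫ L₁ = N ≫ Λ₁) (h₂ : Λ₁ ≫ L₂ ≫ gYf.hom = Ff ≫ ηf) (h₃ : N ≫ Ff = SF ≫ Fa ≫ fα)
    (h₄ : fα ≫ ηf = ηa ≫ gyα) (h₅ : M.hom ≫ R₁ ≫ K.hom = SF ≫ Λ₂) (h₆ : K.hom ≫ Φ = R₂ ≫ l.hom)
    (h₇ : Λ₂ ≫ Φ ≫ gYa.hom = Fa ≫ ηa) (h₈ : gα ≫ gYf.hom = l.hom ≫ gYa.hom ≫ gyα) :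
    L₁ ≫ L₂ = R₁ ≫ R₂ ≫ gα := by
  rw [← cancel_epi M.hom, ← cancel_mono gYf.hom]
  simp only [Category.assoc, h₈]
  rw [reassoc_of% h₁, h₂, reassoc_of% h₃, h₄, ← reassoc_of% h₆, reassoc_of% h₅, reassoc_of% h₇]

theorem extension_unit_of_components {C : Type u₁} [Category.{v₁} C]
    {X₀ X₀' X₁ X₁' X₂ X₃ Y₁ : C} {M : X₀' ≅ X₀} {L₁ : X₀ ⟶ X₁} {L₂ : X₁ ⟶ X₂}
    {N : X₀' ⟶ X₁'} {Λ₁ : X₁' ⟶ X₁} {gY : X₂ ≅ X₃} {F : X₁' ⟶ Y₁} {ηf : Y₁ ⟶ X₃}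
    {fυ : X₀' ⟶ Y₁} {gυ : X₀ ⟶ X₂} {gyυ : X₀ ⟶ X₃}
    (h₁ : M.hom ≫ L₁ = N ≫ Λ₁) (h₂ : Λ₁ ≫ L₂ ≫ gY.hom = F ≫ ηf) (h₃ : N ≫ F = fυ)
    (h₄ : fυ ≫ ηf = M.hom ≫ gyυ) (h₅ : gυ ≫ gY.hom = gyυ) : L₁ ≫ L₂ = gυ := by
  rw [← cancel_epi M.hom, ← cancel_mono gY.hom]
  simp only [Category.assoc, h₅]
  rw [reassoc_of% h₁, h₂, reassoc_of% h₃, h₄]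

theorem eq_comp₃_inv {C : Type u₁} [Category.{v₁} C] {X₀ X₁ X₂ X₃ X₄ : C} {m : X₁ ≅ X₀}
    {f : X₁ ⟶ X₂} {g : X₂ ⟶ X₃} {i : X₄ ≅ X₃} {k : X₀ ⟶ X₄} (h : k = m.inv ≫ f ≫ g ≫ i.inv) :
    m.hom ≫ k ≫ i.hom = f ≫ g := by
  simp [h]

theorem homOver_comp_eq {X : Type u₁} [Category.{v₁} X] {Y : Type u₂} [Category.{v₂} Y]
    (s : Tuples κ X ⥤ Y) {n : ℕ} {x₀ x₁ x₂ x₃ x₄ : Fin n → X}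
    {f₁ : ∀ i, x₀ i ⟶ x₁ i} {f₂ : ∀ i, x₁ i ⟶ x₂ i} {f₃ : ∀ i, x₂ i ⟶ x₃ i} {g₁ : ∀ i, x₀ i ⟶ x₄ i}
    {g₂ : ∀ i, x₄ i ⟶ x₃ i} (h : ∀ i, f₁ i ≫ f₂ i ≫ f₃ i = g₁ i ≫ g₂ i) :
    s.map (X := ⟨n, x₀⟩) (Y := ⟨n, x₁⟩) (homOver f₁) ≫
        s.map (X := ⟨n, x₁⟩) (Y := ⟨n, x₂⟩) (homOver f₂) ≫
        s.map (X := ⟨n, x₂⟩) (Y := ⟨n, x₃⟩) (homOver f₃) =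
      s.map (X := ⟨n, x₀⟩) (Y := ⟨n, x₄⟩) (homOver g₁) ≫
        s.map (X := ⟨n, x₄⟩) (Y := ⟨n, x₃⟩) (homOver g₂) := by
  rw [← s.map_comp, ← s.map_comp, ← s.map_comp]
  refine congrArg s.map ?_
  rw [← homOver_comp, ← homOver_comp, ← homOver_comp]
  exact congrArg homOver (funext h)

theorem map_comp_eq_comp₃ {C : Type u₁} [Category.{v₁} C] {C' : Type u₂} [Category.{v₂} C']
    (F : C ⥤ C') {X₀ X₁ X₂ X₃ Y₁ : C} {f₁ : X₀ ⟶ Y₁} {f₂ : Y₁ ⟶ X₃} {g₁ : X₀ ⟶ X₁} {g₂ : X₁ ⟶ X₂}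
    {g₃ : X₂ ⟶ X₃} (h : f₁ ≫ f₂ = g₁ ≫ g₂ ≫ g₃) :
    F.map f₁ ≫ F.map f₂ = F.map g₁ ≫ F.map g₂ ≫ F.map g₃ := by
  simp only [← F.map_comp, h]

section Extension

variable {a : PseudoAlgebraStr (monoidalTwoMonad κ) A} {d : PseudoAlgebraStr (monoidalTwoMonad κ) D}
  {e : PseudoAlgebraStr (monoidalTwoMonad κ) E} {y : A ⟶ D} (Y : PseudoMorphismStr a d y)
  {f : A ⟶ E} (F : PseudoMorphismStr a e f) {g : D ⟶ E} (η : f ≅ y ≫ g)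

/-- The restriction of the cell of an extended pseudomorphism. -/
def extensionCell : mapFunctor y.toFunctor ⋙ mapFunctor g.toFunctor ⋙ e.func ≅
    mapFunctor y.toFunctor ⋙ d.func ⋙ g.toFunctor :=
  (Functor.isoWhiskerRight (mapFunctorIso (Cat.Hom.toNatIso η)) e.func).symm ≪≫
    Cat.Hom.toNatIso F.cell ≪≫
    Functor.isoWhiskerLeft a.func (Cat.Hom.toNatIso η) ≪≫
    (Functor.isoWhiskerRight (Cat.Hom.toNatIso Y.cell) g.toFunctor).symm

variable {Y F η}

/-- The requirement that `η` be an algebra 2-cell fixes the cell of `g` on tuples from `A`; density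
extends it, and each coherence law is an equation out of a left extension, where it reduces to the
laws of `F` and `Y`. -/
theorem exists_extension
    (h₀ : Dense y.toFunctor g.toFunctor)
    (h₁ : Dense (mapFunctor (κ := κ) y.toFunctor) (mapFunctor g.toFunctor ⋙ e.func))
    (h₁' : Dense (mapFunctor (κ := κ) y.toFunctor) (d.func ⋙ g.toFunctor))
    (h₂ : Dense (mapFunctor (κ := κ) (mapFunctor (κ := κ) y.toFunctor))
      (mapFunctor (mapFunctor g.toFunctor ⋙ e.func) ⋙ e.func)) :
    ∃ G : PseudoMorphismStr d e g, IsAlgebraTwoCell F (Y.comp G) η.hom := by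
  obtain ⟨φ, hφ⟩ := h₁.exists_iso h₁' (extensionCell Y F η)
  -- The defining equation of `φ`, freed of inverses; it is already the algebra 2-cell condition for
  -- `η`.
  have key : ∀ x : Tuples κ A,
      e.func.map ((mapNatTrans η.hom.toNatTrans).app x) ≫
          φ.hom.app ((mapFunctor y.toFunctor).obj x) ≫ g.toFunctor.map (Y.cellAt x).hom =
        (F.cellAt x).hom ≫ η.hom.toNatTrans.app (a.func.obj x) := fun x =>
    eq_comp₃_inv (m := e.func.mapIso ((mapFunctorIso (Cat.Hom.toNatIso η)).app x))
      (i := g.toFunctor.mapIso (Y.cellAt x)) (hφ x)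
  have c₁ : ∀ x : Tuples κ (Tuples κ D),
      (e.assocAt ((mapFunctor (mapFunctor g.toFunctor)).obj x)).hom ≫ φ.hom.app (flattenObj x) =
      e.func.map ((mapNatTrans φ.hom).app x) ≫ φ.hom.app ((mapFunctor d.func).obj x) ≫
        g.toFunctor.map (d.assocAt x).hom := by
    have key₂ := h₂.ext (H := flatten κ D ⋙ d.func ⋙ g.toFunctor)
      (α := Functor.whiskerLeft (mapFunctor (mapFunctor g.toFunctor)) e.assoc.hom.toNatTrans ≫
        Functor.whiskerLeft (flatten κ D) φ.hom)
      (β := Functor.whiskerRight (mapNatTrans φ.hom) e.func ≫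
        Functor.whiskerLeft (mapFunctor d.func) φ.hom ≫
        Functor.whiskerRight d.assoc.hom.toNatTrans g.toFunctor) (by
        intro x
        let Sη := mapNatTrans (κ := κ) η.hom.toNatTrans
        let SSη := mapFunctorIso (κ := κ) (mapFunctorIso (κ := κ) (Cat.Hom.toNatIso η))
        let SY : mapFunctor (κ := κ) (mapFunctor (κ := κ) y.toFunctor ⋙ d.func) ≅
            mapFunctor (a.func ⋙ y.toFunctor) :=
          mapFunctorIso (Cat.Hom.toNatIso Y.cell)
        refine extension_assoc_of_components
          (M := e.func.mapIso ((mapFunctor e.func).mapIso (SSη.app x)))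
          (N := (e.assocAt ((mapFunctor (mapFunctor f.toFunctor)).obj x)).hom)
          (Λ₁ := e.func.map (Sη.app (flattenObj x)))
          (gYf := g.toFunctor.mapIso (Y.cellAt (flattenObj x)))
          (K := e.func.mapIso ((mapFunctor g.toFunctor).mapIso (SY.app x)))
          (Λ₂ := e.func.map (Sη.app ((mapFunctor a.func).obj x)))
          (l := g.toFunctor.mapIso (d.func.mapIso (SY.app x)))
          (gYa := g.toFunctor.mapIso (Y.cellAt ((mapFunctor a.func).obj x)))
          (gyα := g.toFunctor.map (y.toFunctor.map (a.assocAt x).hom))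
          ?_ (key (flattenObj x)) (F.cellAt_assoc x) (η.hom.toNatTrans.naturality (a.assocAt x).hom)
          ?_ (φ.hom.naturality (SY.app x).hom) (key ((mapFunctor a.func).obj x)) ?_
        · exact (e.assocAt_naturality (SSη.app x).hom).trans
            (congrArg (fun t => (e.assocAt _).hom ≫ e.func.map t) (flatten_homOver η.hom.toNatTrans x))
        · exact (congrArg₂ (fun t t' => e.func.map t ≫ e.func.map ((mapNatTrans φ.hom).app
            ((mapFunctor (mapFunctor y.toFunctor)).obj x)) ≫ e.func.map t')
            (mapFunctor_homOver e.func
              fun i => (mapNatTrans η.hom.toNatTrans).app (Tuples.get x i))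
            (mapFunctor_homOver g.toFunctor fun i => (Y.cellAt (Tuples.get x i)).hom)).trans
            (homOver_comp_eq e.func
              (f₁ := fun i => e.func.map ((mapNatTrans η.hom.toNatTrans).app (x.get i)))
              (f₂ := fun i => φ.hom.app ((mapFunctor y.toFunctor).obj (x.get i)))
              (f₃ := fun i => g.toFunctor.map (Y.cellAt (x.get i)).hom)
              (g₁ := fun i => (F.cellAt (x.get i)).hom)
              (g₂ := fun i => η.hom.toNatTrans.app (a.func.obj (x.get i))) fun i => key (x.get i))
        · exact map_comp_eq_comp₃ g.toFunctor (Y.cellAt_assoc x))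
    intro x
    exact congrArg (fun t => t.app x) key₂
  have c₂ : ∀ x : D, (e.unitAt (g.toFunctor.obj x)).hom ≫ φ.hom.app ((unitFunctor κ D).obj x) =
      g.toFunctor.map (d.unitAt x).hom := by
    -- The unit law starts at `g` itself, so it is tested on `A` by `h₀`; this needs its left side
    -- as a natural transformation.
    let α : g.toFunctor ⟶ unitFunctor κ D ⋙ d.func ⋙ g.toFunctor :=
      { app := fun x => (e.unitAt (g.toFunctor.obj x)).hom ≫ φ.hom.app ((unitFunctor κ D).obj x)
        naturality := fun x x' h => naturality_comp (e.unitAt_naturality (g.toFunctor.map h))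
          ((congrArg (fun t => e.func.map t ≫ φ.hom.app _)
            (mapFunctor_homOver g.toFunctor fun _ => h).symm).trans
            (φ.hom.naturality ((unitFunctor κ D).map h))) }
    have key₂ := h₀.ext (α := α) (β := Functor.whiskerRight d.unit.hom.toNatTrans g.toFunctor)
      (fun x => extension_unit_of_components (M := (Cat.Hom.toNatIso η).app x)
        (N := (e.unitAt (f.toFunctor.obj x)).hom)
        (Λ₁ := e.func.map ((mapNatTrans η.hom.toNatTrans).app ((unitFunctor κ A).obj x)))
        (gY := g.toFunctor.mapIso (Y.cellAt ((unitFunctor κ A).obj x)))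
        (gyυ := g.toFunctor.map (y.toFunctor.map (a.unitAt x).hom))
        (e.unitAt_naturality (η.hom.toNatTrans.app x)) (key ((unitFunctor κ A).obj x))
        (F.cellAt_unit x) (η.hom.toNatTrans.naturality (a.unitAt x).hom)
        ((g.toFunctor.map_comp _ _).symm.trans (congrArg g.toFunctor.map (Y.cellAt_unit x))))
    intro x
    exact congrArg (fun t => t.app x) key₂
  let G : PseudoMorphismStr d e g :=
    { cell := Cat.Hom.isoMk φ
      assoc_coherence := (PseudoMorphismStr.assoc_coherence_iff (a := d) (b := e) (f := g)
        (Cat.Hom.isoMk φ) _ _ _ _ _).2 c₁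
      unit_coherence := (PseudoMorphismStr.unit_coherence_iff (a := d) (b := e) (f := g)
        (Cat.Hom.isoMk φ) _ _ _).2 c₂ }
  refine ⟨G, (isAlgebraTwoCell_iff _ _ _).2 fun x => ?_⟩
  exact (congrArg (e.func.map _ ≫ ·) (PseudoMorphismStr.comp_cellAt Y G x)).trans (key x)

end Extension

section TwoCells

variable {a : PseudoAlgebraStr (monoidalTwoMonad κ) A} {d : PseudoAlgebraStr (monoidalTwoMonad κ) D}
  {e : PseudoAlgebraStr (monoidalTwoMonad κ) E}

theorem IsAlgebraTwoCell.comp {f g h : A ⟶ D} {F : PseudoMorphismStr a d f}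
    {G : PseudoMorphismStr a d g} {H : PseudoMorphismStr a d h} {α : f ⟶ g} {β : g ⟶ h}
    (hα : IsAlgebraTwoCell F G α) (hβ : IsAlgebraTwoCell G H β) :
    IsAlgebraTwoCell F H (α ≫ β) := by
  unfold IsAlgebraTwoCell at *
  rw [(monoidalTwoMonad κ).S.map₂_comp, comp_whiskerRight, Category.assoc, hβ, reassoc_of% hα,
    ← whiskerLeft_comp]

/-- An invertible algebra 2-cell can be cancelled on the left. Applied with `α` the cell `f ≅ f* y`.
-/
theorem IsAlgebraTwoCell.of_comp {f g h : A ⟶ D} {F : PseudoMorphismStr a d f}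
    {G : PseudoMorphismStr a d g} {H : PseudoMorphismStr a d h} {α : f ≅ g} {β : g ⟶ h}
    (hα : IsAlgebraTwoCell F G α.hom) (hβ : IsAlgebraTwoCell F H (α.hom ≫ β)) :
    IsAlgebraTwoCell G H β := by
  unfold IsAlgebraTwoCell at *
  rw [← cancel_epi (((monoidalTwoMonad κ).S.map₂ α.hom) ▷ d.str), reassoc_of% hα, ← whiskerLeft_comp,
    ← hβ, (monoidalTwoMonad κ).S.map₂_comp, comp_whiskerRight, Category.assoc]

theorem IsAlgebraTwoCell.whiskerRight {f f' : A ⟶ D} {F : PseudoMorphismStr a d f}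
    {F' : PseudoMorphismStr a d f'} {α : f ⟶ f'} (hα : IsAlgebraTwoCell F F' α) {g : D ⟶ E}
    (G : PseudoMorphismStr d e g) : IsAlgebraTwoCell (F.comp G) (F'.comp G) (α ▷ g) := by
  rw [isAlgebraTwoCell_iff] at *
  intro x
  rw [PseudoMorphismStr.comp_cellAt, PseudoMorphismStr.comp_cellAt]
  have h₁ := (congrArg (fun t => e.func.map t ≫ (G.cellAt _).hom)
    (mapFunctor_homOver g.toFunctor fun i => α.toNatTrans.app (Tuples.get x i)).symm).trans
    (G.cellAt_naturality ((mapNatTrans α.toNatTrans).app x))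
  have h₂ := (g.toFunctor.map_comp _ _).symm.trans
    ((congrArg g.toFunctor.map (hα x)).trans (g.toFunctor.map_comp _ _))
  exact naturality_comp h₁ h₂

/-- The condition sees a pseudomorphism structure only through the components of its cell. This lets
a threefold composite be rebracketed. -/
theorem IsAlgebraTwoCell.congr {f f' : A ⟶ D} {F G : PseudoMorphismStr a d f}
    {F' G' : PseudoMorphismStr a d f'} {α : f ⟶ f'} (h : IsAlgebraTwoCell F F' α)
    (e₁ : ∀ x, (F.cellAt x).hom = (G.cellAt x).hom) (e₂ : ∀ x, (F'.cellAt x).hom = (G'.cellAt x).hom) :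
    IsAlgebraTwoCell G G' α := by
  rw [isAlgebraTwoCell_iff] at *
  intro x
  rw [← e₁, ← e₂, h x]

theorem PseudoMorphismStr.comp_assoc_cellAt {E' : Cat.{v, u}}
    {e' : PseudoAlgebraStr (monoidalTwoMonad κ) E'} {f : A ⟶ D} {g : D ⟶ E} {h : E ⟶ E'}
    (F : PseudoMorphismStr a d f) (G : PseudoMorphismStr d e g) (H : PseudoMorphismStr e e' h)
    (x : Tuples κ A) : (((F.comp G).comp H).cellAt x).hom =
      ((F.comp (G.comp H) : PseudoMorphismStr a e' (f ≫ g ≫ h)).cellAt x).hom := by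
  rw [PseudoMorphismStr.comp_cellAt, PseudoMorphismStr.comp_cellAt, PseudoMorphismStr.comp_cellAt,
    PseudoMorphismStr.comp_cellAt]
  exact (congrArg (_ ≫ ·) (h.toFunctor.map_comp _ _)).trans (Category.assoc _ _ _).symm

theorem right_unit_of_components {C : Type u₁} [Category.{v₁} C] {X₀ X₁ : C} {b : X₀ ⟶ X₀}
    {i : X₀ ⟶ X₀} {f f' : X₀ ⟶ X₁} (hb : b = 𝟙 _) (hi : i = 𝟙 _) (hf : f' = f) :
    b ≫ i ≫ f' = f ≫ 𝟙 _ := by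
  subst hb hi hf
  simp

theorem IsAlgebraTwoCell.rightUnitor_inv {f : A ⟶ D} (F : PseudoMorphismStr a d f) :
    IsAlgebraTwoCell F (F.comp (PseudoMorphismStr.id d)) (ρ_ f).inv := by
  rw [isAlgebraTwoCell_iff]
  intro x
  rw [PseudoMorphismStr.comp_cellAt]
  exact right_unit_of_components
    ((congrArg d.func.map (homOver_id fun i => f.toFunctor.obj (Tuples.get x i))).trans
      (d.func.map_id _))
    (PseudoMorphismStr.id_cellAt _) rfl

theorem test_of_components {C : Type u₁} [Category.{v₁} C] {X₀ X₁ X₂ Y₁ Y₂ Z : C}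
    {b : X₀ ⟶ X₁} {G' : X₁ ⟶ X₂} {Y' : X₂ ≅ Z} {G : X₀ ⟶ Y₁} {Yg : Y₁ ⟶ Y₂} {βa : Y₂ ⟶ Z}
    {βs : Y₁ ⟶ X₂} (h : b ≫ G' ≫ Y'.hom = (G ≫ Yg) ≫ βa) (h' : Yg ≫ βa = βs ≫ Y'.hom) :
    b ≫ G' = G ≫ βs := by
  rw [← cancel_mono Y'.hom, Category.assoc, Category.assoc, h, Category.assoc, h']

/-- Algebra 2-cells out of an extension can be tested on the restriction. -/
theorem IsAlgebraTwoCell.of_whiskerLeft {y : A ⟶ D} {Y : PseudoMorphismStr a d y} {g g' : D ⟶ E}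
    {G : PseudoMorphismStr d e g} {G' : PseudoMorphismStr d e g'} {β : g ⟶ g'}
    (hd : Dense (mapFunctor (κ := κ) y.toFunctor) (mapFunctor g.toFunctor ⋙ e.func))
    (h : IsAlgebraTwoCell (Y.comp G) (Y.comp G') (y ◁ β)) : IsAlgebraTwoCell G G' β := by
  refine Cat.Hom₂.ext (hd.ext (H := d.func ⋙ g'.toFunctor) fun x => ?_)
  have hx := (isAlgebraTwoCell_iff _ _ _).1 h x
  rw [PseudoMorphismStr.comp_cellAt, PseudoMorphismStr.comp_cellAt] at hx
  -- The hypothesis gives the required square followed by the invertible cell of `Y` under `g'`;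
  -- naturality of `β` moves that cell to the end, where it cancels.
  exact test_of_components (Y' := g'.toFunctor.mapIso (Y.cellAt x)) hx
    (β.toNatTrans.naturality (Y.cellAt x).hom)

end TwoCells

end PseudoLift

/-! ### The lifting of the presheaf construction -/

namespace PseudoLift
attribute [local instance] uliftCategory

namespace Presheaf
open Tuples

variable {κ : MonoidalKind}

section Dense

variable {A B : Cat.{u, u}}

/-- The unit starts at the universe-lifted copy of `A`, so it is Yoneda preceded by an equivalence,
and density is insensitive to that. The next three lemmas are the same under iterated tuples. -/
theorem Good.dense_unit {G : (Aᵒᵖ ⥤ Type u) ⥤ Bᵒᵖ ⥤ Type u} (h : Good CategoryTheory.yoneda G) :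
    Dense (unit A).toFunctor G :=
  h.dense.precomp (ULift.equivalence (C := A)).symm

theorem Good.dense_map_unit {G : Tuples κ (Aᵒᵖ ⥤ Type u) ⥤ Bᵒᵖ ⥤ Type u}
    (h : Good (mapFunctor CategoryTheory.yoneda) G) :
    Dense (mapFunctor (κ := κ) (unit A).toFunctor) G :=
  h.dense.precomp (mapEquivalence (ULift.equivalence (C := A)).symm)

theorem Good.dense_map_map_unit {G : Tuples κ (Tuples κ (Aᵒᵖ ⥤ Type u)) ⥤ Bᵒᵖ ⥤ Type u}
    (h : Good (mapFunctor (mapFunctor CategoryTheory.yoneda)) G) :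
    Dense (mapFunctor (κ := κ) (mapFunctor (κ := κ) (unit A).toFunctor)) G :=
  h.dense.precomp (mapEquivalence (mapEquivalence (ULift.equivalence (C := A)).symm))

theorem Good.dense_map_map_map_unit
    {G : Tuples κ (Tuples κ (Tuples κ (Aᵒᵖ ⥤ Type u))) ⥤ Bᵒᵖ ⥤ Type u}
    (h : Good (mapFunctor (mapFunctor (mapFunctor CategoryTheory.yoneda))) G) :
    Dense (mapFunctor (κ := κ) (mapFunctor (κ := κ) (mapFunctor (κ := κ) (unit A).toFunctor))) G :=
  h.dense.precomp (mapEquivalence (mapEquivalence (mapEquivalence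
    (ULift.equivalence (C := A)).symm)))

end Dense

variable (X Y Z : StrictAlgebra (monoidalTwoMonad.{u, u} κ))

/-- The strict algebra `J X` as a pseudoalgebra. -/
abbrev smallAlgebra :
    PseudoAlgebraStr (monoidalTwoMonad.{u, u + 1} κ) (inclusion.{u}.obj X.obj) :=
  ((monoidalRestriction κ).lift X).alg.toPseudo

/-- Transfer of the structure of `X` to Day convolution. The structure functor is recorded because
the algebra is later taken by choice, while the stability properties of `Good` are about
`dayConvolution`. -/
theorem exists_presheafAlgebra :
    ∃ d : PseudoAlgebraStr (monoidalTwoMonad κ) (Cat.of (X.objᵒᵖ ⥤ Type u)),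
      d.func = dayConvolution X.alg.str.toFunctor ∧
        Nonempty (PseudoMorphismStr (smallAlgebra X) d (unit X.obj)) :=
  have h₁ := Good.dayConvolution (κ := κ) X.alg.str.toFunctor
  have h₂ := h₁.mapFunctor_comp_dayConvolution X.alg.str.toFunctor
  exists_transfer (Functor.isoWhiskerLeft (mapFunctor (down X.obj))
      (dayConvolutionYoneda X.alg.str.toFunctor))
    good_yoneda_id.dense_unit h₁.unitFunctor_comp.dense_unit h₁.dense_map_unit
    h₂.dense_map_map_unit h₁.flatten_comp.dense_map_map_unit
    (h₂.mapFunctor_comp_dayConvolution X.alg.str.toFunctor).dense_map_map_map_unit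

/-- The pseudoalgebra of presheaves on a strict algebra. -/
noncomputable def presheafAlgebra :
    PseudoAlgebraStr (monoidalTwoMonad κ) (Cat.of (X.objᵒᵖ ⥤ Type u)) :=
  (exists_presheafAlgebra X).choose

theorem presheafAlgebra_func :
    (presheafAlgebra X).func = dayConvolution X.alg.str.toFunctor :=
  (exists_presheafAlgebra X).choose_spec.1

/-- The Yoneda embedding as a pseudomorphism. -/
noncomputable def unitMorphism :
    PseudoMorphismStr (smallAlgebra X) (presheafAlgebra X) (unit X.obj) :=
  (exists_presheafAlgebra X).choose_spec.2.some

variable {X Y Z}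

theorem good_presheafAlgebra {W : Type (u + 1)} [Category.{u} W] {A : Type u} [Category.{u} A]
    {j : A ⥤ W} {G : W ⥤ Y.objᵒᵖ ⥤ Type u} (h : Good j G) :
    Good (mapFunctor (κ := κ) j) (mapFunctor G ⋙ (presheafAlgebra Y).func) := by
  rw [presheafAlgebra_func]
  exact h.mapFunctor_comp_dayConvolution _

theorem dense_map_extend (f : inclusion.{u}.obj X.obj ⟶ Cat.of (Y.objᵒᵖ ⥤ Type u)) :
    Dense (mapFunctor (κ := κ) (unit X.obj).toFunctor)
      (mapFunctor ((ext X.obj Y.obj).obj f).toFunctor ⋙ (presheafAlgebra Y).func) :=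
  (good_presheafAlgebra (good_yoneda_extend (toFun f))).dense_map_unit

/-- All density hypotheses follow from `f*` being an extension along Yoneda: the composites with Day
convolution on `Y` come from the stability under tuples, and Day convolution on `X` followed by `f*`
from composition with `extend`. -/
theorem exists_extMorphism {f : inclusion.{u}.obj X.obj ⟶ Cat.of (Y.objᵒᵖ ⥤ Type u)}
    (F : PseudoMorphismStr (smallAlgebra X) (presheafAlgebra Y) f) :
    ∃ G : PseudoMorphismStr (presheafAlgebra X) (presheafAlgebra Y) ((ext X.obj Y.obj).obj f),
      IsAlgebraTwoCell F ((unitMorphism X).comp G) (catEta f).hom := by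
  have h := good_yoneda_extend (toFun f)
  refine exists_extension h.dense_unit (dense_map_extend f) ?_
    (good_presheafAlgebra (good_presheafAlgebra h)).dense_map_map_unit
  rw [presheafAlgebra_func]
  exact ((Good.dayConvolution _).comp_extend _).dense_map_unit

/-- The extension of a pseudomorphism to presheaves. -/
noncomputable def extMorphism {f : inclusion.{u}.obj X.obj ⟶ Cat.of (Y.objᵒᵖ ⥤ Type u)}
    (F : PseudoMorphismStr (smallAlgebra X) (presheafAlgebra Y) f) :
    PseudoMorphismStr (presheafAlgebra X) (presheafAlgebra Y) ((ext X.obj Y.obj).obj f) :=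
  (exists_extMorphism F).choose

theorem eta_isAlgebraTwoCell {f : inclusion.{u}.obj X.obj ⟶ Cat.of (Y.objᵒᵖ ⥤ Type u)}
    (F : PseudoMorphismStr (smallAlgebra X) (presheafAlgebra Y) f) :
    IsAlgebraTwoCell F ((unitMorphism X).comp (extMorphism F)) (catEta f).hom :=
  (exists_extMorphism F).choose_spec

/-- Identifies `mu` on representables: both sides send `[y, s, r]` to `[y, s, [x, r, 1]]`. -/
theorem eta_mu {A B C : Cat.{u, u}} (f : inclusion.{u}.obj A ⟶ Cat.of (Bᵒᵖ ⥤ Type u))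
    (g : inclusion.{u}.obj B ⟶ Cat.of (Cᵒᵖ ⥤ Type u)) :
    (catEta (f ≫ (ext B C).obj g)).hom ≫ unit A ◁ (catMu f g).hom =
      (catEta f).hom ▷ (ext B C).obj g := by
  refine Cat.Hom₂.ext ?_
  ext x : 2
  refine hom_ext_apply fun z a => ?_
  induction a using Coend.ind with | _ y s r
  rfl

theorem eta_theta (A : Cat.{u, u}) :
    (catEta (unit A)).hom ≫ unit A ◁ (catTheta A).hom = (ρ_ (unit A)).inv := by
  refine Cat.Hom₂.ext ?_
  ext x : 2
  refine hom_ext_apply fun z (s : z.unop ⟶ x.down) => ?_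
  exact Category.comp_id s

/-- Tested on representables and preceded by the invertible `eta` of `f`, the cell `α*` becomes, by
naturality, `α` followed by the `eta` of `f'`, a composite of algebra 2-cells. -/
theorem ext_map_isAlgebraTwoCell {f f' : inclusion.{u}.obj X.obj ⟶ Cat.of (Y.objᵒᵖ ⥤ Type u)}
    {F : PseudoMorphismStr (smallAlgebra X) (presheafAlgebra Y) f}
    {F' : PseudoMorphismStr (smallAlgebra X) (presheafAlgebra Y) f'} {α : f ⟶ f'}
    (hα : IsAlgebraTwoCell F F' α) :
    IsAlgebraTwoCell (extMorphism F) (extMorphism F') ((ext X.obj Y.obj).map α) := by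
  refine IsAlgebraTwoCell.of_whiskerLeft (Y := unitMorphism X) (dense_map_extend f) ?_
  refine IsAlgebraTwoCell.of_comp (eta_isAlgebraTwoCell F) ?_
  have h := (presheafPseudomonad.{u}.eta_naturality α).symm
  exact Eq.mpr (congrArg (IsAlgebraTwoCell F ((unitMorphism X).comp (extMorphism F'))) h)
    (hα.comp (eta_isAlgebraTwoCell F'))

/-- The same reduction turns `mu` into the `eta` of `f` whiskered by `g*`, an algebra 2-cell because
`g*` is a pseudomorphism. -/
theorem mu_isAlgebraTwoCell {f : inclusion.{u}.obj X.obj ⟶ Cat.of (Y.objᵒᵖ ⥤ Type u)}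
    {g : inclusion.{u}.obj Y.obj ⟶ Cat.of (Z.objᵒᵖ ⥤ Type u)}
    (F : PseudoMorphismStr (smallAlgebra X) (presheafAlgebra Y) f)
    (G : PseudoMorphismStr (smallAlgebra Y) (presheafAlgebra Z) g) :
    IsAlgebraTwoCell (extMorphism (F.comp (extMorphism G)))
      ((extMorphism F).comp (extMorphism G)) (catMu f g).hom := by
  refine IsAlgebraTwoCell.of_whiskerLeft (Y := unitMorphism X)
    (dense_map_extend (f ≫ (ext Y.obj Z.obj).obj g)) ?_
  refine IsAlgebraTwoCell.of_comp (eta_isAlgebraTwoCell (F.comp (extMorphism G))) ?_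
  exact Eq.mpr (congrArg (IsAlgebraTwoCell (F.comp (extMorphism G))
      ((unitMorphism X).comp ((extMorphism F).comp (extMorphism G)))) (eta_mu f g))
    (((eta_isAlgebraTwoCell F).whiskerRight (extMorphism G)).congr (fun _ => rfl)
      (fun x => PseudoMorphismStr.comp_assoc_cellAt _ _ _ x))

/-- The same reduction turns `theta` into an inverse unitor, by `eta_theta`. -/
theorem theta_isAlgebraTwoCell :
    IsAlgebraTwoCell (extMorphism (unitMorphism X)) (PseudoMorphismStr.id (presheafAlgebra X))
      (catTheta X.obj).hom := by
  refine IsAlgebraTwoCell.of_whiskerLeft (Y := unitMorphism X) (dense_map_extend (unit X.obj)) ?_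
  refine IsAlgebraTwoCell.of_comp (eta_isAlgebraTwoCell (unitMorphism X)) ?_
  exact Eq.mpr (congrArg (IsAlgebraTwoCell (unitMorphism X)
    ((unitMorphism X).comp (PseudoMorphismStr.id (presheafAlgebra X)))) (eta_theta X.obj))
    (IsAlgebraTwoCell.rightUnitor_inv _)

end Presheaf

end PseudoLift

theorem theorem7p4 (κ : PseudoLift.MonoidalKind) :
    Nonempty (PseudoLift.PseudoLifting PseudoLift.presheafPseudomonad.{u}
      (PseudoLift.monoidalRestriction.{u} κ)) :=
  ⟨{ alg := PseudoLift.Presheaf.presheafAlgebra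
     ext := PseudoLift.Presheaf.extMorphism
     unit := PseudoLift.Presheaf.unitMorphism
     ext_map := fun _ _ _ hα => PseudoLift.Presheaf.ext_map_isAlgebraTwoCell hα
     mu := fun F G => PseudoLift.Presheaf.mu_isAlgebraTwoCell F G
     eta := PseudoLift.Presheaf.eta_isAlgebraTwoCell
     theta := fun _ => PseudoLift.Presheaf.theta_isAlgebraTwoCell }⟩
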